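/- Let $k$ be a field of characteristic $3$. **Symmetric composition superalgebras.** Let $S_2$ be the split para-Hurwitz algebra of dimension $2$ (purely even): it has a basis $\{e^+,e^-\}$ with $e^\pm\bullet e^\pm=e^\mp$, $e^\pm\bullet e^\mp=0$ and symmetric bilinear form $b(e^\pm,e^\pm)=0$, $b(e^+,e^-)=1$. Let $S_{1,2}=k1\oplus V$ be the para-Hurwitz superalgebra of the Hurwitz superalgebra $B(1,2)$: the even part is $k1$, the odd part is a two-dimensional space $V$ with a nonzero alternating form $\langle\cdot|\cdot\rangle$, and $1\bullet 1=1$, $1\bullet v=v\bullet 1=-v$, $u\bullet v=\langle u|v\rangle 1$, $b(1,1)=2$, $b(1,v)=b(v,1)=0$, $b(u,v)=\langle u|v\rangle$ for $u,v\in V$. **The superalgebra $\mathfrak g(S,S')$.** For such a superalgebra $S$ let $\mathfrak{osp}(S)_i$ ($i\in\mathbb Z/2$) be the space of endomorphisms $d$ of parity $i$ with $b(d(x),y)+(-1)^{i|x|}b(x,d(y))=0$, and let $\mathfrak{tri}(S)=\mathfrak{tri}(S)_{\bar0}\oplus\mathfrak{tri}(S)_{\bar1}$, where $\mathfrak{tri}(S)_i$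 is the space of triples $(d_0,d_1,d_2)\in\mathfrak{osp}(S)_i^3$ with $d_0(x\bullet y)=d_1(x)\bullet y+(-1)^{i|x|}x\bullet d_2(y)$ for all homogeneous $x,y$; its bracket is the componentwise supercommutator. Put $\theta(d_0,d_1,d_2)=(d_2,d_0,d_1)$ and $$t_{x,y}=\bigl(\sigma_{x,y},\ \tfrac12 b(x,y)1-r_xl_y,\ \tfrac12 b(x,y)1-l_xr_y\bigr)\in\mathfrak{tri}(S),$$ where $l_x(y)=x\bullet y$, $r_x(y)=(-1)^{|x||y|}y\bullet x$ and $\sigma_{x,y}(z)=(-1)^{|y||z|}b(x,z)y-(-1)^{|x|(|y|+|z|)}b(y,z)x$. Then $$\mathfrak g(S,S')=\bigl(\mathfrak{tri}(S)\oplus\mathfrak{tri}(S')\bigr)\oplus\bigoplus_{i=0}^{2}\iota_i(S\otimes S'),$$ where the $\iota_i(S\otimes S')$ are three copies of $S\otimes S'$, with the superanticommutative product such that $\mathfrak{tri}(S)\oplus\mathfrak{tri}(S')$ is a subalgebra and direct sum of its two summands, and (indices modulo $3$, homogeneous arguments, primes denoting the analogous objects of $S'$) $$[(d_0,d_1,d_2),\iota_i(x\otimes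 x')]=\iota_i(d_i(x)\otimes x'),\qquad [(d'_0,d'_1,d'_2),\iota_i(x\otimes x')]=(-1)^{|d'_i||x|}\iota_i(x\otimes d'_i(x')),$$ $$[\iota_i(x\otimes x'),\iota_{i+1}(y\otimes y')]=(-1)^{|x'||y|}\iota_{i+2}\bigl((x\bullet y)\otimes(x'\bullet y')\bigr),$$ $$[\iota_i(x\otimes x'),\iota_i(y\otimes y')]=(-1)^{|x||x'|+|x||y'|+|y||y'|}b'(x',y')\theta^i(t_{x,y})+(-1)^{|y||x'|}b(x,y)\theta'^i(t'_{x',y'}).$$ **Contragredient Lie superalgebras.** A Lie superalgebra over $k$ is a $\mathbb Z/2$-graded superalgebra with a superanticommutative product satisfying the super Jacobi identity and $[x,[x,x]]=0$ for all odd $x$. A realization of an $n\times n$ matrix $A=(a_{ij})$ over $k$ is a finite-dimensional vector space $\mathfrak h$ with linearly independent $\alpha_1,\dots,\alpha_n\in\mathfrak h^*$ and linearly independent $h_1,\dots,h_n\in\mathfrak h$ such that $\alpha_j(h_i)=a_{ij}$ and $\dim\mathfrak h=2n-\operatorname{rank}A$. For $\tau\subseteq\{1,\dots,n\}$ let $\tilde{\mathfrak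 g}(A,\tau)$ be the Lie superalgebra generated by the (even) vector space $\mathfrak h$ and elements $e_i,f_i$ ($1\le i\le n$), odd if $i\in\tau$ and even otherwise, subject to $[e_i,f_j]=\delta_{ij}h_i$, $[h,h']=0$, $[h,e_i]=\alpha_i(h)e_i$, $[h,f_i]=-\alpha_i(h)f_i$. It is $\mathbb Z$-graded by $\deg h=0$, $\deg e_i=1=-\deg f_i$. Let $\mathfrak g(A,\tau)=\tilde{\mathfrak g}(A,\tau)/\mathfrak i(A)$, where $\mathfrak i(A)$ is the largest $\mathbb Z$-homogeneous ideal that intersects $\mathfrak h$ trivially, and let $\mathfrak c$ be the centre of $\mathfrak g(A,\tau)$. **Proposition.** Let $$A=\begin{pmatrix}2&-1&-1\\-1&2&-1\\1&1&0\end{pmatrix}$$ over $k$. Then $\mathfrak g(S_2,S_{1,2})$ is a Lie superalgebra, and the following hold. 1. For every realization of $A$, $\mathfrak g(S_2,S_{1,2})$ is isomorphic, as a Lie superalgebra, to the centerless contragredient Lie superalgebra $\mathfrak g(A,\{3\})/\mathfrak c$. 2. $\mathfrak g(S_2,S_{1,2})$ is not simple, but its derived superalgebra $[\mathfrak g(S_2,S_{1,2}),\mathfrak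 g(S_2,S_{1,2})]$ is an ideal of codimension $1$ that is a simple Lie superalgebra. 3. The even part of $\mathfrak g(S_2,S_{1,2})$ is isomorphic, as a Lie algebra, to $\mathfrak{pgl}_3(k)\oplus\mathfrak{sl}_2(k)$, where $\mathfrak{pgl}_3=\mathfrak{gl}_3/k1$. Under such an isomorphism the odd part is isomorphic, as a module for the even part, to $\mathfrak{psl}_3(k)\otimes k^2$, where $\mathfrak{psl}_3=\mathfrak{sl}_3/k1\subset\mathfrak{pgl}_3$ is the adjoint module of $\mathfrak{pgl}_3$ on this ideal and $k^2$ is the natural module of $\mathfrak{sl}_2$. -/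

import Mathlib

open scoped TensorProduct

noncomputable section

namespace MagicSquare

universe u v w

/-! ### Superspaces and superalgebras -/

section Super

/-- The sign `(-1)^a` attached to a parity `a`. -/
def sgn (k : Type u) [Ring k] (a : ZMod 2) : k := if a = 0 then 1 else -1

/-- A superspace: a vector space with a `ℤ/2`-grading, given by the two projections onto the even
and the odd part. -/
class SuperSpace (k : Type u) (V : Type v) [Field k] [AddCommGroup V] [Module k V] where
  proj : ZMod 2 → V →ₗ[k] V
  proj_proj : ∀ (i j : ZMod 2) (x : V), proj i (proj j x) = if i = j then proj j x else 0
  proj_add : ∀ x : V, proj 0 x + proj 1 x = x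

/-- A superspace with a bilinear product. That the product respects parities is part of the
predicates `IsSymmetricComposition` and `IsLieSuperalgebra` below. -/
class SuperProduct (k : Type u) (A : Type v) [Field k] [AddCommGroup A] [Module k A] extends
    SuperSpace k A where
  mul : A →ₗ[k] A →ₗ[k] A

variable (k : Type u) [Field k] {V : Type v} [AddCommGroup V] [Module k V]
  {W : Type w} [AddCommGroup W] [Module k W]

/-- The projection onto the homogeneous component of parity `i`. -/
abbrev pr [SuperSpace k V] (i : ZMod 2) : V →ₗ[k] V := SuperSpace.proj i

/-- The homogeneous component of parity `i`. -/
def part (V : Type v) [AddCommGroup V] [Module k V] [SuperSpace k V] (i : ZMod 2) :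
    Submodule k V :=
  LinearMap.eqLocus (pr k i) LinearMap.id

/-- The product of a superspace with product. -/
abbrev pmul [SuperProduct k V] : V →ₗ[k] V →ₗ[k] V := SuperProduct.mul

variable {k}

theorem mem_part [SuperSpace k V] {i : ZMod 2} {x : V} : x ∈ part k V i ↔ pr k i x = x := Iff.rfl

theorem pr_mem_part [SuperSpace k V] (i : ZMod 2) (x : V) : pr k i x ∈ part k V i := by
  simp [mem_part, SuperSpace.proj_proj]

theorem zmod2_cases (i : ZMod 2) : i = 0 ∨ i = 1 := by
  revert i; decide

/-- The direct product of two superspaces. -/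
instance [SuperSpace k V] [SuperSpace k W] : SuperSpace k (V × W) where
  proj i := (pr k i).prodMap (pr k i)
  proj_proj i j x := by
    by_cases h : i = j <;> simp [SuperSpace.proj_proj, h]
  proj_add x := by ext <;> simp [SuperSpace.proj_add]

instance [SuperSpace k V] {n : ℕ} : SuperSpace k (Fin n → V) where
  proj i := LinearMap.pi fun j => pr k i ∘ₗ LinearMap.proj j
  proj_proj i j x := by
    ext l
    by_cases h : i = j <;> simp [SuperSpace.proj_proj, h]
  proj_add x := by ext; simp [SuperSpace.proj_add]

/-- The endomorphism `d` has parity `i` if it maps the part of parity `a` into the part of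
parity `i + a`. -/
instance [SuperSpace k V] : SuperSpace k (Module.End k V) where
  proj i := LinearMap.llcomp k V V V (pr k i) ∘ₗ LinearMap.lcomp k V (pr k 0)
    + LinearMap.llcomp k V V V (pr k (i + 1)) ∘ₗ LinearMap.lcomp k V (pr k 1)
  proj_proj i j d := by
    ext x
    rcases zmod2_cases i with rfl | rfl <;> rcases zmod2_cases j with rfl | rfl <;>
      simp [SuperSpace.proj_proj, show (1 : ZMod 2) + 1 = 0 from rfl]
  proj_add d := by
    ext x
    have h := fun y => SuperSpace.proj_add (k := k) (d y)
    have h1 := h (pr k 0 x)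
    have h2 := h (pr k 1 x)
    have h3 := congrArg d (SuperSpace.proj_add (k := k) x)
    simp [show (1 : ZMod 2) + 1 = 0 from rfl]
    rw [map_add, ← h1, ← h2] at h3
    rw [← h3]; abel

/-- `x ⊗ y` has parity `|x| + |y|`. -/
instance [SuperSpace k V] [SuperSpace k W] : SuperSpace k (V ⊗[k] W) where
  proj i := TensorProduct.map (pr k 0) (pr k i) + TensorProduct.map (pr k 1) (pr k (i + 1))
  proj_proj i j x := by
    induction x using TensorProduct.induction_on with
    | zero => simp
    | tmul x y =>
      rcases zmod2_cases i with rfl | rfl <;> rcases zmod2_cases j with rfl | rfl <;>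
        simp [SuperSpace.proj_proj, show (1 : ZMod 2) + 1 = 0 from rfl]
    | add x y hx hy =>
      rw [map_add, map_add, hx, hy]
      split_ifs <;> simp
  proj_add x := by
    induction x using TensorProduct.induction_on with
    | zero => simp
    | tmul x y =>
      have h1 := SuperSpace.proj_add (k := k) x
      have h2 := SuperSpace.proj_add (k := k) y
      simp [show (1 : ZMod 2) + 1 = 0 from rfl]
      conv_rhs => rw [← h1, ← h2]
      simp only [TensorProduct.add_tmul, TensorProduct.tmul_add]
      abel
    | add x y hx hy =>
      conv_rhs => rw [← hx, ← hy]
      simp only [map_add]; abel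

/-- A submodule stable under the parity projections is a superspace. -/
abbrev SuperSpace.ofSubmodule [SuperSpace k V] (J : Submodule k V)
    (h : ∀ i, ∀ x ∈ J, pr k i x ∈ J) : SuperSpace k J where
  proj i := (pr k i).restrict (h i)
  proj_proj i j x := by
    ext
    by_cases h : i = j <;> simp [SuperSpace.proj_proj, h]
  proj_add x := by ext; simp [SuperSpace.proj_add]

/-- For a bilinear map `f`, the bilinear map `(x, y) ↦ (-1)^(|x||y|) f(y, x)`. -/
def superFlip [SuperSpace k V] (f : V →ₗ[k] V →ₗ[k] W) : V →ₗ[k] V →ₗ[k] W :=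
  ∑ a : ZMod 2, ∑ b : ZMod 2, sgn k (a * b) • f.flip.compl₁₂ (pr k a) (pr k b)

end Super

/-! ### Symmetric composition superalgebras -/

section Composition

/-- A superspace with a bilinear product and a bilinear form. -/
class FormProduct (k : Type u) (S : Type v) [Field k] [AddCommGroup S] [Module k S] extends
    SuperProduct k S where
  form : S →ₗ[k] S →ₗ[k] k

/-- A superspace with a bilinear product, a bilinear form and a distinguished element `one`. -/
class UnitalFormProduct (k : Type u) (S : Type v) [Field k] [AddCommGroup S] [Module k S] extends
    FormProduct k S where
  one : S

variable (k : Type u) [Field k]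

/-- The bilinear form of a `FormProduct`. -/
abbrev bform {S : Type v} [AddCommGroup S] [Module k S] [FormProduct k S] : S →ₗ[k] S →ₗ[k] k :=
  FormProduct.form

/-- Symmetric composition superalgebras over a field of characteristic different from `2`. The
quadratic form on the even part is then `q₀(x) = b(x,x)/2`, so that the quadratic superform
`(q₀, b)` is given by `b`, and `q₀` is regular if and only if `b` is nondegenerate on the
even part. -/
class IsSymmetricComposition (S : Type v) [AddCommGroup S] [Module k S] [FormProduct k S] : Prop where
  mul_mem : ∀ (i j : ZMod 2), ∀ x ∈ part k S i, ∀ y ∈ part k S j, pmul k x y ∈ part k S (i + j)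
  form_even : ∀ (i j : ZMod 2), i ≠ j → ∀ x ∈ part k S i, ∀ y ∈ part k S j, bform k x y = 0
  form_symm : ∀ x ∈ part k S 0, ∀ y ∈ part k S 0, bform k x y = bform k y x
  form_alt : ∀ x ∈ part k S 1, bform k x x = 0
  nondegenerate : ∀ x : S, (∀ y, bform k x y = 0) → x = 0
  norm_mul : ∀ x ∈ part k S 0, ∀ y ∈ part k S 0,
    bform k (pmul k x y) (pmul k x y) / 2 = (bform k x x / 2) * (bform k y y / 2)
  form_mul_left : ∀ x ∈ part k S 0, ∀ y z : S,
    bform k (pmul k x y) (pmul k x z) = (bform k x x / 2) * bform k y z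
  form_mul_right : ∀ x ∈ part k S 0, ∀ y z : S,
    bform k (pmul k y x) (pmul k z x) = (bform k x x / 2) * bform k y z
  composition : ∀ (a b c d : ZMod 2), ∀ x ∈ part k S a, ∀ y ∈ part k S b, ∀ z ∈ part k S c,
    ∀ t ∈ part k S d,
    bform k (pmul k x y) (pmul k z t)
      + sgn k (a * b + a * c + b * c) * bform k (pmul k z y) (pmul k x t)
      = sgn k (b * c) * (bform k x z * bform k y t)
  form_assoc : ∀ x y z : S, bform k (pmul k x y) z = bform k x (pmul k y z)

/-- The map `x ↦ x̄ = b(x,1)1 - x`. -/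
def conj {C : Type v} [AddCommGroup C] [Module k C] (h : UnitalFormProduct k C) : C →ₗ[k] C :=
  (h.form.flip h.one).smulRight h.one - LinearMap.id

/-- The para-Hurwitz superalgebra attached to a (Hurwitz) superalgebra `C`: the same superspace
and form, with the product `x • y = x̄ ȳ`. -/
abbrev paraHurwitz {C : Type v} [AddCommGroup C] [Module k C] (h : UnitalFormProduct k C) :
    FormProduct k C where
  toSuperSpace := h.toSuperSpace
  mul := h.mul.compl₁₂ (conj k h) (conj k h)
  form := h.form

/-- The vector space `k × k`. -/
@[ext] structure S2 (k : Type u) : Type u where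
  p : k
  m : k

/-- The vector space `k1 ⊕ V` with `V = k × k`; the vector `c1 + (u, v)` has coordinates
`c`, `u`, `v`. -/
@[ext] structure S12 (k : Type u) : Type u where
  c : k
  u : k
  v : k

namespace S2

variable {k}

def equiv : S2 k ≃ k × k where
  toFun x := (x.p, x.m)
  invFun x := ⟨x.1, x.2⟩
  left_inv _ := rfl
  right_inv _ := rfl

instance : AddCommGroup (S2 k) := equiv.addCommGroup

instance : Module k (S2 k) := equiv.module k

@[simp] theorem add_p (x y : S2 k) : (x + y).p = x.p + y.p := rfl
@[simp] theorem add_m (x y : S2 k) : (x + y).m = x.m + y.m := rfl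
@[simp] theorem sub_p (x y : S2 k) : (x - y).p = x.p - y.p := rfl
@[simp] theorem sub_m (x y : S2 k) : (x - y).m = x.m - y.m := rfl
@[simp] theorem neg_p (x : S2 k) : (-x).p = -x.p := rfl
@[simp] theorem neg_m (x : S2 k) : (-x).m = -x.m := rfl
@[simp] theorem zero_p : (0 : S2 k).p = 0 := rfl
@[simp] theorem zero_m : (0 : S2 k).m = 0 := rfl
@[simp] theorem smul_p (c : k) (x : S2 k) : (c • x).p = c * x.p := rfl
@[simp] theorem smul_m (c : k) (x : S2 k) : (c • x).m = c * x.m := rfl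

/-- The split Hurwitz algebra `k × k` of dimension `2`, with componentwise product and norm
`q(p, m) = p m`, concentrated in even parity. -/
abbrev hurwitz : UnitalFormProduct k (S2 k) where
  proj i := if i = 0 then LinearMap.id else 0
  proj_proj i j x := by
    rcases zmod2_cases i with rfl | rfl <;> rcases zmod2_cases j with rfl | rfl <;> simp
  proj_add x := by simp
  mul := LinearMap.mk₂ k (fun x y => ⟨x.p * y.p, x.m * y.m⟩)
    (fun _ _ _ => by ext <;> simp <;> ring) (fun _ _ _ => by ext <;> simp <;> ring)
    (fun _ _ _ => by ext <;> simp <;> ring) (fun _ _ _ => by ext <;> simp <;> ring)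
  form := LinearMap.mk₂ k (fun x y => x.p * y.m + x.m * y.p)
    (fun _ _ _ => by simp; ring) (fun _ _ _ => by simp; ring)
    (fun _ _ _ => by simp; ring) (fun _ _ _ => by simp; ring)
  one := ⟨1, 1⟩

/-- `S2 k` is the split para-Hurwitz algebra of dimension `2`. -/
instance : FormProduct k (S2 k) := paraHurwitz k hurwitz

theorem proj_eq (i : ZMod 2) (x : S2 k) : pr k i x = if i = 0 then x else 0 := by
  change (if i = 0 then LinearMap.id else 0 : S2 k →ₗ[k] S2 k) x = _
  split_ifs <;> rfl

theorem mul_eq (x y : S2 k) : pmul k x y = ⟨x.m * y.m, x.p * y.p⟩ := by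
  have h : ∀ z : S2 k, conj k hurwitz z = ⟨z.m, z.p⟩ := by
    intro z
    change (⟨(z.p * 1 + z.m * 1) * 1 - z.p, (z.p * 1 + z.m * 1) * 1 - z.m⟩ : S2 k) = _
    ext <;> simp
  change hurwitz.mul (conj k hurwitz x) (conj k hurwitz y) = _
  rw [h, h]; rfl

theorem form_eq (x y : S2 k) : bform k x y = x.p * y.m + x.m * y.p := rfl

end S2

namespace S12

variable {k}

def equiv : S12 k ≃ k × k × k where
  toFun x := (x.c, x.u, x.v)
  invFun x := ⟨x.1, x.2.1, x.2.2⟩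
  left_inv _ := rfl
  right_inv _ := rfl

instance : AddCommGroup (S12 k) := equiv.addCommGroup

instance : Module k (S12 k) := equiv.module k

@[simp] theorem add_c (x y : S12 k) : (x + y).c = x.c + y.c := rfl
@[simp] theorem add_u (x y : S12 k) : (x + y).u = x.u + y.u := rfl
@[simp] theorem add_v (x y : S12 k) : (x + y).v = x.v + y.v := rfl
@[simp] theorem sub_c (x y : S12 k) : (x - y).c = x.c - y.c := rfl
@[simp] theorem sub_u (x y : S12 k) : (x - y).u = x.u - y.u := rfl
@[simp] theorem sub_v (x y : S12 k) : (x - y).v = x.v - y.v := rfl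
@[simp] theorem neg_c (x : S12 k) : (-x).c = -x.c := rfl
@[simp] theorem neg_u (x : S12 k) : (-x).u = -x.u := rfl
@[simp] theorem neg_v (x : S12 k) : (-x).v = -x.v := rfl
@[simp] theorem zero_c : (0 : S12 k).c = 0 := rfl
@[simp] theorem zero_u : (0 : S12 k).u = 0 := rfl
@[simp] theorem zero_v : (0 : S12 k).v = 0 := rfl
@[simp] theorem smul_c (a : k) (x : S12 k) : (a • x).c = a * x.c := rfl
@[simp] theorem smul_u (a : k) (x : S12 k) : (a • x).u = a * x.u := rfl
@[simp] theorem smul_v (a : k) (x : S12 k) : (a • x).v = a * x.v := rfl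

/-- The alternating form on the `V`-component of `k1 ⊕ V`. -/
def alt (x y : S12 k) : k := x.u * y.v - x.v * y.u

/-- The superalgebra `B(1,2) = k1 ⊕ V`, where `V` has dimension `2` and carries the alternating
form `⟨·|·⟩`. Its even part is `k1` and its odd part is `V`; the element `1` is a unit,
`xy = ⟨x|y⟩1` for `x, y ∈ V`, and the form is given by `b(1,1) = 2`, `b(x,y) = ⟨x|y⟩`. -/
abbrev hurwitz : UnitalFormProduct k (S12 k) where
  proj i := if i = 0 then
      { toFun := fun x => ⟨x.c, 0, 0⟩
        map_add' := fun _ _ => by ext <;> simp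
        map_smul' := fun _ _ => by ext <;> simp }
    else
      { toFun := fun x => ⟨0, x.u, x.v⟩
        map_add' := fun _ _ => by ext <;> simp
        map_smul' := fun _ _ => by ext <;> simp }
  proj_proj i j x := by
    rcases zmod2_cases i with rfl | rfl <;> rcases zmod2_cases j with rfl | rfl <;> simp <;> rfl
  proj_add x := by ext <;> simp
  mul := LinearMap.mk₂ k
    (fun x y => ⟨x.c * y.c + alt x y, x.c * y.u + x.u * y.c, x.c * y.v + x.v * y.c⟩)
    (fun _ _ _ => by ext <;> simp [alt] <;> ring) (fun _ _ _ => by ext <;> simp [alt] <;> ring)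
    (fun _ _ _ => by ext <;> simp [alt] <;> ring) (fun _ _ _ => by ext <;> simp [alt] <;> ring)
  form := LinearMap.mk₂ k (fun x y => 2 * (x.c * y.c) + alt x y)
    (fun _ _ _ => by simp [alt]; ring) (fun _ _ _ => by simp [alt]; ring)
    (fun _ _ _ => by simp [alt]; ring) (fun _ _ _ => by simp [alt]; ring)
  one := ⟨1, 0, 0⟩

/-- `S12 k` is the para-Hurwitz superalgebra of `B(1,2)`. -/
instance : FormProduct k (S12 k) := paraHurwitz k hurwitz

theorem proj_eq (i : ZMod 2) (x : S12 k) :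
    pr k i x = if i = 0 then ⟨x.c, 0, 0⟩ else ⟨0, x.u, x.v⟩ := by
  rcases zmod2_cases i with rfl | rfl <;> rfl

theorem mul_eq (x y : S12 k) : pmul k x y =
    ⟨x.c * y.c + alt x y, -(x.c * y.u + x.u * y.c), -(x.c * y.v + x.v * y.c)⟩ := by
  have h : ∀ z : S12 k, conj k hurwitz z = ⟨z.c, -z.u, -z.v⟩ := by
    intro z
    change (⟨(2 * (z.c * 1) + (z.u * 0 - z.v * 0)) * 1 - z.c,
      (2 * (z.c * 1) + (z.u * 0 - z.v * 0)) * 0 - z.u,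
      (2 * (z.c * 1) + (z.u * 0 - z.v * 0)) * 0 - z.v⟩ : S12 k) = _
    ext <;> simp
    ring
  change hurwitz.mul (conj k hurwitz x) (conj k hurwitz y) = _
  rw [h, h]
  change (⟨x.c * y.c + (-x.u * -y.v - -x.v * -y.u), x.c * -y.u + -x.u * y.c,
    x.c * -y.v + -x.v * y.c⟩ : S12 k) = _
  ext <;> simp [alt] <;> ring

theorem form_eq (x y : S12 k) : bform k x y = 2 * (x.c * y.c) + alt x y := rfl

end S12

variable {k}

instance neZero_two [CharP k 3] : NeZero (2 : k) :=
  ⟨fun h => by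
    have h3 : (3 : k) = 0 := by exact_mod_cast CharP.cast_eq_zero k 3
    exact one_ne_zero (α := k) (by linear_combination h3 - h)⟩

theorem S2.of_mem_part {i : ZMod 2} {x : S2 k} (h : x ∈ part k (S2 k) i) : i = 0 ∨ x = 0 := by
  rcases zmod2_cases i with rfl | rfl
  · exact Or.inl rfl
  · right; rw [mem_part, S2.proj_eq] at h; exact h.symm

instance [NeZero (2 : k)] : IsSymmetricComposition k (S2 k) where
  mul_mem i j x hx y hy := by
    rcases S2.of_mem_part hx with rfl | rfl
    · rcases S2.of_mem_part hy with rfl | rfl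
      · simp [mem_part, S2.proj_eq]
      · simp
    · simp
  form_even i j hij x hx y hy := by
    rcases S2.of_mem_part hx with rfl | rfl
    · rcases S2.of_mem_part hy with rfl | rfl
      · exact absurd rfl hij
      · simp
    · simp
  form_symm x _ y _ := by rw [S2.form_eq, S2.form_eq]; ring
  form_alt x hx := by
    rcases S2.of_mem_part hx with h | rfl
    · exact absurd h (by decide)
    · simp
  nondegenerate x h := by
    have h1 := h ⟨1, 0⟩
    have h2 := h ⟨0, 1⟩
    rw [S2.form_eq] at h1 h2
    exact S2.ext (by simpa using h2) (by simpa using h1)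
  norm_mul x _ y _ := by
    have := NeZero.ne (2 : k)
    simp only [S2.form_eq, S2.mul_eq]; field_simp; ring
  form_mul_left x _ y z := by
    have := NeZero.ne (2 : k)
    simp only [S2.form_eq, S2.mul_eq]; field_simp; ring
  form_mul_right x _ y z := by
    have := NeZero.ne (2 : k)
    simp only [S2.form_eq, S2.mul_eq]; field_simp; ring
  composition a b c d x hx y hy z hz t ht := by
    rcases S2.of_mem_part hx with rfl | rfl
    · rcases S2.of_mem_part hy with rfl | rfl
      · simp only [S2.form_eq, S2.mul_eq, sgn, zero_mul, zero_add, if_true]; ring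
      · simp
    · simp
  form_assoc x y z := by simp only [S2.form_eq, S2.mul_eq]; ring

theorem S12.of_mem_part {i : ZMod 2} {x : S12 k} (h : x ∈ part k (S12 k) i) :
    (i = 0 ∧ ∃ c : k, x = ⟨c, 0, 0⟩) ∨ (i = 1 ∧ ∃ u v : k, x = ⟨0, u, v⟩) := by
  rcases zmod2_cases i with rfl | rfl
  · left; rw [mem_part, S12.proj_eq] at h; exact ⟨rfl, x.c, h.symm⟩
  · right; rw [mem_part, S12.proj_eq] at h; exact ⟨rfl, x.u, x.v, h.symm⟩

theorem three_eq_zero (k : Type u) [Field k] [CharP k 3] : (3 : k) = 0 := by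
  exact_mod_cast CharP.cast_eq_zero k 3

instance [CharP k 3] : IsSymmetricComposition k (S12 k) where
  mul_mem i j x hx y hy := by
    rcases S12.of_mem_part hx with ⟨rfl, c, rfl⟩ | ⟨rfl, c, d, rfl⟩ <;>
    rcases S12.of_mem_part hy with ⟨rfl, c', rfl⟩ | ⟨rfl, c', d', rfl⟩ <;>
    rw [mem_part, S12.mul_eq, S12.proj_eq] <;>
    simp [S12.alt, show (1 : ZMod 2) + 1 = 0 from rfl]
  form_even i j hij x hx y hy := by
    rcases S12.of_mem_part hx with ⟨rfl, c, rfl⟩ | ⟨rfl, c, d, rfl⟩ <;>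
    rcases S12.of_mem_part hy with ⟨rfl, c', rfl⟩ | ⟨rfl, c', d', rfl⟩ <;>
    simp [S12.form_eq, S12.alt] at hij ⊢
  form_symm x hx y hy := by
    rcases S12.of_mem_part hx with ⟨_, c, rfl⟩ | ⟨h, _⟩
    · rcases S12.of_mem_part hy with ⟨_, c', rfl⟩ | ⟨h, _⟩
      · simp [S12.form_eq, S12.alt, mul_comm]
      · exact absurd h (by decide)
    · exact absurd h (by decide)
  form_alt x hx := by
    rcases S12.of_mem_part hx with ⟨h, _⟩ | ⟨_, c, d, rfl⟩
    · exact absurd h (by decide)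
    · simp [S12.form_eq, S12.alt, mul_comm]
  nondegenerate x h := by
    have h0 := h ⟨1, 0, 0⟩
    have h1 := h ⟨0, 1, 0⟩
    have h2 := h ⟨0, 0, 1⟩
    rw [S12.form_eq] at h0 h1 h2
    simp [S12.alt, NeZero.ne (2 : k)] at h0 h1 h2
    exact S12.ext h0 h2 h1
  norm_mul x hx y hy := by
    have := NeZero.ne (2 : k)
    rcases S12.of_mem_part hx with ⟨_, c, rfl⟩ | ⟨h, _⟩
    · rcases S12.of_mem_part hy with ⟨_, c', rfl⟩ | ⟨h, _⟩
      · simp only [S12.form_eq, S12.mul_eq, S12.alt]; field_simp; ring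
      · exact absurd h (by decide)
    · exact absurd h (by decide)
  form_mul_left x hx y z := by
    have := NeZero.ne (2 : k)
    rcases S12.of_mem_part hx with ⟨_, c, rfl⟩ | ⟨h, _⟩
    · simp only [S12.form_eq, S12.mul_eq, S12.alt]; field_simp; ring
    · exact absurd h (by decide)
  form_mul_right x hx y z := by
    have := NeZero.ne (2 : k)
    rcases S12.of_mem_part hx with ⟨_, c, rfl⟩ | ⟨h, _⟩
    · simp only [S12.form_eq, S12.mul_eq, S12.alt]; field_simp; ring
    · exact absurd h (by decide)
  composition a b c d x hx y hy z hz t ht := by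
    have h3 := three_eq_zero k
    have h11 : (1 : ZMod 2) + 1 = 0 := rfl
    rcases S12.of_mem_part hx with ⟨rfl, x0, rfl⟩ | ⟨rfl, x1, x2, rfl⟩ <;>
    rcases S12.of_mem_part hy with ⟨rfl, y0, rfl⟩ | ⟨rfl, y1, y2, rfl⟩ <;>
    rcases S12.of_mem_part hz with ⟨rfl, z0, rfl⟩ | ⟨rfl, z1, z2, rfl⟩ <;>
    rcases S12.of_mem_part ht with ⟨rfl, t0, rfl⟩ | ⟨rfl, t1, t2, rfl⟩ <;>
    simp [S12.form_eq, S12.mul_eq, S12.alt, sgn, h11] <;>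
    grind
  form_assoc x y z := by
    have h3 := three_eq_zero k
    simp only [S12.form_eq, S12.mul_eq, S12.alt]
    grind

end Composition

/-! ### The triality Lie superalgebra and the superalgebra `g(S, S')` -/

section Triality

variable (k : Type u) [Field k] (S : Type v) [AddCommGroup S] [Module k S]

section Lemmas

variable {k}

theorem sgn_zero : sgn k 0 = 1 := rfl

theorem sgn_one : sgn k 1 = -1 := rfl

theorem pr_of_mem {V : Type v} [AddCommGroup V] [Module k V] [SuperSpace k V] {a : ZMod 2}
    {x : V} (hx : x ∈ part k V a) (i : ZMod 2) : pr k i x = if i = a then x else 0 := by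
  rw [mem_part] at hx
  conv_lhs => rw [← hx]
  rw [SuperSpace.proj_proj]
  split_ifs
  · exact hx
  · rfl

/-- To prove an additive statement for all vectors, it is enough to treat homogeneous ones. -/
theorem hom_induction {V : Type v} [AddCommGroup V] [Module k V] [SuperSpace k V] {P : V → Prop}
    (h : ∀ a, ∀ x ∈ part k V a, P x) (hadd : ∀ x y, P x → P y → P (x + y)) (x : V) : P x := by
  rw [← SuperSpace.proj_add (k := k) x]
  exact hadd _ _ (h _ _ (pr_mem_part _ _)) (h _ _ (pr_mem_part _ _))

theorem superFlip_of_mem {V : Type v} [AddCommGroup V] [Module k V] [SuperSpace k V] {W : Type w}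
    [AddCommGroup W] [Module k W] (f : V →ₗ[k] V →ₗ[k] W) {a b : ZMod 2} {x y : V}
    (hx : x ∈ part k V a) (hy : y ∈ part k V b) :
    superFlip f x y = sgn k (a * b) • f y x := by
  simp only [superFlip, LinearMap.sum_apply, LinearMap.smul_apply, LinearMap.compl₁₂_apply,
    LinearMap.flip_apply, pr_of_mem hx, pr_of_mem hy]
  rw [Finset.sum_eq_single a, Finset.sum_eq_single b]
  · simp
  · intro c _ hc; simp [hc]
  · simp
  · intro c _ hc; simp [hc]
  · simp

variable {S}

theorem end_apply_mem [SuperSpace k S] {d : Module.End k S} {i a : ZMod 2}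
    (hd : d ∈ part k (Module.End k S) i) {x : S} (hx : x ∈ part k S a) :
    d x ∈ part k S (i + a) := by
  rw [mem_part] at hd
  have : d x = pr k i (d (pr k 0 x)) + pr k (i + 1) (d (pr k 1 x)) := by
    conv_lhs => rw [← hd]
    rfl
  rw [this, pr_of_mem hx, pr_of_mem hx]
  rcases zmod2_cases a with rfl | rfl
  · simpa using pr_mem_part i (d x)
  · simpa using pr_mem_part (i + 1) (d x)

theorem mem_part_end [SuperSpace k S] {d : Module.End k S} {i : ZMod 2}
    (h : ∀ a, ∀ x ∈ part k S a, d x ∈ part k S (i + a)) : d ∈ part k (Module.End k S) i := by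
  rw [mem_part]
  ext x
  change pr k i (d (pr k 0 x)) + pr k (i + 1) (d (pr k 1 x)) = d x
  have h0 := h 0 _ (pr_mem_part 0 x)
  have h1 := h 1 _ (pr_mem_part 1 x)
  rw [mem_part] at h0 h1
  rw [add_zero] at h0
  rw [h0, h1, ← map_add, SuperSpace.proj_add]

end Lemmas

/-- The part of parity `i` of the orthosymplectic Lie superalgebra of the form `b`: the
endomorphisms `d` of parity `i` with `b(d x, y) + (-1)^(i|x|) b(x, d y) = 0`. -/
def osp [FormProduct k S] (i : ZMod 2) : Submodule k (Module.End k S) where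
  carrier := {d | d ∈ part k (Module.End k S) i ∧ ∀ a, ∀ x ∈ part k S a, ∀ y,
    bform k (d x) y + sgn k (i * a) * bform k x (d y) = 0}
  add_mem' := by
    rintro d e ⟨hd, hd'⟩ ⟨he, he'⟩
    refine ⟨add_mem hd he, fun a x hx y => ?_⟩
    have h1 := hd' a x hx y
    have h2 := he' a x hx y
    simp only [LinearMap.add_apply, map_add]
    linear_combination h1 + h2
  zero_mem' := ⟨zero_mem _, by simp⟩
  smul_mem' := by
    rintro c d ⟨hd, hd'⟩
    refine ⟨Submodule.smul_mem _ _ hd, fun a x hx y => ?_⟩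
    have h1 := hd' a x hx y
    simp only [LinearMap.smul_apply, map_smul, smul_eq_mul]
    linear_combination c * h1

/-- The part of parity `i` of the triality Lie superalgebra: the triples `(d₀, d₁, d₂)` of elements
of parity `i` of the orthosymplectic Lie superalgebra with
`d₀(x • y) = d₁(x) • y + (-1)^(i|x|) x • d₂(y)`. -/
def triPart [FormProduct k S] (i : ZMod 2) : Submodule k (Fin 3 → Module.End k S) where
  carrier := {d | (∀ j, d j ∈ osp k S i) ∧ ∀ a, ∀ x ∈ part k S a, ∀ y,
    d 0 (pmul k x y) = pmul k (d 1 x) y + sgn k (i * a) • pmul k x (d 2 y)}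
  add_mem' := by
    rintro d e ⟨hd, hd'⟩ ⟨he, he'⟩
    refine ⟨fun j => add_mem (hd j) (he j), fun a x hx y => ?_⟩
    simp only [Pi.add_apply, LinearMap.add_apply, map_add, hd' a x hx y, he' a x hx y]
    module
  zero_mem' := ⟨fun _ => zero_mem _, by simp⟩
  smul_mem' := by
    rintro c d ⟨hd, hd'⟩
    refine ⟨fun j => Submodule.smul_mem _ _ (hd j), fun a x hx y => ?_⟩
    simp only [Pi.smul_apply, LinearMap.smul_apply, map_smul, hd' a x hx y]
    module

/-- The triality Lie superalgebra of `S`. -/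
def tri [FormProduct k S] : Submodule k (Fin 3 → Module.End k S) :=
  triPart k S 0 ⊔ triPart k S 1

variable {k S}

section FormProduct

variable [FormProduct k S]

theorem triPart_le_tri (i : ZMod 2) : triPart k S i ≤ tri k S := by
  rcases zmod2_cases i with rfl | rfl
  · exact le_sup_left
  · exact le_sup_right

theorem triPart_le_part (i : ZMod 2) : triPart k S i ≤ part k (Fin 3 → Module.End k S) i := by
  intro d hd
  rw [mem_part]
  funext j
  exact (hd.1 j).1

theorem mem_tri {d : Fin 3 → Module.End k S} : d ∈ tri k S ↔ ∀ i, pr k i d ∈ triPart k S i := by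
  constructor
  · intro hd i
    obtain ⟨a, ha, b, hb, rfl⟩ := Submodule.mem_sup.1 hd
    rw [map_add, pr_of_mem (triPart_le_part 0 ha), pr_of_mem (triPart_le_part 1 hb)]
    rcases zmod2_cases i with rfl | rfl <;> simpa
  · intro h
    rw [← SuperSpace.proj_add (k := k) d]
    exact add_mem (triPart_le_tri 0 (h 0)) (triPart_le_tri 1 (h 1))

instance : SuperSpace k (tri k S) :=
  SuperSpace.ofSubmodule (tri k S) fun i d hd => by
    exact triPart_le_tri i (mem_tri.1 hd i)

/-- The supercommutator `[d, e] = d e - (-1)^(|d||e|) e d` of endomorphisms. -/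
def superComm : Module.End k S →ₗ[k] Module.End k S →ₗ[k] Module.End k S :=
  LinearMap.mul k (Module.End k S) - superFlip (LinearMap.mul k (Module.End k S))

theorem superComm_of_mem {i j : ZMod 2} {d e : Module.End k S}
    (hd : d ∈ part k (Module.End k S) i) (he : e ∈ part k (Module.End k S) j) :
    superComm d e = d * e - sgn k (i * j) • (e * d) := by
  simp [superComm, superFlip_of_mem _ hd he]

theorem superComm_mem_osp {i j : ZMod 2} {d e : Module.End k S}
    (hd : d ∈ osp k S i) (he : e ∈ osp k S j) : superComm d e ∈ osp k S (i + j) := by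
  rw [superComm_of_mem hd.1 he.1]
  refine ⟨mem_part_end fun a x hx => ?_, fun a x hx y => ?_⟩
  · have h1 := end_apply_mem hd.1 (end_apply_mem he.1 hx)
    have h2 := end_apply_mem he.1 (end_apply_mem hd.1 hx)
    rw [← add_assoc] at h1 h2
    rw [add_comm j i] at h2
    exact sub_mem h1 (Submodule.smul_mem _ _ h2)
  · have h1 := hd.2 _ _ (end_apply_mem he.1 hx) y
    have h2 := he.2 _ _ hx (d y)
    have h3 := he.2 _ _ (end_apply_mem hd.1 hx) y
    have h4 := hd.2 _ _ hx (e y)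
    simp only [LinearMap.sub_apply, LinearMap.smul_apply, Module.End.mul_apply, map_sub, map_smul,
      smul_eq_mul]
    rcases zmod2_cases i with rfl | rfl <;> rcases zmod2_cases j with rfl | rfl <;>
    rcases zmod2_cases a with rfl | rfl <;>
    simp [sgn, show (1 : ZMod 2) + 1 = 0 from rfl] at h1 h2 h3 h4 ⊢ <;> grind

/-- The componentwise bracket of triples. -/
def tripleComm : (Fin 3 → Module.End k S) →ₗ[k] (Fin 3 → Module.End k S) →ₗ[k]
    (Fin 3 → Module.End k S) :=
  LinearMap.mk₂ k (fun d e j => superComm (d j) (e j))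
    (fun _ _ _ => by ext; simp) (fun _ _ _ => by ext; simp)
    (fun _ _ _ => by ext; simp) (fun _ _ _ => by ext; simp)

theorem tripleComm_mem_triPart {i j : ZMod 2} {d e : Fin 3 → Module.End k S}
    (hd : d ∈ triPart k S i) (he : e ∈ triPart k S j) : tripleComm d e ∈ triPart k S (i + j) := by
  refine ⟨fun l => superComm_mem_osp (hd.1 l) (he.1 l), fun a x hx y => ?_⟩
  change superComm (d 0) (e 0) _ = pmul k (superComm (d 1) (e 1) x) y
    + _ • pmul k x (superComm (d 2) (e 2) y)
  simp only [superComm_of_mem (hd.1 _).1 (he.1 _).1, LinearMap.sub_apply, LinearMap.smul_apply,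
    Module.End.mul_apply, map_sub, map_smul]
  rw [hd.2 a x hx, he.2 a x hx]
  simp only [map_add, map_smul]
  rw [hd.2 _ _ (end_apply_mem (he.1 1).1 hx), hd.2 a x hx, he.2 a x hx,
    he.2 _ _ (end_apply_mem (hd.1 1).1 hx)]
  rcases zmod2_cases i with rfl | rfl <;> rcases zmod2_cases j with rfl | rfl <;>
    rcases zmod2_cases a with rfl | rfl <;>
    simp [sgn, show (1 : ZMod 2) + 1 = 0 from rfl] <;> module

theorem tripleComm_mem {d e : Fin 3 → Module.End k S} (hd : d ∈ tri k S) (he : e ∈ tri k S) :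
    tripleComm d e ∈ tri k S := by
  rw [← SuperSpace.proj_add (k := k) d, ← SuperSpace.proj_add (k := k) e]
  simp only [map_add, LinearMap.add_apply]
  exact add_mem
    (add_mem (triPart_le_tri _ (tripleComm_mem_triPart (mem_tri.1 hd 0) (mem_tri.1 he 0)))
      (triPart_le_tri _ (tripleComm_mem_triPart (mem_tri.1 hd 1) (mem_tri.1 he 0))))
    (add_mem (triPart_le_tri _ (tripleComm_mem_triPart (mem_tri.1 hd 0) (mem_tri.1 he 1)))
      (triPart_le_tri _ (tripleComm_mem_triPart (mem_tri.1 hd 1) (mem_tri.1 he 1))))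

/-- The bracket of the triality Lie superalgebra. -/
def triBracket : tri k S →ₗ[k] tri k S →ₗ[k] tri k S :=
  LinearMap.mk₂ k (fun d e => ⟨tripleComm d.1 e.1, tripleComm_mem d.2 e.2⟩)
    (fun _ _ _ => by ext; simp) (fun _ _ _ => by ext; simp)
    (fun _ _ _ => by ext; simp) (fun _ _ _ => by ext; simp)

/-- The operators `σ_{x,y} : z ↦ (-1)^(|y||z|) b(x,z) y - (-1)^(|x|(|y|+|z|)) b(y,z) x`. -/
def sigma : S →ₗ[k] S →ₗ[k] Module.End k S :=
  ∑ a : ZMod 2, ∑ b : ZMod 2, ∑ c : ZMod 2,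
    LinearMap.mk₂ k (fun x y : S =>
      (sgn k (b * c) • (bform k (pr k a x)).smulRight (pr k b y)
        - sgn k (a * (b + c)) • (bform k (pr k b y)).smulRight (pr k a x)) ∘ₗ pr k c)
      (fun _ _ _ => by ext; simp; module) (fun _ _ _ => by ext; simp; module)
      (fun _ _ _ => by ext; simp; module) (fun _ _ _ => by ext; simp; module)

/-- The left multiplications `l_x(y) = x • y`. -/
def lmul : S →ₗ[k] Module.End k S := pmul k

/-- The right multiplications `r_x(y) = (-1)^(|x||y|) y • x`. -/
def rmul : S →ₗ[k] Module.End k S := superFlip (pmul k)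

/-- The triples
`t_{x,y} = (σ_{x,y}, (1/2) b(x,y) 1 - r_x l_y, (1/2) b(x,y) 1 - l_x r_y)`. -/
def tTriple : S →ₗ[k] S →ₗ[k] (Fin 3 → Module.End k S) :=
  LinearMap.mk₂ k (fun x y => ![sigma (k := k) x y,
      ((2 : k)⁻¹ * bform k x y) • (1 : Module.End k S) - rmul (k := k) x * lmul (k := k) y,
      ((2 : k)⁻¹ * bform k x y) • (1 : Module.End k S) - lmul (k := k) x * rmul (k := k) y])
    (fun _ _ _ => by
      funext j
      fin_cases j <;> simp [mul_add, add_mul, add_smul] <;> abel)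
    (fun _ _ _ => by
      funext j
      fin_cases j <;> simp [smul_sub, smul_smul, mul_left_comm])
    (fun _ _ _ => by
      funext j
      fin_cases j <;> simp [mul_add, add_smul] <;> abel)
    (fun _ _ _ => by
      funext j
      fin_cases j <;> simp [smul_sub, smul_smul, mul_left_comm])

theorem sigma_of_mem {a b c : ZMod 2} {x y z : S} (hx : x ∈ part k S a) (hy : y ∈ part k S b)
    (hz : z ∈ part k S c) : sigma (k := k) x y z =
      (sgn k (b * c) * bform k x z) • y - (sgn k (a * (b + c)) * bform k y z) • x := by
  simp only [sigma, LinearMap.sum_apply, LinearMap.mk₂_apply, LinearMap.comp_apply,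
    pr_of_mem hx, pr_of_mem hy, pr_of_mem hz]
  rw [Finset.sum_eq_single a, Finset.sum_eq_single b, Finset.sum_eq_single c]
  · simp [smul_smul]
  · intro e _ he; simp [he]
  · simp
  · intro e _ he; simp [he]
  · simp
  · intro e _ he; simp [he]
  · simp

theorem rmul_of_mem {a b : ZMod 2} {x y : S} (hx : x ∈ part k S a) (hy : y ∈ part k S b) :
    rmul (k := k) x y = sgn k (a * b) • pmul k y x := superFlip_of_mem _ hx hy

theorem mem_osp_of_hom {i : ZMod 2} {d : Module.End k S}
    (h : ∀ a, ∀ x ∈ part k S a, d x ∈ part k S (i + a))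
    (h' : ∀ a, ∀ x ∈ part k S a, ∀ b, ∀ y ∈ part k S b,
      bform k (d x) y + sgn k (i * a) * bform k x (d y) = 0) : d ∈ osp k S i := by
  refine ⟨mem_part_end h, fun a x hx y => ?_⟩
  refine hom_induction (k := k) (P := fun y =>
    bform k (d x) y + sgn k (i * a) * bform k x (d y) = 0) (fun b y hy => h' a x hx b y hy)
    (fun y z hy hz => ?_) y
  simp only [map_add]
  linear_combination hy + hz

theorem lr_apply {b c : ZMod 2} {x y z : S} (hy : y ∈ part k S b) (hz : z ∈ part k S c) :
    (((2 : k)⁻¹ * bform k x y) • (1 : Module.End k S) - lmul (k := k) x * rmul (k := k) y) z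
      = ((2 : k)⁻¹ * bform k x y) • z - sgn k (b * c) • pmul k x (pmul k z y) := by
  rw [← map_smul, ← rmul_of_mem hy hz]
  rfl

end FormProduct

section Symmetric

variable [FormProduct k S] [hS : IsSymmetricComposition k S]

theorem form_eq_zero {a b : ZMod 2} {x y : S} (hx : x ∈ part k S a) (hy : y ∈ part k S b)
    (h : a ≠ b) : bform k x y = 0 := hS.form_even a b h x hx y hy

theorem mul_mem_part {a b : ZMod 2} {x y : S} (hx : x ∈ part k S a) (hy : y ∈ part k S b) :
    pmul k x y ∈ part k S (a + b) := hS.mul_mem a b x hx y hy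

theorem form_swap {a b : ZMod 2} {x y : S} (hx : x ∈ part k S a) (hy : y ∈ part k S b) :
    bform k x y = sgn k (a * b) * bform k y x := by
  by_cases h : a = b
  · subst h
    rcases zmod2_cases a with rfl | rfl
    · simpa [sgn] using hS.form_symm x hx y hy
    · have h1 := hS.form_alt x hx
      have h2 := hS.form_alt y hy
      have h3 := hS.form_alt (x + y) (add_mem hx hy)
      simp only [map_add, LinearMap.add_apply] at h3
      simp only [mul_one, sgn_one]
      linear_combination h3 - h1 - h2
  · rw [form_eq_zero hx hy h, form_eq_zero hy hx (Ne.symm h), mul_zero]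

theorem eq_of_form {x y : S} (h : ∀ a, ∀ z ∈ part k S a, bform k x z = bform k y z) : x = y := by
  refine sub_eq_zero.1 (hS.nondegenerate _ fun z => ?_)
  refine hom_induction (k := k) (P := fun z => bform k (x - y) z = 0) (fun a z hz => ?_)
    (fun z w hz hw => ?_) z
  · simp [h a z hz]
  · rw [map_add, hz, hw, add_zero]

theorem mul_mul_left {a b c : ZMod 2} {x y z : S} (hx : x ∈ part k S a) (hy : y ∈ part k S b)
    (hz : z ∈ part k S c) : pmul k (pmul k x y) z =
      (sgn k (b * c) * bform k x z) • y - sgn k (a * b + a * c + b * c) • pmul k (pmul k z y) x := by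
  refine eq_of_form (k := k) fun d w hw => ?_
  have h := hS.composition a b c d x hx y hy z hz w hw
  simp only [map_sub, map_smul, LinearMap.sub_apply, LinearMap.smul_apply, smul_eq_mul]
  rw [hS.form_assoc (pmul k x y) z w, hS.form_assoc (pmul k z y) x w]
  linear_combination h

theorem mul_mul_right {a b c : ZMod 2} {x y z : S} (hx : x ∈ part k S a) (hy : y ∈ part k S b)
    (hz : z ∈ part k S c) : pmul k x (pmul k y z) =
      (sgn k (a * b) * bform k x z) • y - sgn k (a * b + a * c + b * c) • pmul k z (pmul k y x) := by
  refine eq_of_form (k := k) fun d w hw => ?_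
  have h := hS.composition d a b c w hw x hx y hy z hz
  simp only [map_sub, map_smul, LinearMap.sub_apply, LinearMap.smul_apply, smul_eq_mul]
  have h1 := form_swap (mul_mem_part hx (mul_mem_part hy hz)) hw
  have h2 := form_swap (mul_mem_part hz (mul_mem_part hy hx)) hw
  have h3 := form_swap hy hw
  have h4 := form_swap (mul_mem_part hw hz) (mul_mem_part hy hx)
  have e1 : a ≠ c → bform k x z = 0 := form_eq_zero hx hz
  have e2 : b ≠ d → bform k y w = 0 := form_eq_zero hy hw
  have e3 : d + c ≠ b + a → bform k (pmul k w z) (pmul k y x) = 0 :=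
    form_eq_zero (mul_mem_part hw hz) (mul_mem_part hy hx)
  have e4 : d + a ≠ b + c → bform k (pmul k w x) (pmul k y z) = 0 :=
    form_eq_zero (mul_mem_part hw hx) (mul_mem_part hy hz)
  rw [← hS.form_assoc] at h1 h2
  have h11 : (1 : ZMod 2) + 1 = 0 := rfl
  clear hx hy hz hw
  rcases zmod2_cases a with rfl | rfl <;> rcases zmod2_cases b with rfl | rfl <;>
    rcases zmod2_cases c with rfl | rfl <;> rcases zmod2_cases d with rfl | rfl <;>
    simp [sgn, h11] at h h1 h2 h3 h4 e1 e2 e3 e4 ⊢ <;> grind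

/-- The cyclic shift of a triple. -/
def shift : (Fin 3 → Module.End k S) →ₗ[k] (Fin 3 → Module.End k S) where
  toFun d := ![d 2, d 0, d 1]
  map_add' _ _ := by ext j; fin_cases j <;> rfl
  map_smul' _ _ := by ext j; fin_cases j <;> rfl

theorem shift_mem_triPart {i : ZMod 2} {d : Fin 3 → Module.End k S} (hd : d ∈ triPart k S i) :
    shift d ∈ triPart k S i := by
  refine ⟨fun j => by fin_cases j <;> exact hd.1 _, fun a x hx y => ?_⟩
  change d 2 (pmul k x y) = pmul k (d 0 x) y + sgn k (i * a) • pmul k x (d 1 y)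
  refine hom_induction (k := k) (P := fun y => d 2 (pmul k x y) =
    pmul k (d 0 x) y + sgn k (i * a) • pmul k x (d 1 y)) (fun b y hy => ?_)
    (fun y z hy hz => ?_) y
  · refine eq_of_form (k := k) fun c z hz => ?_
    have h1 := (hd.1 2).2 _ _ (mul_mem_part hx hy) z
    have h2 := hd.2 _ _ hy z
    have h3 := (hd.1 0).2 _ _ hx (pmul k y z)
    rw [h2] at h3
    simp only [map_add, map_smul, LinearMap.add_apply, LinearMap.smul_apply, smul_eq_mul,
      hS.form_assoc] at h1 h3 ⊢
    have h11 : (1 : ZMod 2) + 1 = 0 := rfl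
    clear hx hy hz
    rcases zmod2_cases a with rfl | rfl <;> rcases zmod2_cases b with rfl | rfl <;>
      rcases zmod2_cases i with rfl | rfl <;>
      simp [sgn, h11] at h1 h3 ⊢ <;> grind
  · simp only [map_add, hy, hz]
    module

/-- The automorphism `θ : (d₀, d₁, d₂) ↦ (d₂, d₀, d₁)` of the triality Lie superalgebra. -/
def theta : Module.End k (tri k S) :=
  shift.restrict (p := tri k S) (q := tri k S) fun d hd => by
    rw [← SuperSpace.proj_add (k := k) d, map_add]
    exact add_mem (triPart_le_tri _ (shift_mem_triPart (mem_tri.1 hd 0)))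
      (triPart_le_tri _ (shift_mem_triPart (mem_tri.1 hd 1)))

theorem sigma_mem_osp {a b : ZMod 2} {x y : S} (hx : x ∈ part k S a) (hy : y ∈ part k S b) :
    sigma x y ∈ osp k S (a + b) := by
  have h11 : (1 : ZMod 2) + 1 = 0 := rfl
  refine mem_osp_of_hom (fun c z hz => ?_) (fun c z hz d w hw => ?_)
  · rw [sigma_of_mem hx hy hz]
    refine sub_mem ?_ ?_
    · by_cases h : a = c
      · subst h
        have : a + b + a = b := by
          rcases zmod2_cases a with rfl | rfl <;> rcases zmod2_cases b with rfl | rfl <;> rfl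
        rw [this]
        exact Submodule.smul_mem _ _ hy
      · simp [form_eq_zero hx hz h]
    · by_cases h : b = c
      · subst h
        have : a + b + b = a := by
          rcases zmod2_cases a with rfl | rfl <;> rcases zmod2_cases b with rfl | rfl <;> rfl
        rw [this]
        exact Submodule.smul_mem _ _ hx
      · simp [form_eq_zero hy hz h]
  · rw [sigma_of_mem hx hy hz, sigma_of_mem hx hy hw]
    simp only [map_sub, map_smul, LinearMap.sub_apply, LinearMap.smul_apply, smul_eq_mul]
    have h1 := form_swap hz hx
    have h2 := form_swap hz hy
    have e1 : a ≠ c → bform k x z = 0 := form_eq_zero hx hz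
    have e2 : a ≠ d → bform k x w = 0 := form_eq_zero hx hw
    have e3 : b ≠ c → bform k y z = 0 := form_eq_zero hy hz
    have e4 : b ≠ d → bform k y w = 0 := form_eq_zero hy hw
    rw [h1, h2]
    clear hx hy hz hw h1 h2
    rcases zmod2_cases a with rfl | rfl <;> rcases zmod2_cases b with rfl | rfl <;>
      rcases zmod2_cases c with rfl | rfl <;> rcases zmod2_cases d with rfl | rfl <;>
      simp [sgn, h11] at e1 e2 e3 e4 ⊢ <;> grind

theorem rl_apply {a b c : ZMod 2} {x y z : S} (hx : x ∈ part k S a) (hy : y ∈ part k S b)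
    (hz : z ∈ part k S c) :
    (((2 : k)⁻¹ * bform k x y) • (1 : Module.End k S) - rmul (k := k) x * lmul (k := k) y) z
      = ((2 : k)⁻¹ * bform k x y) • z - sgn k (a * (b + c)) • pmul k (pmul k y z) x := by
  rw [← rmul_of_mem hx (mul_mem_part hy hz)]
  rfl

theorem rl_mem_osp [NeZero (2 : k)] {a b : ZMod 2} {x y : S} (hx : x ∈ part k S a)
    (hy : y ∈ part k S b) :
    ((2 : k)⁻¹ * bform k x y) • (1 : Module.End k S) - rmul (k := k) x * lmul (k := k) y
      ∈ osp k S (a + b) := by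
  have h11 : (1 : ZMod 2) + 1 = 0 := rfl
  have h22 : (2 : k)⁻¹ * bform k x y + (2 : k)⁻¹ * bform k x y = bform k x y := by
    rw [← two_mul, mul_inv_cancel_left₀ (NeZero.ne (2 : k))]
  refine mem_osp_of_hom (fun c z hz => ?_) (fun c z hz d w hw => ?_)
  · rw [rl_apply hx hy hz]
    refine sub_mem ?_ (Submodule.smul_mem _ _ ?_)
    · by_cases h : a = b
      · subst h
        have : a + a = 0 := by rcases zmod2_cases a with rfl | rfl <;> rfl
        rw [this, zero_add]
        exact Submodule.smul_mem _ _ hz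
      · simp [form_eq_zero hx hy h]
    · have := mul_mem_part (mul_mem_part hy hz) hx
      rwa [show b + c + a = a + b + c by ring] at this
  · rw [rl_apply hx hy hz, rl_apply hx hy hw]
    simp only [map_sub, map_smul, LinearMap.sub_apply, LinearMap.smul_apply, smul_eq_mul]
    have h := hS.composition b c a d y hy z hz x hx w hw
    have h1 := form_swap hz (mul_mem_part (mul_mem_part hy hw) hx)
    have h2 := form_swap (mul_mem_part hy hw) (mul_mem_part hx hz)
    have h3 := form_swap hx hy
    rw [hS.form_assoc (pmul k y w) x z] at h1
    rw [hS.form_assoc (pmul k y z) x w]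
    have e1 : a ≠ b → bform k x y = 0 := form_eq_zero hx hy
    have e2 : c ≠ d → bform k z w = 0 := form_eq_zero hz hw
    have e3 : b + d ≠ a + c → bform k (pmul k y w) (pmul k x z) = 0 :=
      form_eq_zero (mul_mem_part hy hw) (mul_mem_part hx hz)
    have e4 : b + c ≠ a + d → bform k (pmul k y z) (pmul k x w) = 0 :=
      form_eq_zero (mul_mem_part hy hz) (mul_mem_part hx hw)
    generalize (2 : k)⁻¹ * bform k x y = β at h22 ⊢
    clear hx hy hz hw
    rcases zmod2_cases a with rfl | rfl <;> rcases zmod2_cases b with rfl | rfl <;>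
      rcases zmod2_cases c with rfl | rfl <;> rcases zmod2_cases d with rfl | rfl <;>
      simp [sgn, h11] at h h1 h2 h3 e1 e2 e3 e4 ⊢ <;> grind

theorem lr_mem_osp [NeZero (2 : k)] {a b : ZMod 2} {x y : S} (hx : x ∈ part k S a)
    (hy : y ∈ part k S b) :
    ((2 : k)⁻¹ * bform k x y) • (1 : Module.End k S) - lmul (k := k) x * rmul (k := k) y
      ∈ osp k S (a + b) := by
  have h11 : (1 : ZMod 2) + 1 = 0 := rfl
  have h22 : (2 : k)⁻¹ * bform k x y + (2 : k)⁻¹ * bform k x y = bform k x y := by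
    rw [← two_mul, mul_inv_cancel_left₀ (NeZero.ne (2 : k))]
  refine mem_osp_of_hom (fun c z hz => ?_) (fun c z hz d w hw => ?_)
  · rw [lr_apply hy hz]
    refine sub_mem ?_ (Submodule.smul_mem _ _ ?_)
    · by_cases h : a = b
      · subst h
        have : a + a = 0 := by rcases zmod2_cases a with rfl | rfl <;> rfl
        rw [this, zero_add]
        exact Submodule.smul_mem _ _ hz
      · simp [form_eq_zero hx hy h]
    · have := mul_mem_part hx (mul_mem_part hz hy)
      rwa [show a + (c + b) = a + b + c by ring] at this
  · rw [lr_apply hy hz, lr_apply hy hw]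
    simp only [map_sub, map_smul, LinearMap.sub_apply, LinearMap.smul_apply, smul_eq_mul]
    have h := hS.composition c a d b z hz x hx w hw y hy
    have h1 := form_swap (mul_mem_part hx (mul_mem_part hz hy)) hw
    rw [← hS.form_assoc w x] at h1
    rw [← hS.form_assoc z x]
    have e1 : a ≠ b → bform k x y = 0 := form_eq_zero hx hy
    have e2 : c ≠ d → bform k z w = 0 := form_eq_zero hz hw
    have e3 : d + a ≠ c + b → bform k (pmul k w x) (pmul k z y) = 0 :=
      form_eq_zero (mul_mem_part hw hx) (mul_mem_part hz hy)
    have e4 : c + a ≠ d + b → bform k (pmul k z x) (pmul k w y) = 0 :=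
      form_eq_zero (mul_mem_part hz hx) (mul_mem_part hw hy)
    generalize (2 : k)⁻¹ * bform k x y = β at h22 ⊢
    clear hx hy hz hw
    rcases zmod2_cases a with rfl | rfl <;> rcases zmod2_cases b with rfl | rfl <;>
      rcases zmod2_cases c with rfl | rfl <;> rcases zmod2_cases d with rfl | rfl <;>
      simp [sgn, h11] at h h1 e1 e2 e3 e4 ⊢ <;> grind

theorem tTriple_mem_triPart [NeZero (2 : k)] {a b : ZMod 2} {x y : S} (hx : x ∈ part k S a)
    (hy : y ∈ part k S b) : tTriple x y ∈ triPart k S (a + b) := by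
  refine ⟨fun j => ?_, fun c u hu v => ?_⟩
  · fin_cases j
    · exact sigma_mem_osp hx hy
    · exact rl_mem_osp hx hy
    · exact lr_mem_osp hx hy
  refine hom_induction (k := k) (P := fun v => tTriple (k := k) x y 0 (pmul k u v) =
    pmul k (tTriple (k := k) x y 1 u) v
      + sgn k ((a + b) * c) • pmul k u (tTriple (k := k) x y 2 v))
    (fun d v hv => ?_) (fun v w hv hw => ?_) v
  · change sigma (k := k) x y (pmul k u v) =
      pmul k ((((2 : k)⁻¹ * bform k x y) • (1 : Module.End k S)
        - rmul (k := k) x * lmul (k := k) y) u) v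
      + sgn k ((a + b) * c) • pmul k u ((((2 : k)⁻¹ * bform k x y) • (1 : Module.End k S)
        - lmul (k := k) x * rmul (k := k) y) v)
    have h22 : bform k x y = (2 : k)⁻¹ * bform k x y + (2 : k)⁻¹ * bform k x y := by
      rw [← two_mul, mul_inv_cancel_left₀ (NeZero.ne (2 : k))]
    have e1 : a ≠ b → (2 : k)⁻¹ * bform k x y = 0 := fun h => by
      rw [form_eq_zero hx hy h, mul_zero]
    have e2 : a ≠ c + d → bform k x (pmul k u v) = 0 := form_eq_zero hx (mul_mem_part hu hv)
    have e3 : b ≠ c + d → bform k y (pmul k u v) = 0 := form_eq_zero hy (mul_mem_part hu hv)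
    have h1 := form_swap (mul_mem_part hu hv) hx
    rw [hS.form_assoc] at h1
    rw [sigma_of_mem hx hy (mul_mem_part hu hv), rl_apply hx hy hu, lr_apply hy hv]
    simp only [map_sub, map_smul, LinearMap.sub_apply, LinearMap.smul_apply]
    rw [mul_mul_left (mul_mem_part hy hu) hx hv, hS.form_assoc, mul_mul_right hx hv hy]
    simp only [map_sub, map_smul]
    rw [mul_mul_right hu hy (mul_mem_part hv hx), h1]
    generalize (2 : k)⁻¹ * bform k x y = β at e1 h22 ⊢
    rw [h22]
    have h11 : (1 : ZMod 2) + 1 = 0 := rfl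
    clear h1 h22 hx hy hu hv
    rcases zmod2_cases a with rfl | rfl <;> rcases zmod2_cases b with rfl | rfl <;>
      rcases zmod2_cases c with rfl | rfl <;> rcases zmod2_cases d with rfl | rfl <;>
      simp [sgn, h11] at e1 e2 e3 ⊢ <;> (try simp [*]) <;> module
  · simp only [map_add, hv, hw]
    module

/-- The bilinear map `(x, y) ↦ t_{x,y}` with values in the triality Lie superalgebra. -/
def tMap [NeZero (2 : k)] : S →ₗ[k] S →ₗ[k] tri k S :=
  LinearMap.mk₂ k (fun x y => ⟨tTriple x y, by
      rw [← SuperSpace.proj_add (k := k) x, ← SuperSpace.proj_add (k := k) y]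
      simp only [map_add, LinearMap.add_apply]
      exact add_mem
        (add_mem (triPart_le_tri _ (tTriple_mem_triPart (pr_mem_part _ _) (pr_mem_part _ _)))
          (triPart_le_tri _ (tTriple_mem_triPart (pr_mem_part _ _) (pr_mem_part _ _))))
        (add_mem (triPart_le_tri _ (tTriple_mem_triPart (pr_mem_part _ _) (pr_mem_part _ _)))
          (triPart_le_tri _ (tTriple_mem_triPart (pr_mem_part _ _) (pr_mem_part _ _))))⟩)
    (fun _ _ _ => by ext : 1; simp) (fun _ _ _ => by ext : 1; simp)
    (fun _ _ _ => by ext : 1; simp) (fun _ _ _ => by ext : 1; simp)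

end Symmetric

end Triality

section Magic

variable (k : Type u) [Field k] (S : Type v) [AddCommGroup S] [Module k S] [FormProduct k S]
  (S' : Type w) [AddCommGroup S'] [Module k S'] [FormProduct k S']

/-- The superspace `g(S, S') = (tri(S) ⊕ tri(S')) ⊕ (⊕_{i=0}^{2} ι_i(S ⊗ S'))`. -/
abbrev Magic : Type _ := tri k S × tri k S' × (Fin 3 → S ⊗[k] S')

variable {k S S'}

/-- For bilinear maps `f` on `S` and `g` on `S'` and a sign exponent `ε`, the bilinear map
`(x ⊗ x', y ⊗ y') ↦ (-1)^ε(|x|, |x'|, |y|, |y'|) f(x, y) ⊗ g(x', y')` on `S ⊗ S'`. -/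
def signedMap {M N : Type*} [AddCommGroup M] [Module k M] [AddCommGroup N] [Module k N]
    (ε : ZMod 2 → ZMod 2 → ZMod 2 → ZMod 2 → ZMod 2)
    (f : S →ₗ[k] S →ₗ[k] M) (g : S' →ₗ[k] S' →ₗ[k] N) :
    S ⊗[k] S' →ₗ[k] S ⊗[k] S' →ₗ[k] M ⊗[k] N :=
  ∑ a : ZMod 2, ∑ a' : ZMod 2, ∑ b : ZMod 2, ∑ b' : ZMod 2, sgn k (ε a a' b b') •
    TensorProduct.map₂ (f.compl₁₂ (pr k a) (pr k b)) (g.compl₁₂ (pr k a') (pr k b'))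

/-- `(x ⊗ x', y ⊗ y') ↦ (-1)^(|x'||y|) (x • y) ⊗ (x' * y')`. -/
def iotaMul : S ⊗[k] S' →ₗ[k] S ⊗[k] S' →ₗ[k] S ⊗[k] S' :=
  signedMap (fun _ a' b _ => a' * b) (pmul k) (pmul k)

/-- `(x ⊗ x', y ⊗ y') ↦ (-1)^(|x||x'| + |x||y'| + |y||y'|) b'(x', y') t_{x,y}`. -/
def iotaTri [IsSymmetricComposition k S] [NeZero (2 : k)] :
    S ⊗[k] S' →ₗ[k] S ⊗[k] S' →ₗ[k] tri k S :=
  (signedMap (fun a a' b b' => a * a' + a * b' + b * b') tMap (bform k)).compr₂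
    (TensorProduct.rid k (tri k S)).toLinearMap

/-- `(x ⊗ x', y ⊗ y') ↦ (-1)^(|y||x'|) b(x, y) t'_{x',y'}`. -/
def iotaTri' [IsSymmetricComposition k S'] [NeZero (2 : k)] :
    S ⊗[k] S' →ₗ[k] S ⊗[k] S' →ₗ[k] tri k S' :=
  (signedMap (fun _ a' b _ => b * a') (bform k) tMap).compr₂
    (TensorProduct.lid k (tri k S')).toLinearMap

/-- `(d, x ⊗ x') ↦ d(x) ⊗ x'`. -/
def actLeft : Module.End k S →ₗ[k] S ⊗[k] S' →ₗ[k] S ⊗[k] S' := LinearMap.rTensorHom S'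

/-- `(d', x ⊗ x') ↦ (-1)^(|d'||x|) x ⊗ d'(x')`. -/
def actRight : Module.End k S' →ₗ[k] S ⊗[k] S' →ₗ[k] S ⊗[k] S' :=
  ∑ a : ZMod 2, ∑ b : ZMod 2, sgn k (a * b) •
    (TensorProduct.mapBilinear (RingHom.id k) S S' S S' (pr k b)) ∘ₗ pr k a

/-- The brackets inside `tri(S) ⊕ tri(S')`, and the brackets of `ι_i(S ⊗ S')` with itself:
`[ι_i(x ⊗ x'), ι_i(y ⊗ y')] = (-1)^(|x||x'| + |x||y'| + |y||y'|) b'(x', y') θ^i(t_{x,y})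
  + (-1)^(|y||x'|) b(x, y) θ'^i(t'_{x',y'})`. -/
def magicDiag [IsSymmetricComposition k S] [IsSymmetricComposition k S'] [NeZero (2 : k)] :
    Magic k S S' →ₗ[k] Magic k S S' →ₗ[k] Magic k S S' :=
  LinearMap.mk₂ k (fun X Y =>
    (triBracket X.1 Y.1 + ∑ i : Fin 3, (theta ^ (i : ℕ)) (iotaTri (X.2.2 i) (Y.2.2 i)),
      triBracket X.2.1 Y.2.1 + ∑ i : Fin 3, (theta ^ (i : ℕ)) (iotaTri' (X.2.2 i) (Y.2.2 i)),
      0))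
    (fun _ _ _ => by
      refine Prod.ext ?_ (Prod.ext ?_ ?_) <;> simp [Finset.sum_add_distrib] <;> abel)
    (fun _ _ _ => by
      refine Prod.ext ?_ (Prod.ext ?_ ?_) <;> simp [Finset.smul_sum])
    (fun _ _ _ => by
      refine Prod.ext ?_ (Prod.ext ?_ ?_) <;> simp [Finset.sum_add_distrib] <;> abel)
    (fun _ _ _ => by
      refine Prod.ext ?_ (Prod.ext ?_ ?_) <;> simp [Finset.smul_sum])

/-- The products `[(d₀, d₁, d₂), ι_i(x ⊗ x')] = ι_i(d_i(x) ⊗ x')`,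
`[(d'₀, d'₁, d'₂), ι_i(x ⊗ x')] = (-1)^(|d'_i||x|) ι_i(x ⊗ d'_i(x'))` and
`[ι_i(x ⊗ x'), ι_{i+1}(y ⊗ y')] = (-1)^(|x'||y|) ι_{i+2}((x • y) ⊗ (x' * y'))`. -/
def magicHalf : Magic k S S' →ₗ[k] Magic k S S' →ₗ[k] Magic k S S' :=
  LinearMap.mk₂ k (fun X Y =>
    (0, 0, fun j => actLeft (X.1.1 j) (Y.2.2 j) + actRight (X.2.1.1 j) (Y.2.2 j)
      + iotaMul (X.2.2 (j + 1)) (Y.2.2 (j + 2))))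
    (fun _ _ _ => by
      refine Prod.ext ?_ (Prod.ext ?_ (funext fun j => ?_)) <;> simp; abel)
    (fun _ _ _ => by
      refine Prod.ext ?_ (Prod.ext ?_ (funext fun j => ?_)) <;> simp)
    (fun _ _ _ => by
      refine Prod.ext ?_ (Prod.ext ?_ (funext fun j => ?_)) <;> simp; abel)
    (fun _ _ _ => by
      refine Prod.ext ?_ (Prod.ext ?_ (funext fun j => ?_)) <;> simp)

/-- The superalgebra `g(S, S')`: the remaining products are determined by
superanticommutativity, `[Y, X] = -(-1)^(|X||Y|) [X, Y]`. -/
instance [IsSymmetricComposition k S] [IsSymmetricComposition k S'] [NeZero (2 : k)] :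
    SuperProduct k (Magic k S S') where
  mul := magicDiag (k := k) (S := S) (S' := S') + magicHalf
    + (-1 : k) • superFlip (magicHalf (k := k) (S := S) (S' := S'))

end Magic

/-! ### Lie superalgebras -/

section LieSuper

variable (k : Type u) [Field k] (L : Type v) [AddCommGroup L] [Module k L] [SuperProduct k L]

/-- Lie superalgebras over a field of characteristic different from `2`; the last axiom is
automatic if the characteristic is also different from `3`. -/
structure IsLieSuperalgebra : Prop where
  mul_mem : ∀ (i j : ZMod 2), ∀ x ∈ part k L i, ∀ y ∈ part k L j, pmul k x y ∈ part k L (i + j)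
  skew : ∀ (i j : ZMod 2), ∀ x ∈ part k L i, ∀ y ∈ part k L j,
    pmul k x y = -(sgn k (i * j) • pmul k y x)
  jacobi : ∀ (i j : ZMod 2), ∀ x ∈ part k L i, ∀ y ∈ part k L j, ∀ z : L,
    pmul k x (pmul k y z) = pmul k (pmul k x y) z + sgn k (i * j) • pmul k y (pmul k x z)
  cube : ∀ x ∈ part k L 1, pmul k x (pmul k x x) = 0

/-- An isomorphism of superalgebras: a bijective linear map preserving parities and products. -/
structure SuperIso (L' : Type w) [AddCommGroup L'] [Module k L'] [SuperProduct k L'] extends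
    L ≃ₗ[k] L' where
  map_pr : ∀ (i : ZMod 2) (x : L), toFun (pr k i x) = pr k i (toFun x)
  map_mul : ∀ x y : L, toFun (pmul k x y) = pmul k (toFun x) (toFun y)

variable {k L}

/-- A submodule is graded if it is stable under the parity projections. -/
def IsGraded (J : Submodule k L) : Prop := ∀ i, ∀ x ∈ J, pr k i x ∈ J

/-- Graded two-sided ideals. -/
structure IsGradedIdeal (J : Submodule k L) : Prop where
  graded : IsGraded J
  mul_left : ∀ x : L, ∀ y ∈ J, pmul k x y ∈ J
  mul_right : ∀ x ∈ J, ∀ y : L, pmul k x y ∈ J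

/-- A graded subalgebra `D` of `L` is simple (as a superalgebra in its own right) if its product
is not zero and its only graded ideals are `0` and `D`. -/
structure IsSimpleSub (D : Submodule k L) : Prop where
  graded : IsGraded D
  mul_mem : ∀ x ∈ D, ∀ y ∈ D, pmul k x y ∈ D
  nonabelian : ∃ x ∈ D, ∃ y ∈ D, pmul k x y ≠ 0
  eq_bot_or_eq : ∀ J ≤ D, IsGraded J → (∀ x ∈ D, ∀ y ∈ J, pmul k x y ∈ J ∧ pmul k y x ∈ J) →
    J = ⊥ ∨ J = D

variable (k L)

/-- A superalgebra is simple if its product is not zero and it has no proper nonzero graded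
ideals. -/
def IsSimpleSuper : Prop := IsSimpleSub (⊤ : Submodule k L)

/-- The derived superalgebra `[L, L]`, spanned by all brackets. -/
def derived : Submodule k L := Submodule.span k {z | ∃ x y : L, z = pmul k x y}

/-- The centre `{x | [x, L] = 0}`. -/
def centre : Set L := {x | ∀ y : L, pmul k x y = 0 ∧ pmul k y x = 0}

variable {L}

/-- The smallest graded ideal containing the set `s`. -/
def idealSpan (s : Set L) : Submodule k L :=
  sInf {J | IsGradedIdeal J ∧ s ⊆ J}

theorem isGradedIdeal_idealSpan (s : Set L) : IsGradedIdeal (idealSpan k s) where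
  graded i x hx := by
    simp only [idealSpan, Submodule.mem_sInf] at hx ⊢
    exact fun J hJ => hJ.1.graded i x (hx J hJ)
  mul_left x y hy := by
    simp only [idealSpan, Submodule.mem_sInf] at hy ⊢
    exact fun J hJ => hJ.1.mul_left x y (hy J hJ)
  mul_right x hx y := by
    simp only [idealSpan, Submodule.mem_sInf] at hx ⊢
    exact fun J hJ => hJ.1.mul_right x (hx J hJ) y

/-- The quotient of a superalgebra by the graded ideal generated by a set. -/
def SuperQuot (s : Set L) : Type v := L ⧸ idealSpan k s

instance (s : Set L) : AddCommGroup (SuperQuot k s) :=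
  inferInstanceAs (AddCommGroup (L ⧸ idealSpan k s))

instance (s : Set L) : Module k (SuperQuot k s) :=
  inferInstanceAs (Module k (L ⧸ idealSpan k s))

/-- The projection onto the quotient. -/
def SuperQuot.mk (s : Set L) : L →ₗ[k] SuperQuot k s := (idealSpan k s).mkQ

theorem SuperQuot.mk_surjective (s : Set L) : Function.Surjective (SuperQuot.mk k s) :=
  (idealSpan k s).mkQ_surjective

theorem SuperQuot.ker_mk (s : Set L) : LinearMap.ker (SuperQuot.mk k s) = idealSpan k s :=
  (idealSpan k s).ker_mkQ

instance (s : Set L) : SuperProduct k (SuperQuot k s) where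
  proj i := (idealSpan k s).mapQ (idealSpan k s) (pr k i)
    fun x hx => (isGradedIdeal_idealSpan k s).graded i x hx
  proj_proj i j x := by
    obtain ⟨x, rfl⟩ := SuperQuot.mk_surjective k s x
    change SuperQuot.mk k s (pr k i (pr k j x)) = _
    rw [SuperSpace.proj_proj]
    split_ifs <;> rfl
  proj_add x := by
    obtain ⟨x, rfl⟩ := SuperQuot.mk_surjective k s x
    change SuperQuot.mk k s (pr k 0 x + pr k 1 x) = _
    rw [SuperSpace.proj_add]
  mul := LinearMap.liftQ₂ (idealSpan k s) (idealSpan k s) ((pmul k).compr₂ (SuperQuot.mk k s))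
    (fun x hx => by
      ext y
      change SuperQuot.mk k s (pmul k x y) = 0
      rw [← LinearMap.mem_ker, SuperQuot.ker_mk]
      exact (isGradedIdeal_idealSpan k s).mul_right x hx y)
    (fun y hy => by
      ext x
      change SuperQuot.mk k s (pmul k x y) = 0
      rw [← LinearMap.mem_ker, SuperQuot.ker_mk]
      exact (isGradedIdeal_idealSpan k s).mul_left x y hy)

theorem SuperQuot.mk_pr (s : Set L) (i : ZMod 2) (x : L) :
    pr k i (SuperQuot.mk k s x) = SuperQuot.mk k s (pr k i x) := rfl

theorem SuperQuot.mk_mul (s : Set L) (x y : L) :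
    pmul k (SuperQuot.mk k s x) (SuperQuot.mk k s y) = SuperQuot.mk k s (pmul k x y) := rfl

end LieSuper

/-! ### Contragredient Lie superalgebras -/

section Contragredient

/-- A realization of a square matrix `A`: linearly independent `α_1, …, α_n ∈ 𝔥*` and linearly
independent `h_1, …, h_n ∈ 𝔥` with `α_j(h_i) = a_{ij}` and `dim 𝔥 = 2n - rank A`. -/
structure Realization {k : Type u} [Field k] {n : ℕ} (A : Matrix (Fin n) (Fin n) k)
    (𝔥 : Type v) [AddCommGroup 𝔥] [Module k 𝔥] where
  root : Fin n → Module.Dual k 𝔥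
  coroot : Fin n → 𝔥
  root_indep : LinearIndependent k root
  coroot_indep : LinearIndependent k coroot
  root_coroot : ∀ i j, root j (coroot i) = A i j
  finite : FiniteDimensional k 𝔥
  finrank_eq : Module.finrank k 𝔥 + A.rank = 2 * n

/-- The generators: the elements of `𝔥`, and `e_i`, `f_i` for `i = 1, …, n`. -/
inductive Gen (𝔥 : Type v) (n : ℕ) : Type v
  | H : 𝔥 → Gen 𝔥 n
  | E : Fin n → Gen 𝔥 n
  | F : Fin n → Gen 𝔥 n

/-- The parity of a generator: `𝔥` is even, and `e_i`, `f_i` are odd if and only if `i ∈ τ`. -/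
def Gen.parity {𝔥 : Type v} {n : ℕ} (τ : Finset (Fin n)) : Gen 𝔥 n → ZMod 2
  | H _ => 0
  | E i => if i ∈ τ then 1 else 0
  | F i => if i ∈ τ then 1 else 0

/-- The `ℤ`-degree of a generator. -/
def Gen.degree {𝔥 : Type v} {n : ℕ} : Gen 𝔥 n → ℤ
  | H _ => 0
  | E _ => 1
  | F _ => -1

/-- The extension of a degree map from letters to nonassociative words. -/
def wordSum {X : Type v} {A : Type w} [Add A] (d : X → A) : FreeMagma X → A
  | FreeMagma.of x => d x
  | FreeMagma.mul x y => wordSum d x + wordSum d y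

/-- The free nonassociative superalgebra on a set `X` of generators with parities `p`: as an
algebra it is the free nonassociative algebra, with the parity of a word being the sum of the
parities of its letters. -/
def FreeSuper (k : Type u) [Field k] {X : Type v} (_p : X → ZMod 2) : Type (max u v) :=
  FreeNonUnitalNonAssocAlgebra k X

section Free

variable (k : Type u) [Field k] {X : Type v} (p : X → ZMod 2)

instance : AddCommGroup (FreeSuper k p) :=
  inferInstanceAs (AddCommGroup (FreeNonUnitalNonAssocAlgebra k X))

instance : Module k (FreeSuper k p) :=
  inferInstanceAs (Module k (FreeNonUnitalNonAssocAlgebra k X))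

/-- The element of the free superalgebra given by a word. -/
def FreeSuper.word (x : FreeMagma X) : FreeSuper k p :=
  (MonoidAlgebra.single x 1 : MonoidAlgebra k (FreeMagma X))

/-- The words form a basis. -/
def FreeSuper.basis : Module.Basis (FreeMagma X) k (FreeSuper k p) :=
  ⟨MonoidAlgebra.coeffLinearEquiv k⟩

theorem FreeSuper.basis_apply (x : FreeMagma X) :
    FreeSuper.basis k p x = FreeSuper.word k p x := rfl

/-- The generator attached to `x`. -/
def FreeSuper.gen (x : X) : FreeSuper k p := FreeSuper.word k p (FreeMagma.of x)

/-- The projection onto the span of the words of parity `i`. -/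
def FreeSuper.proj (i : ZMod 2) : FreeSuper k p →ₗ[k] FreeSuper k p :=
  (FreeSuper.basis k p).constr k fun x => if wordSum p x = i then FreeSuper.word k p x else 0

theorem FreeSuper.proj_word (i : ZMod 2) (x : FreeMagma X) :
    FreeSuper.proj k p i (FreeSuper.word k p x) =
      if wordSum p x = i then FreeSuper.word k p x else 0 := by
  exact (FreeSuper.basis k p).constr_basis k _ x

instance : SuperProduct k (FreeSuper k p) where
  proj := FreeSuper.proj k p
  proj_proj i j x := by
    have : FreeSuper.proj k p i ∘ₗ FreeSuper.proj k p j =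
        if i = j then FreeSuper.proj k p j else 0 := by
      refine (FreeSuper.basis k p).ext fun y => ?_
      rw [FreeSuper.basis_apply, LinearMap.comp_apply, FreeSuper.proj_word]
      by_cases h : i = j
      · subst h
        rw [if_pos rfl, FreeSuper.proj_word]
        split_ifs with h' <;> simp [FreeSuper.proj_word, h']
      · rw [if_neg h]
        split_ifs with h'
        · rw [FreeSuper.proj_word, if_neg (fun e => h (e.symm.trans h'))]; rfl
        · rw [map_zero]; rfl
    have h := LinearMap.congr_fun this x
    rw [LinearMap.comp_apply] at h
    rw [h]
    split_ifs <;> rfl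
  proj_add x := by
    have : FreeSuper.proj k p 0 + FreeSuper.proj k p 1 = LinearMap.id := by
      refine (FreeSuper.basis k p).ext fun y => ?_
      rw [FreeSuper.basis_apply, LinearMap.add_apply, FreeSuper.proj_word, FreeSuper.proj_word]
      rcases zmod2_cases (wordSum p y) with h | h <;> simp [h]
    exact LinearMap.congr_fun this x
  mul := LinearMap.mul k (FreeNonUnitalNonAssocAlgebra k X)

theorem FreeSuper.mul_word (x y : FreeMagma X) :
    pmul k (FreeSuper.word k p x) (FreeSuper.word k p y) = FreeSuper.word k p (x * y) := by
  change (MonoidAlgebra.single x 1 * MonoidAlgebra.single y 1 : MonoidAlgebra k (FreeMagma X)) =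
    MonoidAlgebra.single (x * y) 1
  rw [MonoidAlgebra.single_mul_single, one_mul]

end Free

variable {k : Type u} [Field k] {n : ℕ} {A : Matrix (Fin n) (Fin n) k} {𝔥 : Type v}
  [AddCommGroup 𝔥] [Module k 𝔥]

/-- The free nonassociative superalgebra on the generators `𝔥`, `e_i`, `f_i`. -/
abbrev FreeGen (k : Type u) [Field k] {n : ℕ} (𝔥 : Type v) (τ : Finset (Fin n)) : Type _ :=
  FreeSuper k (Gen.parity (𝔥 := 𝔥) τ)

/-- The generator attached to `h ∈ 𝔥`, in the free superalgebra. -/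
abbrev gH (k : Type u) [Field k] {n : ℕ} {𝔥 : Type v} (τ : Finset (Fin n)) (h : 𝔥) :
    FreeGen k 𝔥 τ := FreeSuper.gen k _ (Gen.H h)

/-- The generator `e_i` of the free superalgebra. -/
abbrev gE (k : Type u) [Field k] {n : ℕ} (𝔥 : Type v) (τ : Finset (Fin n)) (i : Fin n) :
    FreeGen k 𝔥 τ := FreeSuper.gen k _ (Gen.E i)

/-- The generator `f_i` of the free superalgebra. -/
abbrev gF (k : Type u) [Field k] {n : ℕ} (𝔥 : Type v) (τ : Finset (Fin n)) (i : Fin n) :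
    FreeGen k 𝔥 τ := FreeSuper.gen k _ (Gen.F i)

/-- The relators: those making the quotient a Lie superalgebra, the linear relations of `𝔥`, and
`[h, h'] = 0`, `[h, e_i] = α_i(h) e_i`, `[h, f_i] = -α_i(h) f_i`, `[e_i, f_j] = δ_{ij} h_i`. -/
inductive Relator (R : Realization A 𝔥) (τ : Finset (Fin n)) : FreeGen k 𝔥 τ → Prop
  | skew (i j : ZMod 2) (x y : FreeGen k 𝔥 τ) (hx : x ∈ part k (FreeGen k 𝔥 τ) i)
      (hy : y ∈ part k (FreeGen k 𝔥 τ) j) :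
      Relator R τ (pmul k x y + sgn k (i * j) • pmul k y x)
  | jacobi (i j : ZMod 2) (x y z : FreeGen k 𝔥 τ) (hx : x ∈ part k (FreeGen k 𝔥 τ) i)
      (hy : y ∈ part k (FreeGen k 𝔥 τ) j) :
      Relator R τ (pmul k x (pmul k y z) -
        (pmul k (pmul k x y) z + sgn k (i * j) • pmul k y (pmul k x z)))
  | cube (x : FreeGen k 𝔥 τ) (hx : x ∈ part k (FreeGen k 𝔥 τ) 1) :
      Relator R τ (pmul k x (pmul k x x))
  | add (h h' : 𝔥) : Relator R τ (gH k τ (h + h') - (gH k τ h + gH k τ h'))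
  | smul (c : k) (h : 𝔥) : Relator R τ (gH k τ (c • h) - c • gH k τ h)
  | HH (h h' : 𝔥) : Relator R τ (pmul k (gH k τ h) (gH k τ h'))
  | HE (h : 𝔥) (i : Fin n) :
      Relator R τ (pmul k (gH k τ h) (gE k 𝔥 τ i) - R.root i h • gE k 𝔥 τ i)
  | HF (h : 𝔥) (i : Fin n) :
      Relator R τ (pmul k (gH k τ h) (gF k 𝔥 τ i) + R.root i h • gF k 𝔥 τ i)
  | EF (i j : Fin n) :
      Relator R τ (pmul k (gE k 𝔥 τ i) (gF k 𝔥 τ j) - if i = j then gH k τ (R.coroot i) else 0)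

/-- The Lie superalgebra `g̃(A, τ)` generated by `𝔥` and the `e_i`, `f_i`, subject to the relations
above. -/
abbrev GTilde (R : Realization A 𝔥) (τ : Finset (Fin n)) : Type _ :=
  SuperQuot k {x : FreeGen k 𝔥 τ | Relator R τ x}

/-- The image of `𝔥` in `g̃(A, τ)`. -/
def cartan (R : Realization A 𝔥) (τ : Finset (Fin n)) : Submodule k (GTilde R τ) :=
  Submodule.span k {z | ∃ h : 𝔥, z = SuperQuot.mk k _ (gH k τ h)}

/-- The homogeneous component of degree `m` of `g̃(A, τ)`, where `deg e_i = 1 = -deg f_i` and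
`deg h = 0`. -/
def zPart (R : Realization A 𝔥) (τ : Finset (Fin n)) (m : ℤ) : Submodule k (GTilde R τ) :=
  Submodule.span k {z | ∃ x : FreeMagma (Gen 𝔥 n), wordSum Gen.degree x = m ∧
    z = SuperQuot.mk k _ (FreeSuper.word k (Gen.parity (𝔥 := 𝔥) τ) x)}

/-- The union of the homogeneous (that is, `ℤ`-graded) ideals of `g̃(A, τ)` that intersect `𝔥`
trivially. The ideal it generates is their sum, the largest such ideal. -/
def trivialIdeals (R : Realization A 𝔥) (τ : Finset (Fin n)) : Set (GTilde R τ) :=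
  {x | ∃ J : Submodule k (GTilde R τ), IsGradedIdeal J ∧ J ≤ ⨆ m, J ⊓ zPart R τ m ∧
    J ⊓ cartan R τ = ⊥ ∧ x ∈ J}

/-- The contragredient Lie superalgebra `g(A, τ)`. -/
abbrev Contragredient (R : Realization A 𝔥) (τ : Finset (Fin n)) : Type _ :=
  SuperQuot k (trivialIdeals R τ)

/-- The centerless contragredient Lie superalgebra `g(A, τ)/c`, with `c` the centre of
`g(A, τ)`. -/
abbrev CenterlessContragredient (R : Realization A 𝔥) (τ : Finset (Fin n)) : Type _ :=
  SuperQuot k (centre k (Contragredient R τ))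

/-- The Cartan matrix attached to `S2` and `S12`. -/
def cartanMatrix (k : Type u) [Field k] : Matrix (Fin 3) (Fin 3) k :=
  !![2, -1, -1; -1, 2, -1; 1, 1, 0]

end Contragredient

/-! ### The projective general linear Lie algebra -/

attribute [local instance] LieRing.ofAssociativeRing

section PGL

variable (k : Type u) [Field k] (n : ℕ)

/-- The ideal of scalar matrices of `gl_n`. -/
def scalars : LieIdeal k (Matrix (Fin n) (Fin n) k) where
  toSubmodule := Submodule.span k {1}
  lie_mem {x m} hm := by
    obtain ⟨c, rfl⟩ := Submodule.mem_span_singleton.1 hm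
    simp [LieRing.of_associative_ring_bracket]

/-- The projective general linear Lie algebra `gl_n/k1`. -/
abbrev PGL : Type u := Matrix (Fin n) (Fin n) k ⧸ scalars k n

/-- The ideal of `pgl_n` formed by the classes of the matrices of trace `0`. If the characteristic
divides `n`, this is `psl_n = sl_n/k1`. -/
def PSL : LieIdeal k (PGL k n) where
  toSubmodule := (LinearMap.ker (Matrix.traceLinearMap (Fin n) k k)).map
    (LieSubmodule.Quotient.mk' (scalars k n)).toLinearMap
  lie_mem {x m} hm := by
    obtain ⟨b, _, rfl⟩ := hm
    obtain ⟨a, rfl⟩ := LieSubmodule.Quotient.surjective_mk' (scalars k n) x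
    refine ⟨⁅a, b⁆, ?_, rfl⟩
    change Matrix.trace ⁅a, b⁆ = 0
    rw [LieRing.of_associative_ring_bracket, Matrix.trace_sub, Matrix.trace_mul_comm, sub_self]

end PGL

end MagicSquare

end

open scoped TensorProduct

attribute [local instance] LieRing.ofAssociativeRing

open MagicSquare

/-!
The proof compares three descriptions of the same superalgebra.

The middle one is elementary. Let `𝔥 = psl₃`, an ideal of `𝔤 = pgl₃` since `3 = 0` in `k`, and let
`B(a, b) = -tr(ab)` on `𝔥`. The space `𝔥` is that of the trace zero octonions, and in characteristic
`3` its bracket is a cross product: `[a, [a, c]] = B(a, a)c - B(a, c)a` (`PGL3.isCrossForm`). This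
identity and the invariance of `B` are all that is needed for `(𝔤 ⊕ 𝔰𝔩₂) ⊕ (𝔥 ⊗ V)`, with `V` the
natural module of `𝔰𝔩₂` and `[a ⊗ u, b ⊗ v] = ⟨u|v⟩[a, b] + B(a, b) u ∘ v`, to be a Lie superalgebra
(`Double.isLieSuperalgebra`). It is called the double of `psl₃ ⊂ pgl₃` below. Its even and odd parts
are as required by construction (`Double.evEquiv`, `Double.odEquiv`). A nonzero graded subspace
stable under the core `(𝔥 ⊕ 𝔰𝔩₂) ⊕ (𝔥 ⊗ V)` contains the core (`Double.core_le`); hence the core is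
simple, and it is the derived superalgebra. It has codimension `1` since `psl₃` has codimension `1`
in `pgl₃`.

The double is isomorphic to `g(S₂, S₁,₂)` (`PGL3.magicIso`). In characteristic `3` the triality
algebra of `S₂` is a two-dimensional torus, the diagonal subalgebra of `pgl₃`, and the three
components of a triality triple of `S₁,₂` agree, so that the triality superalgebra is the
superalgebra `𝔬𝔰𝔭(1, 2) = 𝔰𝔩₂ ⊕ V`; its odd part corresponds to the zero weight space of `psl₃ ⊗ V`.
The three copies of `S₂ ⊗ S₁,₂` are the sums of the six root spaces, each of them being `k ⊕ V`. The
isomorphism is verified in coordinates.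

The double is also the contragredient superalgebra modulo its centre (`PGL3.nonempty_superIso`). This
follows from a criterion valid for all matrices and parities (`IsChevalley.nonempty_superIso`):
let `L` be a Lie superalgebra with trivial centre, generated by elements satisfying the defining
relations of `g̃(A, τ)`, and with a compatible `ℤ`-grading such that no nonzero graded ideal lies in
the sum of the components of nonzero degree. Then the kernels of `g̃(A, τ) → L` and of
`g̃(A, τ) → g(A, τ)/c` coincide. The homogeneous elements of the first kernel are treated by degree.
Those of degree `0` lie in `𝔥`, by the triangular decomposition of `g̃(A, τ)`, and are central.
Those of degree `±1` vanish. The remaining ones span an ideal that meets `𝔥` trivially. Conversely,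
the image in `L` of a homogeneous ideal meeting `𝔥` trivially is zero. That the homogeneous
components of `g̃(A, τ)` are independent is seen by mapping it to its loop superalgebra.
The Chevalley generators of the double are `E₁₂`, `E₂₃`, `E₃₁ ⊗ v₀` and `E₂₁`, `E₃₂`, `-E₁₃ ⊗ v₁`.
-/


noncomputable section

namespace MagicSquare

universe u v w

/-! ### Homomorphisms of superalgebras -/

section Hom

variable {k : Type u} [Field k] {L : Type v} [AddCommGroup L] [Module k L] [SuperProduct k L]
  {M : Type w} [AddCommGroup M] [Module k M] [SuperProduct k M]

/-- A linear map is a homomorphism of superalgebras if it preserves parities and products. -/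
structure IsSuperHom (f : L →ₗ[k] M) : Prop where
  map_pr : ∀ i x, f (pr k i x) = pr k i (f x)
  map_mul : ∀ x y, f (pmul k x y) = pmul k (f x) (f y)

theorem IsSuperHom.comp {N : Type*} [AddCommGroup N] [Module k N] [SuperProduct k N]
    {g : M →ₗ[k] N} {f : L →ₗ[k] M} (hg : IsSuperHom g) (hf : IsSuperHom f) :
    IsSuperHom (g ∘ₗ f) where
  map_pr i x := by simp [hf.map_pr, hg.map_pr]
  map_mul x y := by simp [hf.map_mul, hg.map_mul]

theorem isSuperHom_mk (s : Set L) : IsSuperHom (SuperQuot.mk k s) where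
  map_pr i x := (SuperQuot.mk_pr k s i x).symm
  map_mul x y := (SuperQuot.mk_mul k s x y).symm

theorem IsSuperHom.map_mem {f : L →ₗ[k] M} (hf : IsSuperHom f) {i : ZMod 2} {x : L}
    (hx : x ∈ part k L i) : f x ∈ part k M i := by
  rw [mem_part] at hx ⊢
  rw [← hf.map_pr, hx]

theorem IsSuperHom.isGradedIdeal_ker {f : L →ₗ[k] M} (hf : IsSuperHom f) :
    IsGradedIdeal (LinearMap.ker f) where
  graded i x hx := by
    rw [LinearMap.mem_ker] at hx ⊢
    rw [hf.map_pr, hx, map_zero]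
  mul_left x y hy := by
    rw [LinearMap.mem_ker] at hy ⊢
    rw [hf.map_mul, hy, map_zero]
  mul_right x hx y := by
    rw [LinearMap.mem_ker] at hx ⊢
    rw [hf.map_mul, hx, map_zero, LinearMap.zero_apply]

theorem IsSuperHom.isGradedIdeal_map {f : L →ₗ[k] M} (hf : IsSuperHom f)
    (hs : Function.Surjective f) {J : Submodule k L} (hJ : IsGradedIdeal J) :
    IsGradedIdeal (J.map f) where
  graded := by
    rintro i _ ⟨x, hx, rfl⟩
    exact ⟨_, hJ.graded i x hx, hf.map_pr i x⟩
  mul_left := by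
    rintro x _ ⟨y, hy, rfl⟩
    obtain ⟨x, rfl⟩ := hs x
    exact ⟨_, hJ.mul_left x y hy, hf.map_mul x y⟩
  mul_right := by
    rintro _ ⟨x, hx, rfl⟩ y
    obtain ⟨y, rfl⟩ := hs y
    exact ⟨_, hJ.mul_right x hx y, hf.map_mul x y⟩

theorem subset_idealSpan (s : Set L) : s ⊆ idealSpan k s := fun x hx => by
  simp only [idealSpan, SetLike.mem_coe, Submodule.mem_sInf]
  exact fun J hJ => hJ.2 hx

theorem idealSpan_le {s : Set L} {J : Submodule k L} (hJ : IsGradedIdeal J) (h : s ⊆ J) :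
    idealSpan k s ≤ J := sInf_le ⟨hJ, h⟩

theorem SuperQuot.mk_eq_zero_of_mem {s : Set L} {x : L} (hx : x ∈ s) : SuperQuot.mk k s x = 0 := by
  rw [← LinearMap.mem_ker, SuperQuot.ker_mk]
  exact subset_idealSpan s hx

/-- The homomorphism induced on a quotient by a homomorphism vanishing on the relators. -/
def SuperQuot.lift {s : Set L} (f : L →ₗ[k] M) (hf : IsSuperHom f) (h : ∀ x ∈ s, f x = 0) :
    SuperQuot k s →ₗ[k] M :=
  (idealSpan k s).liftQ f (idealSpan_le hf.isGradedIdeal_ker h)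

theorem SuperQuot.lift_mk {s : Set L} (f : L →ₗ[k] M) (hf : IsSuperHom f) (h : ∀ x ∈ s, f x = 0)
    (x : L) : SuperQuot.lift f hf h (SuperQuot.mk k s x) = f x := rfl

theorem SuperQuot.isSuperHom_lift {s : Set L} (f : L →ₗ[k] M) (hf : IsSuperHom f)
    (h : ∀ x ∈ s, f x = 0) : IsSuperHom (SuperQuot.lift f hf h) where
  map_pr i x := by
    obtain ⟨x, rfl⟩ := SuperQuot.mk_surjective k s x
    rw [SuperQuot.mk_pr, SuperQuot.lift_mk, SuperQuot.lift_mk, hf.map_pr]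
  map_mul x y := by
    obtain ⟨x, rfl⟩ := SuperQuot.mk_surjective k s x
    obtain ⟨y, rfl⟩ := SuperQuot.mk_surjective k s y
    rw [SuperQuot.mk_mul, SuperQuot.lift_mk, SuperQuot.lift_mk, SuperQuot.lift_mk, hf.map_mul]

/-- Two surjective homomorphisms with the same kernel have isomorphic targets. -/
theorem nonempty_superIso_of_ker_eq {N : Type*} [AddCommGroup N] [Module k N] [SuperProduct k N]
    {f : L →ₗ[k] M} {g : L →ₗ[k] N} (hf : IsSuperHom f) (hg : IsSuperHom g)
    (sf : Function.Surjective f) (sg : Function.Surjective g)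
    (h : LinearMap.ker f = LinearMap.ker g) : Nonempty (SuperIso k M N) := by
  let e : M ≃ₗ[k] N := (f.quotKerEquivOfSurjective sf).symm ≪≫ₗ
    Submodule.quotEquivOfEq _ _ h ≪≫ₗ g.quotKerEquivOfSurjective sg
  have he : ∀ x, e (f x) = g x := by
    intro x
    have : (f.quotKerEquivOfSurjective sf).symm (f x) = (LinearMap.ker f).mkQ x := by
      rw [LinearEquiv.symm_apply_eq]; rfl
    simp only [e, LinearEquiv.trans_apply, this]
    rfl
  refine ⟨{ e with map_pr := fun i x => ?_, map_mul := fun x y => ?_ }⟩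
  · obtain ⟨x, rfl⟩ := sf x
    change e (pr k i (f x)) = pr k i (e (f x))
    rw [← hf.map_pr, he, he, hg.map_pr]
  · obtain ⟨x, rfl⟩ := sf x
    obtain ⟨y, rfl⟩ := sf y
    change e (pmul k (f x) (f y)) = pmul k (e (f x)) (e (f y))
    rw [← hf.map_mul, he, he, he, hg.map_mul]

/-- A bijective homomorphism is an isomorphism. -/
def SuperIso.ofBijective (f : L →ₗ[k] M) (hf : IsSuperHom f) (hb : Function.Bijective f) :
    SuperIso k L M :=
  { LinearEquiv.ofBijective f hb with
    map_pr := hf.map_pr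
    map_mul := hf.map_mul }

theorem SuperIso.isSuperHom (e : SuperIso k L M) : IsSuperHom (e.toLinearEquiv : L →ₗ[k] M) where
  map_pr := e.map_pr
  map_mul := e.map_mul

theorem SuperIso.isSuperHom_symm (e : SuperIso k L M) :
    IsSuperHom (e.toLinearEquiv.symm : M →ₗ[k] L) where
  map_pr i x := by
    apply e.toLinearEquiv.injective
    simp only [LinearEquiv.coe_coe]
    have := e.isSuperHom.map_pr i (e.toLinearEquiv.symm x)
    simp only [LinearEquiv.coe_coe, LinearEquiv.apply_symm_apply] at this
    rw [this, LinearEquiv.apply_symm_apply]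
  map_mul x y := by
    apply e.toLinearEquiv.injective
    simp only [LinearEquiv.coe_coe]
    have := e.isSuperHom.map_mul (e.toLinearEquiv.symm x) (e.toLinearEquiv.symm y)
    simp only [LinearEquiv.coe_coe, LinearEquiv.apply_symm_apply] at this
    rw [this, LinearEquiv.apply_symm_apply]

/-- The inverse of an isomorphism of superalgebras. -/
def SuperIso.symm (e : SuperIso k L M) : SuperIso k M L :=
  { e.toLinearEquiv.symm with
    map_pr := e.isSuperHom_symm.map_pr
    map_mul := e.isSuperHom_symm.map_mul }

/-- The composite of two isomorphisms of superalgebras. -/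
def SuperIso.trans {N : Type*} [AddCommGroup N] [Module k N] [SuperProduct k N]
    (e : SuperIso k L M) (e' : SuperIso k M N) : SuperIso k L N :=
  { e.toLinearEquiv ≪≫ₗ e'.toLinearEquiv with
    map_pr := (e'.isSuperHom.comp e.isSuperHom).map_pr
    map_mul := (e'.isSuperHom.comp e.isSuperHom).map_mul }

theorem IsLieSuperalgebra.of_injective (hM : IsLieSuperalgebra k M) {f : L →ₗ[k] M}
    (hf : IsSuperHom f) (hi : Function.Injective f) : IsLieSuperalgebra k L where
  mul_mem i j x hx y hy := by
    have := hM.mul_mem i j _ (hf.map_mem hx) _ (hf.map_mem hy)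
    rw [mem_part] at this ⊢
    apply hi
    rw [hf.map_pr, hf.map_mul, this]
  skew i j x hx y hy := by
    apply hi
    rw [hf.map_mul, hM.skew i j _ (hf.map_mem hx) _ (hf.map_mem hy), map_neg, map_smul, hf.map_mul]
  jacobi i j x hx y hy z := by
    apply hi
    simp only [map_add, map_smul, hf.map_mul]
    exact hM.jacobi i j _ (hf.map_mem hx) _ (hf.map_mem hy) _
  cube x hx := by
    apply hi
    rw [hf.map_mul, hf.map_mul, map_zero, hM.cube _ (hf.map_mem hx)]

theorem derived_map {f : L →ₗ[k] M} (hf : IsSuperHom f) (hs : Function.Surjective f) :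
    (derived k L).map f = derived k M := by
  rw [derived, Submodule.map_span, derived]
  congr 1
  ext z
  constructor
  · rintro ⟨_, ⟨x, y, rfl⟩, rfl⟩
    exact ⟨f x, f y, hf.map_mul x y⟩
  · rintro ⟨x, y, rfl⟩
    obtain ⟨x, rfl⟩ := hs x
    obtain ⟨y, rfl⟩ := hs y
    exact ⟨_, ⟨x, y, rfl⟩, hf.map_mul x y⟩

theorem IsSimpleSub.map {f : L →ₗ[k] M} (hf : IsSuperHom f) (hb : Function.Bijective f)
    {D : Submodule k L} (hD : IsSimpleSub D) : IsSimpleSub (D.map f) where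
  graded := by
    rintro i _ ⟨x, hx, rfl⟩
    exact ⟨_, hD.graded i x hx, hf.map_pr i x⟩
  mul_mem := by
    rintro _ ⟨x, hx, rfl⟩ _ ⟨y, hy, rfl⟩
    exact ⟨_, hD.mul_mem x hx y hy, hf.map_mul x y⟩
  nonabelian := by
    obtain ⟨x, hx, y, hy, h⟩ := hD.nonabelian
    refine ⟨_, ⟨x, hx, rfl⟩, _, ⟨y, hy, rfl⟩, ?_⟩
    rw [← hf.map_mul]
    exact fun h0 => h (hb.1 (h0.trans (map_zero f).symm))
  eq_bot_or_eq J hJ hg hm := by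
    have hJ' : (J.comap f).map f = J := Submodule.map_comap_eq_of_surjective hb.2 J
    have hle : J.comap f ≤ D := by
      rw [← Submodule.comap_map_eq_of_injective hb.1 D]
      exact Submodule.comap_mono hJ
    rcases hD.eq_bot_or_eq (J.comap f) hle
      (fun i x hx => by
        rw [Submodule.mem_comap, hf.map_pr]
        exact hg i _ hx)
      (fun x hx y hy => by
        rw [Submodule.mem_comap, Submodule.mem_comap, hf.map_mul, hf.map_mul]
        exact hm _ ⟨x, hx, rfl⟩ _ hy) with h | h
    · left; rw [← hJ', h, Submodule.map_bot]
    · right; rw [← hJ', h]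

end Hom

/-! ### Loop superalgebras -/

section Loop

variable {k : Type u} [Field k] {L : Type v} [AddCommGroup L] [Module k L] [SuperProduct k L]

/-- In a superalgebra satisfying the graded skew-symmetry and Jacobi identities, the cubic map
`x ↦ [x, [x, x]]` is additive on the odd part. -/
theorem cube_add
    (hskew : ∀ (i j : ZMod 2), ∀ x ∈ part k L i, ∀ y ∈ part k L j,
      pmul k x y = -(sgn k (i * j) • pmul k y x))
    (hjac : ∀ (i j : ZMod 2), ∀ x ∈ part k L i, ∀ y ∈ part k L j, ∀ z : L,
      pmul k x (pmul k y z) = pmul k (pmul k x y) z + sgn k (i * j) • pmul k y (pmul k x z))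
    (hmul : ∀ (i j : ZMod 2), ∀ x ∈ part k L i, ∀ y ∈ part k L j, pmul k x y ∈ part k L (i + j))
    {x y : L} (hx : x ∈ part k L 1) (hy : y ∈ part k L 1) :
    pmul k (x + y) (pmul k (x + y) (x + y)) = pmul k x (pmul k x x) + pmul k y (pmul k y y) := by
  have key : ∀ x ∈ part k L 1, ∀ y ∈ part k L 1,
      pmul k x (pmul k x y) + pmul k x (pmul k x y) + pmul k y (pmul k x x) = 0 := by
    intro x hx y hy
    have h1 := hjac 1 1 x hx x hx y
    have h2 := hskew (1 + 1) 1 _ (hmul 1 1 x hx x hx) y hy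
    rw [h2] at h1
    simp only [show (1 : ZMod 2) + 1 = 0 from rfl, mul_one, sgn_zero, sgn_one, one_smul,
      neg_smul] at h1
    nth_rewrite 1 [h1]
    abel
  have hs : pmul k y x = pmul k x y := by
    have := hskew 1 1 y hy x hx
    simpa [sgn_one] using this
  have h1 := key x hx y hy
  have h2 := key y hy x hx
  rw [hs] at h2
  simp only [map_add, LinearMap.add_apply, hs]
  linear_combination (norm := module) h1 + h2

variable (k L) in
/-- The loop superalgebra `L ⊗ k[t, t⁻¹]`, where `Finsupp.single m x` stands for `x ⊗ t ^ m`. -/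
def Loop : Type v := ℤ →₀ L

instance : AddCommGroup (Loop L) := inferInstanceAs (AddCommGroup (ℤ →₀ L))

instance : Module k (Loop L) := inferInstanceAs (Module k (ℤ →₀ L))

variable (k) in
/-- The element `x ⊗ t ^ m`. -/
def Loop.single (m : ℤ) : L →ₗ[k] Loop L := Finsupp.lsingle m

variable (k) in
/-- The coefficient of `t ^ m`. -/
def Loop.coeff (m : ℤ) : Loop L →ₗ[k] L := Finsupp.lapply m

omit [SuperProduct k L] in
theorem Loop.coeff_single (m j : ℤ) (x : L) :
    Loop.coeff k m (Loop.single k j x) = if j = m then x else 0 :=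
  Finsupp.single_apply

omit [SuperProduct k L] in
theorem Loop.hom_ext {M : Type*} [AddCommGroup M] [Module k M] {f g : Loop L →ₗ[k] M}
    (h : ∀ m x, f (Loop.single k m x) = g (Loop.single k m x)) : f = g :=
  Finsupp.lhom_ext h

variable (k L) in
/-- The product `[x ⊗ t ^ a, y ⊗ t ^ b] = [x, y] ⊗ t ^ (a + b)`. -/
def Loop.mul : Loop L →ₗ[k] Loop L →ₗ[k] Loop L :=
  Finsupp.lsum k fun a => LinearMap.flip (Finsupp.lsum k fun b =>
    LinearMap.flip ((pmul k (V := L)).compr₂ (Loop.single k (a + b))))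

variable (k L) in
/-- The parity projections of the loop superalgebra. -/
def Loop.proj (i : ZMod 2) : Loop L →ₗ[k] Loop L := Finsupp.mapRange.linearMap (pr k i)

theorem Loop.proj_single (i : ZMod 2) (m : ℤ) (x : L) :
    Loop.proj k L i (Loop.single k m x) = Loop.single k m (pr k i x) :=
  Finsupp.mapRange_single (hf := map_zero _)

theorem Loop.mul_single (a b : ℤ) (x y : L) :
    Loop.mul k L (Loop.single k a x) (Loop.single k b y) = Loop.single k (a + b) (pmul k x y) := by
  have h1 : Loop.mul k L (Loop.single k a x) = (LinearMap.flip (Finsupp.lsum k fun b =>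
    LinearMap.flip ((pmul k (V := L)).compr₂ (Loop.single k (a + b))))) x :=
    Finsupp.lsum_single ..
  have h2 : (Finsupp.lsum k fun b => LinearMap.flip
      ((pmul k (V := L)).compr₂ (Loop.single k (a + b)))) (Loop.single k b y) =
      LinearMap.flip ((pmul k (V := L)).compr₂ (Loop.single k (a + b))) y :=
    Finsupp.lsum_single ..
  exact (LinearMap.congr_fun h1 _).trans (LinearMap.congr_fun h2 x)

instance : SuperProduct k (Loop L) where
  proj := Loop.proj k L
  proj_proj i j x := by
    have : Loop.proj k L i ∘ₗ Loop.proj k L j = if i = j then Loop.proj k L j else 0 := by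
      refine Loop.hom_ext fun m x => ?_
      rw [LinearMap.comp_apply, Loop.proj_single, Loop.proj_single, SuperSpace.proj_proj]
      split_ifs
      · rw [Loop.proj_single]
      · rw [map_zero, LinearMap.zero_apply]
    have h := LinearMap.congr_fun this x
    rw [LinearMap.comp_apply] at h
    rw [h]
    split_ifs <;> rfl
  proj_add x := by
    have : Loop.proj k L 0 + Loop.proj k L 1 = LinearMap.id := by
      refine Loop.hom_ext fun m x => ?_
      rw [LinearMap.add_apply, Loop.proj_single, Loop.proj_single, ← map_add, SuperSpace.proj_add,
        LinearMap.id_apply]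
    exact LinearMap.congr_fun this x
  mul := Loop.mul k L

theorem Loop.pr_single (i : ZMod 2) (m : ℤ) (x : L) :
    pr k i (Loop.single k m x) = Loop.single k m (pr k i x) := Loop.proj_single i m x

theorem Loop.pmul_single (a b : ℤ) (x y : L) :
    pmul k (Loop.single k a x) (Loop.single k b y) = Loop.single k (a + b) (pmul k x y) :=
  Loop.mul_single a b x y

theorem Loop.single_mem {i : ZMod 2} {m : ℤ} {x : L} (hx : x ∈ part k L i) :
    Loop.single k m x ∈ part k (Loop L) i := by
  rw [mem_part] at hx ⊢
  rw [Loop.pr_single, hx]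

omit [SuperProduct k L] in
theorem Loop.induction {P : Loop L → Prop} (h0 : P 0) (hadd : ∀ x y, P x → P y → P (x + y))
    (hs : ∀ m x, P (Loop.single k m x)) (x : Loop L) : P x :=
  Finsupp.induction_linear x h0 hadd hs

theorem Loop.part_induction {i : ZMod 2} {P : Loop L → Prop} (h0 : P 0)
    (hadd : ∀ x ∈ part k (Loop L) i, ∀ y ∈ part k (Loop L) i, P x → P y → P (x + y))
    (hs : ∀ m, ∀ x ∈ part k L i, P (Loop.single k m x)) {x : Loop L}
    (hx : x ∈ part k (Loop L) i) : P x := by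
  have : ∀ x : Loop L, P (pr k i x) := by
    refine Loop.induction (k := k) (by rwa [map_zero]) (fun x y h1 h2 => ?_) fun m x => ?_
    · rw [map_add]
      exact hadd _ (pr_mem_part _ _) _ (pr_mem_part _ _) h1 h2
    · rw [Loop.pr_single]
      exact hs m _ (pr_mem_part _ _)
  rw [mem_part] at hx
  rw [← hx]
  exact this x

/-- The loop superalgebra of a Lie superalgebra is a Lie superalgebra. -/
theorem IsLieSuperalgebra.loop (hL : IsLieSuperalgebra k L) : IsLieSuperalgebra k (Loop L) := by
  have hmul : ∀ (i j : ZMod 2), ∀ x ∈ part k (Loop L) i, ∀ y ∈ part k (Loop L) j,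
      pmul k x y ∈ part k (Loop L) (i + j) := by
    intro i j x hx y hy
    refine Loop.part_induction (P := fun x : Loop L => pmul k x y ∈ part k (Loop L) (i + j)) ?_
      (fun x _ x' _ h h' => ?_) (fun a x hx => ?_) hx
    · simp
    · rw [map_add, LinearMap.add_apply]
      exact add_mem h h'
    refine Loop.part_induction (P := fun y : Loop L =>
        pmul k (Loop.single k a x) y ∈ part k (Loop L) (i + j)) ?_
      (fun y _ y' _ h h' => ?_) (fun b y hy => ?_) hy
    · simp
    · rw [map_add]
      exact add_mem h h'
    rw [Loop.pmul_single]
    exact Loop.single_mem (hL.mul_mem i j x hx y hy)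
  have hskew : ∀ (i j : ZMod 2), ∀ x ∈ part k (Loop L) i, ∀ y ∈ part k (Loop L) j,
      pmul k x y = -(sgn k (i * j) • pmul k y x) := by
    intro i j x hx y hy
    refine Loop.part_induction
      (P := fun x : Loop L => pmul k x y = -(sgn k (i * j) • pmul k y x)) ?_
      (fun x _ x' _ h h' => ?_) (fun a x hx => ?_) hx
    · simp
    · rw [map_add, LinearMap.add_apply, h, h', map_add]
      module
    refine Loop.part_induction (P := fun y : Loop L =>
        pmul k (Loop.single k a x) y = -(sgn k (i * j) • pmul k y (Loop.single k a x))) ?_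
      (fun y _ y' _ h h' => ?_) (fun b y hy => ?_) hy
    · simp
    · rw [map_add, h, h', map_add, LinearMap.add_apply]
      module
    rw [Loop.pmul_single, Loop.pmul_single, hL.skew i j x hx y hy, map_neg, map_smul, add_comm b]
  have hjac : ∀ (i j : ZMod 2), ∀ x ∈ part k (Loop L) i, ∀ y ∈ part k (Loop L) j, ∀ z : Loop L,
      pmul k x (pmul k y z) = pmul k (pmul k x y) z + sgn k (i * j) • pmul k y (pmul k x z) := by
    intro i j x hx y hy z
    refine Loop.part_induction (P := fun x : Loop L => pmul k x (pmul k y z) =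
      pmul k (pmul k x y) z + sgn k (i * j) • pmul k y (pmul k x z)) ?_
      (fun x _ x' _ h h' => ?_) (fun a x hx => ?_) hx
    · simp
    · simp only [map_add, LinearMap.add_apply, h, h']
      module
    refine Loop.part_induction (P := fun y : Loop L =>
        pmul k (Loop.single k a x) (pmul k y z) =
      pmul k (pmul k (Loop.single k a x) y) z +
        sgn k (i * j) • pmul k y (pmul k (Loop.single k a x) z)) ?_
      (fun y _ y' _ h h' => ?_) (fun b y hy => ?_) hy
    · simp
    · simp only [map_add, LinearMap.add_apply, h, h']
      module
    refine Loop.induction (k := k) (P := fun z : Loop L =>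
      pmul k (Loop.single k a x) (pmul k (Loop.single k b y) z) =
        pmul k (pmul k (Loop.single k a x) (Loop.single k b y)) z +
          sgn k (i * j) • pmul k (Loop.single k b y) (pmul k (Loop.single k a x) z)) ?_
      (fun z z' h h' => ?_) (fun c z => ?_) z
    · simp
    · simp only [map_add, h, h']
      module
    rw [Loop.pmul_single b c, Loop.pmul_single a, Loop.pmul_single a b, Loop.pmul_single (a + b),
      Loop.pmul_single a c, Loop.pmul_single b, hL.jacobi i j x hx y hy z, map_add, map_smul,
      add_assoc, add_left_comm b a c]
  refine ⟨hmul, hskew, hjac, fun x hx => ?_⟩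
  refine Loop.part_induction (P := fun x : Loop L => pmul k x (pmul k x x) = 0) ?_
    (fun x hx y hy h h' => ?_) (fun a x hx => ?_) hx
  · simp
  · rw [cube_add hskew hjac hmul hx hy, h, h', add_zero]
  · rw [Loop.pmul_single, Loop.pmul_single, hL.cube x hx, map_zero]

end Loop

/-! ### The Lie superalgebra `g̃(A, τ)` -/

section Lift

variable {k : Type u} [Field k] {X : Type v} (p : X → ZMod 2)
  {L : Type w} [AddCommGroup L] [Module k L] [SuperProduct k L]

/-- The value of a nonassociative word under an assignment of the letters. -/
def evalWord (e : X → L) : FreeMagma X → L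
  | FreeMagma.of x => e x
  | FreeMagma.mul x y => pmul k (evalWord e x) (evalWord e y)

/-- The linear extension of an assignment of the letters to the free superalgebra. -/
def FreeSuper.lift (e : X → L) : FreeSuper k p →ₗ[k] L :=
  (FreeSuper.basis k p).constr k (evalWord (k := k) e)

theorem FreeSuper.lift_word (e : X → L) (x : FreeMagma X) :
    FreeSuper.lift p e (FreeSuper.word k p x) = evalWord (k := k) e x :=
  (FreeSuper.basis k p).constr_basis k _ x

theorem evalWord_mem (hL : IsLieSuperalgebra k L) {e : X → L} (he : ∀ x, e x ∈ part k L (p x))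
    (x : FreeMagma X) : evalWord (k := k) e x ∈ part k L (wordSum p x) := by
  induction x using FreeMagma.recOnMul with
  | ih1 x => exact he x
  | ih2 x y hx hy => exact hL.mul_mem _ _ _ hx _ hy

theorem FreeSuper.word_induction {P : FreeSuper k p → Prop} (h0 : P 0)
    (hadd : ∀ x y, P x → P y → P (x + y)) (hsmul : ∀ (c : k) x, P x → P (c • x))
    (hw : ∀ x, P (FreeSuper.word k p x)) (x : FreeSuper k p) : P x := by
  have hx : x ∈ Submodule.span k (Set.range (FreeSuper.basis k p)) := by
    rw [(FreeSuper.basis k p).span_eq]; trivial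
  induction hx using Submodule.span_induction with
  | mem x hx =>
    obtain ⟨y, rfl⟩ := hx
    exact hw y
  | zero => exact h0
  | add x y _ _ hx hy => exact hadd x y hx hy
  | smul c x _ hx => exact hsmul c x hx

theorem FreeSuper.isSuperHom_lift (hL : IsLieSuperalgebra k L) {e : X → L}
    (he : ∀ x, e x ∈ part k L (p x)) : IsSuperHom (FreeSuper.lift (k := k) p e) where
  map_pr i x := by
    induction x using FreeSuper.word_induction with
    | h0 => simp
    | hadd x y hx hy => rw [map_add, map_add, map_add, map_add, hx, hy]
    | hsmul c x hx => rw [map_smul, map_smul, map_smul, map_smul, hx]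
    | hw x =>
      change FreeSuper.lift p e (FreeSuper.proj k p i _) = _
      rw [FreeSuper.proj_word, FreeSuper.lift_word, pr_of_mem (evalWord_mem p hL he x)]
      by_cases h : wordSum p x = i
      · rw [if_pos h, if_pos h.symm, FreeSuper.lift_word]
      · rw [if_neg h, if_neg (Ne.symm h), map_zero]
  map_mul x y := by
    induction x using FreeSuper.word_induction with
    | h0 => simp
    | hadd x y hx hy => simp only [map_add, LinearMap.add_apply, hx, hy]
    | hsmul c x hx => simp only [map_smul, LinearMap.smul_apply, hx]
    | hw x =>
      induction y using FreeSuper.word_induction with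
      | h0 => simp
      | hadd x y hx hy => simp only [map_add, hx, hy]
      | hsmul c x hx => simp only [map_smul, hx]
      | hw y =>
        rw [FreeSuper.mul_word, FreeSuper.lift_word, FreeSuper.lift_word, FreeSuper.lift_word]
        rfl

end Lift

section Presentation

variable {k : Type u} [Field k] {n : ℕ} {A : Matrix (Fin n) (Fin n) k} {𝔥 : Type v}
  [AddCommGroup 𝔥] [Module k 𝔥] (R : Realization A 𝔥) (τ : Finset (Fin n))
  {L : Type w} [AddCommGroup L] [Module k L] [SuperProduct k L]

/-- The parity of `e_i` and `f_i`. -/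
abbrev genParity (τ : Finset (Fin n)) (i : Fin n) : ZMod 2 := if i ∈ τ then 1 else 0

/-- Elements of a superalgebra satisfying the defining relations of `g̃(A, τ)`. -/
structure IsChevalley (H : 𝔥 →ₗ[k] L) (E F : Fin n → L) : Prop where
  H_mem : ∀ h, H h ∈ part k L 0
  E_mem : ∀ i, E i ∈ part k L (genParity τ i)
  F_mem : ∀ i, F i ∈ part k L (genParity τ i)
  HH : ∀ h h', pmul k (H h) (H h') = 0
  HE : ∀ h i, pmul k (H h) (E i) = R.root i h • E i
  HF : ∀ h i, pmul k (H h) (F i) = -(R.root i h • F i)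
  EF : ∀ i j, pmul k (E i) (F j) = if i = j then H (R.coroot i) else 0

/-- The assignment of the generators given by `H`, `E` and `F`. -/
def genMap (H : 𝔥 →ₗ[k] L) (E F : Fin n → L) : Gen 𝔥 n → L
  | Gen.H h => H h
  | Gen.E i => E i
  | Gen.F i => F i

variable {R τ} {H : 𝔥 →ₗ[k] L} {E F : Fin n → L}

theorem IsChevalley.genMap_mem (hC : IsChevalley R τ H E F) (x : Gen 𝔥 n) :
    genMap H E F x ∈ part k L (Gen.parity τ x) := by
  cases x with
  | H h => exact hC.H_mem h
  | E i => exact hC.E_mem i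
  | F i => exact hC.F_mem i

theorem IsChevalley.relator (hC : IsChevalley R τ H E F) (hL : IsLieSuperalgebra k L)
    (x : FreeGen k 𝔥 τ) (hx : Relator R τ x) :
    FreeSuper.lift (k := k) (Gen.parity (𝔥 := 𝔥) τ) (genMap H E F) x = 0 := by
  have hf := FreeSuper.isSuperHom_lift (k := k) _ hL hC.genMap_mem
  have hH : ∀ h, FreeSuper.lift (k := k) (Gen.parity τ) (genMap H E F) (gH k τ h) = H h :=
    fun h => FreeSuper.lift_word _ _ _
  have hE : ∀ i, FreeSuper.lift (k := k) (Gen.parity τ) (genMap H E F) (gE k 𝔥 τ i) = E i :=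
    fun i => FreeSuper.lift_word _ _ _
  have hF : ∀ i, FreeSuper.lift (k := k) (Gen.parity τ) (genMap H E F) (gF k 𝔥 τ i) = F i :=
    fun i => FreeSuper.lift_word _ _ _
  cases hx with
  | skew i j x y hx hy =>
    rw [map_add, map_smul, hf.map_mul, hf.map_mul,
      hL.skew i j _ (hf.map_mem hx) _ (hf.map_mem hy), neg_add_cancel]
  | jacobi i j x y z hx hy =>
    simp only [map_sub, map_add, map_smul, hf.map_mul]
    rw [hL.jacobi i j _ (hf.map_mem hx) _ (hf.map_mem hy), sub_self]
  | cube x hx =>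
    rw [hf.map_mul, hf.map_mul, hL.cube _ (hf.map_mem hx)]
  | add h h' => simp only [map_sub, map_add, hH, sub_self]
  | smul c h => simp only [map_sub, map_smul, hH, sub_self]
  | HH h h' => rw [hf.map_mul, hH, hH, hC.HH]
  | HE h i => rw [map_sub, hf.map_mul, map_smul, hH, hE, hC.HE, sub_self]
  | HF h i => rw [map_add, hf.map_mul, map_smul, hH, hF, hC.HF, neg_add_cancel]
  | EF i j =>
    rw [map_sub, hf.map_mul, hE, hF, hC.EF]
    split_ifs
    · rw [hH, sub_self]
    · rw [map_zero, sub_self]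

/-- The homomorphism `g̃(A, τ) → L` defined by elements satisfying the defining relations. -/
def IsChevalley.hom (hC : IsChevalley R τ H E F) (hL : IsLieSuperalgebra k L) :
    GTilde R τ →ₗ[k] L :=
  SuperQuot.lift _ (FreeSuper.isSuperHom_lift (k := k) _ hL hC.genMap_mem) (hC.relator hL)

theorem IsChevalley.isSuperHom_hom (hC : IsChevalley R τ H E F) (hL : IsLieSuperalgebra k L) :
    IsSuperHom (hC.hom hL) := SuperQuot.isSuperHom_lift _ _ _

theorem IsChevalley.hom_mk_word (hC : IsChevalley R τ H E F) (hL : IsLieSuperalgebra k L)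
    (x : FreeMagma (Gen 𝔥 n)) :
    hC.hom hL (SuperQuot.mk k _ (FreeSuper.word k (Gen.parity (𝔥 := 𝔥) τ) x)) =
      evalWord (k := k) (genMap H E F) x := FreeSuper.lift_word _ _ _

variable (R τ)

/-- The image in `g̃(A, τ)` of a word in the generators. -/
def tWord (x : FreeMagma (Gen 𝔥 n)) : GTilde R τ :=
  SuperQuot.mk k _ (FreeSuper.word k (Gen.parity (𝔥 := 𝔥) τ) x)

/-- The generator `e_i` of `g̃(A, τ)`. -/
def tE (i : Fin n) : GTilde R τ := SuperQuot.mk k _ (gE k 𝔥 τ i)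

/-- The generator `f_i` of `g̃(A, τ)`. -/
def tF (i : Fin n) : GTilde R τ := SuperQuot.mk k _ (gF k 𝔥 τ i)

/-- The linear map `𝔥 → g̃(A, τ)`. -/
def tH : 𝔥 →ₗ[k] GTilde R τ where
  toFun h := SuperQuot.mk k _ (gH k τ h)
  map_add' h h' := by
    have := SuperQuot.mk_eq_zero_of_mem (k := k) (s := {x | Relator R τ x}) (Relator.add h h')
    rw [map_sub, sub_eq_zero, map_add] at this
    exact this
  map_smul' c h := by
    have := SuperQuot.mk_eq_zero_of_mem (k := k) (s := {x | Relator R τ x}) (Relator.smul c h)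
    rw [map_sub, sub_eq_zero, map_smul] at this
    exact this

theorem tWord_of (x : Gen 𝔥 n) :
    tWord R τ (FreeMagma.of x) = genMap (tH R τ) (tE R τ) (tF R τ) x := by
  cases x <;> rfl

theorem tWord_mul (x y : FreeMagma (Gen 𝔥 n)) :
    tWord R τ (x * y) = pmul k (tWord R τ x) (tWord R τ y) := by
  rw [tWord, tWord, tWord, SuperQuot.mk_mul, FreeSuper.mul_word]

theorem pr_tWord (i : ZMod 2) (x : FreeMagma (Gen 𝔥 n)) :
    pr k i (tWord R τ x) = if wordSum (Gen.parity τ) x = i then tWord R τ x else 0 := by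
  rw [tWord, SuperQuot.mk_pr]
  change SuperQuot.mk k _ (FreeSuper.proj k _ i _) = _
  rw [FreeSuper.proj_word]
  split_ifs
  · rfl
  · rw [map_zero]

theorem tWord_mem (x : FreeMagma (Gen 𝔥 n)) :
    tWord R τ x ∈ part k (GTilde R τ) (wordSum (Gen.parity τ) x) := by
  rw [mem_part, pr_tWord, if_pos rfl]

theorem exists_lift_of_mem_part {M : Type*} [AddCommGroup M] [Module k M] [SuperProduct k M]
    {s : Set M} {i : ZMod 2} {x : SuperQuot k s} (hx : x ∈ part k (SuperQuot k s) i) :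
    ∃ y ∈ part k M i, SuperQuot.mk k s y = x := by
  obtain ⟨y, rfl⟩ := SuperQuot.mk_surjective k s x
  refine ⟨pr k i y, pr_mem_part i y, ?_⟩
  rw [mem_part, SuperQuot.mk_pr] at hx
  exact hx

theorem FreeSuper.pmul_mem {X : Type*} (p : X → ZMod 2) {i j : ZMod 2} {x y : FreeSuper k p}
    (hx : x ∈ part k (FreeSuper k p) i) (hy : y ∈ part k (FreeSuper k p) j) :
    pmul k x y ∈ part k (FreeSuper k p) (i + j) := by
  have key : ∀ x y : FreeSuper k p,
      pmul k (pr k i x) (pr k j y) ∈ part k (FreeSuper k p) (i + j) := by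
    intro x y
    induction x using FreeSuper.word_induction with
    | h0 => simp
    | hadd x y hx hy =>
      rw [map_add, map_add, LinearMap.add_apply]
      exact add_mem hx hy
    | hsmul c x hx =>
      rw [map_smul, map_smul, LinearMap.smul_apply]
      exact Submodule.smul_mem _ _ hx
    | hw x =>
      induction y using FreeSuper.word_induction with
      | h0 => simp
      | hadd x y hx hy =>
        rw [map_add, map_add]
        exact add_mem hx hy
      | hsmul c x hx =>
        rw [map_smul, map_smul]
        exact Submodule.smul_mem _ _ hx
      | hw y =>
        change pmul k (FreeSuper.proj k p i _) (FreeSuper.proj k p j _) ∈ _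
        rw [FreeSuper.proj_word, FreeSuper.proj_word]
        split_ifs with h1 h2
        · rw [FreeSuper.mul_word, mem_part]
          change FreeSuper.proj k p _ _ = _
          rw [FreeSuper.proj_word, if_pos]
          change wordSum p x + wordSum p y = _
          rw [h1, h2]
        all_goals simp
  rw [mem_part] at hx hy
  have := key x y
  rwa [hx, hy] at this

/-- `g̃(A, τ)` is a Lie superalgebra. -/
theorem isLieSuperalgebra_gTilde : IsLieSuperalgebra k (GTilde R τ) where
  mul_mem i j x hx y hy := by
    obtain ⟨x, hx', rfl⟩ := exists_lift_of_mem_part hx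
    obtain ⟨y, hy', rfl⟩ := exists_lift_of_mem_part hy
    rw [SuperQuot.mk_mul]
    exact (isSuperHom_mk _).map_mem (FreeSuper.pmul_mem _ hx' hy')
  skew i j x hx y hy := by
    obtain ⟨x, hx', rfl⟩ := exists_lift_of_mem_part hx
    obtain ⟨y, hy', rfl⟩ := exists_lift_of_mem_part hy
    have := SuperQuot.mk_eq_zero_of_mem (k := k) (s := {x | Relator R τ x})
      (Relator.skew i j x y hx' hy')
    rw [map_add, map_smul, ← SuperQuot.mk_mul, ← SuperQuot.mk_mul] at this
    exact eq_neg_of_add_eq_zero_left this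
  jacobi i j x hx y hy z := by
    obtain ⟨x, hx', rfl⟩ := exists_lift_of_mem_part hx
    obtain ⟨y, hy', rfl⟩ := exists_lift_of_mem_part hy
    obtain ⟨z, rfl⟩ := SuperQuot.mk_surjective k _ z
    have := SuperQuot.mk_eq_zero_of_mem (k := k) (s := {x | Relator R τ x})
      (Relator.jacobi i j x y z hx' hy')
    simp only [map_sub, map_add, map_smul, ← SuperQuot.mk_mul] at this
    exact sub_eq_zero.1 this
  cube x hx := by
    obtain ⟨x, hx', rfl⟩ := exists_lift_of_mem_part hx
    have := SuperQuot.mk_eq_zero_of_mem (k := k) (s := {x | Relator R τ x}) (Relator.cube x hx')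
    rw [← SuperQuot.mk_mul, ← SuperQuot.mk_mul] at this
    exact this

theorem isChevalley_gTilde : IsChevalley R τ (tH R τ) (tE R τ) (tF R τ) where
  H_mem h := tWord_mem R τ (FreeMagma.of (Gen.H h))
  E_mem i := tWord_mem R τ (FreeMagma.of (Gen.E i))
  F_mem i := tWord_mem R τ (FreeMagma.of (Gen.F i))
  HH h h' := SuperQuot.mk_eq_zero_of_mem (s := {x | Relator R τ x}) (Relator.HH h h')
  HE h i := by
    have := SuperQuot.mk_eq_zero_of_mem (k := k) (s := {x | Relator R τ x}) (Relator.HE h i)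
    rw [map_sub, map_smul, sub_eq_zero] at this
    exact this
  HF h i := by
    have := SuperQuot.mk_eq_zero_of_mem (k := k) (s := {x | Relator R τ x}) (Relator.HF h i)
    rw [map_add, map_smul] at this
    exact eq_neg_of_add_eq_zero_left this
  EF i j := by
    have := SuperQuot.mk_eq_zero_of_mem (k := k) (s := {x | Relator R τ x}) (Relator.EF i j)
    rw [map_sub, sub_eq_zero] at this
    refine Eq.trans this ?_
    split_ifs
    · rfl
    · rw [map_zero]

theorem zPart_eq (m : ℤ) : zPart R τ m =
    Submodule.span k {z | ∃ x : FreeMagma (Gen 𝔥 n), wordSum Gen.degree x = m ∧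
      z = tWord R τ x} := rfl

theorem cartan_eq : cartan R τ = LinearMap.range (tH R τ) := by
  rw [cartan, ← Submodule.span_eq (LinearMap.range (tH R τ))]
  congr 1
  ext z
  exact ⟨fun ⟨h, e⟩ => ⟨h, e.symm⟩, fun ⟨h, e⟩ => ⟨h, e.symm⟩⟩

theorem tWord_induction {P : GTilde R τ → Prop} (h0 : P 0)
    (hadd : ∀ x y, P x → P y → P (x + y)) (hsmul : ∀ (c : k) x, P x → P (c • x))
    (hw : ∀ x, P (tWord R τ x)) (x : GTilde R τ) : P x := by
  obtain ⟨x, rfl⟩ := SuperQuot.mk_surjective k _ x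
  induction x using FreeSuper.word_induction with
  | h0 => rwa [map_zero]
  | hadd x y hx hy => rw [map_add]; exact hadd _ _ hx hy
  | hsmul c x hx => rw [map_smul]; exact hsmul _ _ hx
  | hw x => exact hw x

theorem iSup_zPart : ⨆ m, zPart R τ m = ⊤ := by
  rw [eq_top_iff]
  rintro x -
  induction x using tWord_induction with
  | h0 => exact zero_mem _
  | hadd x y hx hy => exact add_mem hx hy
  | hsmul c x hx => exact Submodule.smul_mem _ _ hx
  | hw x => exact Submodule.mem_iSup_of_mem _ (Submodule.subset_span ⟨x, rfl, rfl⟩)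

/-- The homogeneous components of `g̃(A, τ)` are independent, because of the homomorphism
`g̃(A, τ) → g̃(A, τ) ⊗ k[t, t⁻¹]` mapping `x` of degree `m` to `x ⊗ t ^ m`. -/
theorem iSupIndep_zPart : iSupIndep (zPart R τ) := by
  have hC := isChevalley_gTilde R τ
  have hL := isLieSuperalgebra_gTilde R τ
  have hC' : IsChevalley R τ (Loop.single k 0 ∘ₗ tH R τ) (fun i => Loop.single k 1 (tE R τ i))
      (fun i => Loop.single k (-1) (tF R τ i)) :=
    { H_mem := fun h => Loop.single_mem (hC.H_mem h)
      E_mem := fun i => Loop.single_mem (hC.E_mem i)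
      F_mem := fun i => Loop.single_mem (hC.F_mem i)
      HH := fun h h' => by
        rw [LinearMap.comp_apply, LinearMap.comp_apply, Loop.pmul_single, hC.HH, map_zero]
      HE := fun h i => by rw [LinearMap.comp_apply, Loop.pmul_single, hC.HE, map_smul, zero_add]
      HF := fun h i => by
        rw [LinearMap.comp_apply, Loop.pmul_single, hC.HF, map_neg, map_smul, zero_add]
      EF := fun i j => by
        rw [Loop.pmul_single, hC.EF, add_neg_cancel]
        split_ifs
        · rfl
        · rw [map_zero] }
  have hw : ∀ x, hC'.hom hL.loop (tWord R τ x) =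
      Loop.single k (wordSum Gen.degree x) (tWord R τ x) := by
    intro x
    induction x using FreeMagma.recOnMul with
    | ih1 x =>
      refine (hC'.hom_mk_word hL.loop _).trans ?_
      cases x <;> rfl
    | ih2 x y hx hy =>
      rw [tWord_mul, (hC'.isSuperHom_hom hL.loop).map_mul, hx, hy, Loop.pmul_single]
      rfl
  have hz : ∀ m, ∀ x ∈ zPart R τ m, hC'.hom hL.loop x = Loop.single k m x := by
    intro m x hx
    rw [zPart_eq] at hx
    induction hx using Submodule.span_induction with
    | mem x hx =>
      obtain ⟨y, rfl, rfl⟩ := hx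
      exact hw y
    | zero => rw [map_zero, map_zero]
    | add x y _ _ hx hy => rw [map_add, map_add, hx, hy]
    | smul c x _ hx => rw [map_smul, map_smul, hx]
  rw [iSupIndep_iff_finsetSum_eq_zero_imp_eq_zero]
  intro s v hv hsum i hi
  have h1 := congrArg (hC'.hom hL.loop) hsum
  rw [map_sum, map_zero, Finset.sum_congr rfl fun j hj => hz j _ (hv j hj)] at h1
  have h2 := congrArg (Loop.coeff k i) h1
  rw [map_sum, map_zero, Finset.sum_eq_single i] at h2
  · rwa [Loop.coeff_single, if_pos rfl] at h2
  · intro j _ hj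
    rw [Loop.coeff_single, if_neg hj]
  · exact fun h => absurd hi h

end Presentation

/-! ### The triangular decomposition -/

section Triangular

variable {k : Type u} [Field k] {n : ℕ} {L : Type w} [AddCommGroup L] [Module k L]
  [SuperProduct k L]

/-- The span of the iterated brackets `[a_{i_1}, [a_{i_2}, …, a_{i_(r+1)}]]`. -/
def iterSpan (a : Fin n → L) : ℕ → Submodule k L
  | 0 => Submodule.span k (Set.range a)
  | r + 1 => ⨆ i, (iterSpan a r).map (pmul k (a i))

theorem iterSpan_succ_induction {a : Fin n → L} {r : ℕ} {N : Submodule k L}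
    (h : ∀ i, ∀ y ∈ iterSpan (k := k) a r, pmul k (a i) y ∈ N) :
    iterSpan (k := k) a (r + 1) ≤ N := by
  refine iSup_le fun i => ?_
  rintro _ ⟨y, hy, rfl⟩
  exact h i y hy

theorem pmul_mem_iterSpan_succ {a : Fin n → L} {r : ℕ} (i : Fin n) {y : L}
    (hy : y ∈ iterSpan (k := k) a r) : pmul k (a i) y ∈ iterSpan (k := k) a (r + 1) :=
  Submodule.mem_iSup_of_mem i ⟨y, hy, rfl⟩

/-- A submodule `C` of even elements having the `a_i` as eigenvectors preserves `iterSpan a r`. -/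
theorem pmul_mem_iterSpan (hL : IsLieSuperalgebra k L) {a : Fin n → L} {C : Submodule k L}
    (hC : C ≤ part k L 0) (hCa : ∀ c ∈ C, ∀ i, ∃ t : k, pmul k c (a i) = t • a i)
    (r : ℕ) : ∀ c ∈ C, ∀ y ∈ iterSpan (k := k) a r, pmul k c y ∈ iterSpan (k := k) a r := by
  induction r with
  | zero =>
    intro c hc y hy
    refine (Submodule.span_le.2 ?_ : _ ≤ (iterSpan (k := k) a 0).comap (pmul k c)) hy
    rintro _ ⟨i, rfl⟩
    obtain ⟨t, ht⟩ := hCa c hc i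
    rw [SetLike.mem_coe, Submodule.mem_comap, ht]
    exact Submodule.smul_mem _ _ (Submodule.subset_span ⟨i, rfl⟩)
  | succ r ih =>
    intro c hc y hy
    refine (iterSpan_succ_induction (N := (iterSpan (k := k) a (r + 1)).comap (pmul k c))
      fun i y hy => ?_) hy
    obtain ⟨t, ht⟩ := hCa c hc i
    -- the Jacobi identity is used for the even element `c`, so no sign occurs
    have hj : pmul k c (pmul k (a i) y) = pmul k (pmul k c (a i)) y +
        pmul k (a i) (pmul k c y) := by
      rw [← SuperSpace.proj_add (k := k) (a i)]
      simp only [map_add, LinearMap.add_apply]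
      rw [hL.jacobi 0 0 c (hC hc) _ (pr_mem_part 0 (a i)),
        hL.jacobi 0 1 c (hC hc) _ (pr_mem_part 1 (a i))]
      simp only [zero_mul, sgn_zero, one_smul]
      abel
    rw [Submodule.mem_comap, hj, ht, map_smul, LinearMap.smul_apply]
    exact add_mem (Submodule.smul_mem _ _ (pmul_mem_iterSpan_succ i hy))
      (pmul_mem_iterSpan_succ i (ih c hc y hy))

/-- If moreover `[b_j, a_i] ∈ C`, then `b_j` lowers the number of factors by one. -/
theorem pmul_mem_iterSpan_pred (hL : IsLieSuperalgebra k L) {a b : Fin n → L}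
    {C : Submodule k L} {p : Fin n → ZMod 2} (ha : ∀ i, a i ∈ part k L (p i))
    (hb : ∀ i, b i ∈ part k L (p i)) (hC : C ≤ part k L 0)
    (hCa : ∀ c ∈ C, ∀ i, ∃ t : k, pmul k c (a i) = t • a i)
    (hba : ∀ j i, pmul k (b j) (a i) ∈ C) (j : Fin n) :
    (∀ y ∈ iterSpan (k := k) a 0, pmul k (b j) y ∈ C) ∧
    ∀ r, ∀ y ∈ iterSpan (k := k) a (r + 1), pmul k (b j) y ∈ iterSpan (k := k) a r := by
  have h0 : ∀ y ∈ iterSpan (k := k) a 0, pmul k (b j) y ∈ C := by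
    intro y hy
    refine (Submodule.span_le.2 ?_ : _ ≤ C.comap (pmul k (b j))) hy
    rintro _ ⟨i, rfl⟩
    exact hba j i
  have hac : ∀ i, ∀ c ∈ C, pmul k (a i) c ∈ iterSpan (k := k) a 0 := by
    intro i c hc
    obtain ⟨t, ht⟩ := hCa c hc i
    rw [hL.skew _ _ _ (ha i) _ (hC hc), ht]
    exact neg_mem (Submodule.smul_mem _ _ (Submodule.smul_mem _ _ (Submodule.subset_span ⟨i, rfl⟩)))
  refine ⟨h0, fun r => ?_⟩
  induction r with
  | zero =>
    intro y hy
    refine (iterSpan_succ_induction (N := (iterSpan (k := k) a 0).comap (pmul k (b j)))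
      fun i y hy => ?_) hy
    rw [Submodule.mem_comap, hL.jacobi _ _ _ (hb j) _ (ha i)]
    exact add_mem (pmul_mem_iterSpan hL hC hCa _ _ (hba j i) _ hy)
      (Submodule.smul_mem _ _ (hac i _ (h0 y hy)))
  | succ r ih =>
    intro y hy
    refine (iterSpan_succ_induction (N := (iterSpan (k := k) a (r + 1)).comap (pmul k (b j)))
      fun i y hy => ?_) hy
    rw [Submodule.mem_comap, hL.jacobi _ _ _ (hb j) _ (ha i)]
    exact add_mem (pmul_mem_iterSpan hL hC hCa _ _ (hba j i) _ hy)
      (Submodule.smul_mem _ _ (pmul_mem_iterSpan_succ i (ih y hy)))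

variable {A : Matrix (Fin n) (Fin n) k} {𝔥 : Type v}
  [AddCommGroup 𝔥] [Module k 𝔥] (R : Realization A 𝔥) (τ : Finset (Fin n))

/-- The spaces forming the triangular decomposition of `g̃(A, τ)`. -/
def triang : ℤ → Submodule k (GTilde R τ)
  | Int.ofNat 0 => cartan R τ
  | Int.ofNat (r + 1) => iterSpan (tE R τ) r
  | Int.negSucc r => iterSpan (tF R τ) r

theorem cartan_le_part : cartan R τ ≤ part k (GTilde R τ) 0 := by
  rw [cartan_eq]
  rintro _ ⟨h, rfl⟩
  exact (isChevalley_gTilde R τ).H_mem h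

theorem pmul_tE_mem (i : Fin n) (m : ℤ) {y : GTilde R τ} (hy : y ∈ triang R τ m) :
    pmul k (tE R τ i) y ∈ triang R τ (1 + m) := by
  have hC := isChevalley_gTilde R τ
  have hL := isLieSuperalgebra_gTilde R τ
  obtain ⟨h0, h1⟩ := pmul_mem_iterSpan_pred hL hC.F_mem hC.E_mem (cartan_le_part R τ)
    (fun c hc i => by
      rw [cartan_eq] at hc
      obtain ⟨h, rfl⟩ := hc
      exact ⟨-R.root i h, by rw [hC.HF, neg_smul]⟩)
    (fun j i => by
      rw [hC.EF]
      split_ifs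
      · rw [cartan_eq]; exact ⟨_, rfl⟩
      · exact zero_mem _) i
  match m, hy with
  | Int.ofNat 0, hy =>
    change y ∈ cartan R τ at hy
    rw [cartan_eq] at hy
    obtain ⟨h, rfl⟩ := hy
    rw [hL.skew _ _ _ (hC.E_mem i) _ (hC.H_mem h), hC.HE]
    exact neg_mem (Submodule.smul_mem _ _ (Submodule.smul_mem _ _ (Submodule.subset_span ⟨i, rfl⟩)))
  | Int.ofNat (r + 1), hy =>
    rw [show 1 + Int.ofNat (r + 1) = Int.ofNat (r + 1 + 1) by simp; ring]
    exact pmul_mem_iterSpan_succ i hy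
  | Int.negSucc 0, hy => exact h0 y hy
  | Int.negSucc (r + 1), hy =>
    rw [show 1 + Int.negSucc (r + 1) = Int.negSucc r by
      rw [Int.negSucc_eq, Int.negSucc_eq]; push_cast; ring]
    exact h1 r y hy

theorem pmul_tF_mem (i : Fin n) (m : ℤ) {y : GTilde R τ} (hy : y ∈ triang R τ m) :
    pmul k (tF R τ i) y ∈ triang R τ (-1 + m) := by
  have hC := isChevalley_gTilde R τ
  have hL := isLieSuperalgebra_gTilde R τ
  obtain ⟨h0, h1⟩ := pmul_mem_iterSpan_pred hL hC.E_mem hC.F_mem (cartan_le_part R τ)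
    (fun c hc i => by
      rw [cartan_eq] at hc
      obtain ⟨h, rfl⟩ := hc
      exact ⟨R.root i h, hC.HE h i⟩)
    (fun j i => by
      rw [hL.skew _ _ _ (hC.F_mem j) _ (hC.E_mem i), hC.EF]
      split_ifs
      · rw [cartan_eq]; exact neg_mem (Submodule.smul_mem _ _ ⟨_, rfl⟩)
      · rw [smul_zero, neg_zero]; exact zero_mem _) i
  match m, hy with
  | Int.ofNat 0, hy =>
    change y ∈ cartan R τ at hy
    rw [cartan_eq] at hy
    obtain ⟨h, rfl⟩ := hy
    rw [hL.skew _ _ _ (hC.F_mem i) _ (hC.H_mem h), hC.HF]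
    exact neg_mem (Submodule.smul_mem _ _ (neg_mem
      (Submodule.smul_mem _ _ (Submodule.subset_span ⟨i, rfl⟩))))
  | Int.ofNat 1, hy => exact h0 y hy
  | Int.ofNat (r + 1 + 1), hy =>
    rw [show -1 + Int.ofNat (r + 1 + 1) = Int.ofNat (r + 1) by simp]
    exact h1 r y hy
  | Int.negSucc r, hy =>
    rw [show -1 + Int.negSucc r = Int.negSucc (r + 1) by
      rw [Int.negSucc_eq, Int.negSucc_eq]; push_cast; ring]
    exact pmul_mem_iterSpan_succ i hy

theorem pmul_tH_mem (h : 𝔥) (m : ℤ) {y : GTilde R τ} (hy : y ∈ triang R τ m) :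
    pmul k (tH R τ h) y ∈ triang R τ m := by
  have hC := isChevalley_gTilde R τ
  have hL := isLieSuperalgebra_gTilde R τ
  have hh : tH R τ h ∈ cartan R τ := by rw [cartan_eq]; exact ⟨h, rfl⟩
  match m, hy with
  | Int.ofNat 0, hy =>
    change y ∈ cartan R τ at hy
    rw [cartan_eq] at hy
    obtain ⟨h', rfl⟩ := hy
    rw [hC.HH]
    exact zero_mem _
  | Int.ofNat (r + 1), hy =>
    refine pmul_mem_iterSpan hL (cartan_le_part R τ) (fun c hc i => ?_) r _ hh y hy
    rw [cartan_eq] at hc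
    obtain ⟨h, rfl⟩ := hc
    exact ⟨R.root i h, hC.HE h i⟩
  | Int.negSucc r, hy =>
    refine pmul_mem_iterSpan hL (cartan_le_part R τ) (fun c hc i => ?_) r _ hh y hy
    rw [cartan_eq] at hc
    obtain ⟨h, rfl⟩ := hc
    exact ⟨-R.root i h, by rw [hC.HF, neg_smul]⟩

theorem tWord_mem_triang (x : FreeMagma (Gen 𝔥 n)) :
    tWord R τ x ∈ triang R τ (wordSum Gen.degree x) ∧
    ∀ m, ∀ y ∈ triang R τ m, pmul k (tWord R τ x) y ∈ triang R τ (wordSum Gen.degree x + m) := by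
  induction x using FreeMagma.recOnMul with
  | ih1 x =>
    rw [tWord_of]
    cases x with
    | H h =>
      refine ⟨?_, fun m y hy => ?_⟩
      · change _ ∈ cartan R τ
        rw [cartan_eq]; exact ⟨h, rfl⟩
      · change _ ∈ triang R τ (0 + m)
        rw [zero_add]
        exact pmul_tH_mem R τ h m hy
    | E i => exact ⟨Submodule.subset_span ⟨i, rfl⟩, fun m y hy => pmul_tE_mem R τ i m hy⟩
    | F i => exact ⟨Submodule.subset_span ⟨i, rfl⟩, fun m y hy => pmul_tF_mem R τ i m hy⟩
  | ih2 x y hx hy =>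
    rw [tWord_mul]
    change _ ∈ triang R τ (wordSum Gen.degree x + wordSum Gen.degree y) ∧
      ∀ m, ∀ z ∈ triang R τ m, pmul k (pmul k _ _) z ∈
        triang R τ (wordSum Gen.degree x + wordSum Gen.degree y + m)
    refine ⟨hx.2 _ _ hy.1, fun m z hz => ?_⟩
    have hj := (isLieSuperalgebra_gTilde R τ).jacobi _ _ _ (tWord_mem R τ x) _ (tWord_mem R τ y) z
    rw [← sub_eq_iff_eq_add] at hj
    rw [← hj]
    refine sub_mem ?_ (Submodule.smul_mem _ _ ?_)
    · rw [add_assoc]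
      exact hx.2 _ _ (hy.2 _ _ hz)
    · rw [add_comm (wordSum Gen.degree x), add_assoc]
      exact hy.2 _ _ (hx.2 _ _ hz)

theorem zPart_le_triang (m : ℤ) : zPart R τ m ≤ triang R τ m := by
  rw [zPart_eq, Submodule.span_le]
  rintro _ ⟨x, rfl, rfl⟩
  exact (tWord_mem_triang R τ x).1

theorem zPart_zero_le : zPart R τ 0 ≤ cartan R τ := zPart_le_triang R τ 0

theorem cartan_le_zPart : cartan R τ ≤ zPart R τ 0 := by
  rw [cartan, zPart_eq]
  refine Submodule.span_mono ?_
  rintro _ ⟨h, rfl⟩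
  exact ⟨FreeMagma.of (Gen.H h), rfl, rfl⟩

theorem tE_mem_zPart (i : Fin n) : tE R τ i ∈ zPart R τ 1 := by
  rw [zPart_eq]
  exact Submodule.subset_span ⟨FreeMagma.of (Gen.E i), rfl, rfl⟩

theorem tF_mem_zPart (i : Fin n) : tF R τ i ∈ zPart R τ (-1) := by
  rw [zPart_eq]
  exact Submodule.subset_span ⟨FreeMagma.of (Gen.F i), rfl, rfl⟩

theorem zPart_one_le : zPart R τ 1 ≤ Submodule.span k (Set.range (tE R τ)) :=
  zPart_le_triang R τ 1

theorem zPart_neg_one_le : zPart R τ (-1) ≤ Submodule.span k (Set.range (tF R τ)) :=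
  zPart_le_triang R τ (-1)

theorem pmul_mem_zPart {m m' : ℤ} {x y : GTilde R τ} (hx : x ∈ zPart R τ m)
    (hy : y ∈ zPart R τ m') : pmul k x y ∈ zPart R τ (m + m') := by
  rw [zPart_eq] at hx
  induction hx using Submodule.span_induction with
  | mem x hx =>
    obtain ⟨x, rfl, rfl⟩ := hx
    rw [zPart_eq] at hy
    induction hy using Submodule.span_induction with
    | mem y hy =>
      obtain ⟨y, rfl, rfl⟩ := hy
      rw [← tWord_mul, zPart_eq]
      exact Submodule.subset_span ⟨_, rfl, rfl⟩
    | zero => rw [map_zero]; exact zero_mem _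
    | add y z _ _ hy hz => rw [map_add]; exact add_mem hy hz
    | smul c y _ hy => rw [map_smul]; exact Submodule.smul_mem _ _ hy
  | zero => rw [map_zero]; exact zero_mem _
  | add y z _ _ hy hz => rw [map_add]; exact add_mem hy hz
  | smul c y _ hy => rw [map_smul]; exact Submodule.smul_mem _ _ hy

theorem pr_mem_zPart (i : ZMod 2) {m : ℤ} {x : GTilde R τ} (hx : x ∈ zPart R τ m) :
    pr k i x ∈ zPart R τ m := by
  rw [zPart_eq] at hx
  induction hx using Submodule.span_induction with
  | mem x hx =>
    obtain ⟨x, rfl, rfl⟩ := hx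
    rw [pr_tWord]
    split_ifs
    · rw [zPart_eq]; exact Submodule.subset_span ⟨_, rfl, rfl⟩
    · exact zero_mem _
  | zero => rw [map_zero]; exact zero_mem _
  | add y z _ _ hy hz => rw [map_add]; exact add_mem hy hz
  | smul c y _ hy => rw [map_smul]; exact Submodule.smul_mem _ _ hy

end Triangular

/-! ### A criterion for recognizing centreless contragredient superalgebras -/

section Recognition

variable {k : Type u} [Field k]

theorem IsLieSuperalgebra.isGradedIdeal {L : Type w} [AddCommGroup L] [Module k L]
    [SuperProduct k L] (hL : IsLieSuperalgebra k L) {J : Submodule k L} (hJ : IsGraded J)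
    (h : ∀ x : L, ∀ y ∈ J, pmul k x y ∈ J) : IsGradedIdeal J where
  graded := hJ
  mul_left := h
  mul_right y hy x := by
    have key : ∀ i j, pmul k (pr k i y) (pr k j x) ∈ J := fun i j => by
      rw [hL.skew i j _ (pr_mem_part _ _) _ (pr_mem_part _ _)]
      exact neg_mem (Submodule.smul_mem _ _ (h _ _ (hJ i y hy)))
    rw [← SuperSpace.proj_add (k := k) y, ← SuperSpace.proj_add (k := k) x]
    simp only [map_add, LinearMap.add_apply]
    exact add_mem (add_mem (key _ _) (key _ _)) (add_mem (key _ _) (key _ _))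

variable {n : ℕ} {A : Matrix (Fin n) (Fin n) k} {𝔥 : Type v}
  [AddCommGroup 𝔥] [Module k 𝔥] {R : Realization A 𝔥} {τ : Finset (Fin n)}
  {L : Type w} [AddCommGroup L] [Module k L] [SuperProduct k L]
  {H : 𝔥 →ₗ[k] L} {E F : Fin n → L}

theorem IsChevalley.hom_tWord (hC : IsChevalley R τ H E F) (hL : IsLieSuperalgebra k L)
    (x : FreeMagma (Gen 𝔥 n)) : hC.hom hL (tWord R τ x) = evalWord (k := k) (genMap H E F) x :=
  hC.hom_mk_word hL x

theorem IsChevalley.hom_tH (hC : IsChevalley R τ H E F) (hL : IsLieSuperalgebra k L) (h : 𝔥) :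
    hC.hom hL (tH R τ h) = H h := hC.hom_mk_word hL (FreeMagma.of (Gen.H h))

theorem IsChevalley.hom_tE (hC : IsChevalley R τ H E F) (hL : IsLieSuperalgebra k L) (i : Fin n) :
    hC.hom hL (tE R τ i) = E i := hC.hom_mk_word hL (FreeMagma.of (Gen.E i))

theorem IsChevalley.hom_tF (hC : IsChevalley R τ H E F) (hL : IsLieSuperalgebra k L) (i : Fin n) :
    hC.hom hL (tF R τ i) = F i := hC.hom_mk_word hL (FreeMagma.of (Gen.F i))

theorem IsChevalley.hom_surjective (hC : IsChevalley R τ H E F) (hL : IsLieSuperalgebra k L)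
    (gen : ∀ J : Submodule k L, (∀ x ∈ J, ∀ y ∈ J, pmul k x y ∈ J) → (∀ h, H h ∈ J) →
      (∀ i, E i ∈ J) → (∀ i, F i ∈ J) → J = ⊤) : Function.Surjective (hC.hom hL) := by
  rw [← LinearMap.range_eq_top]
  refine gen _ ?_ (fun h => ⟨_, hC.hom_tH hL h⟩) (fun i => ⟨_, hC.hom_tE hL i⟩)
    (fun i => ⟨_, hC.hom_tF hL i⟩)
  rintro _ ⟨x, rfl⟩ _ ⟨y, rfl⟩
  exact ⟨_, (hC.isSuperHom_hom hL).map_mul x y⟩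

theorem IsChevalley.hom_mem_gr (hC : IsChevalley R τ H E F) (hL : IsLieSuperalgebra k L)
    {gr : ℤ → Submodule k L}
    (gr_mul : ∀ m m', ∀ x ∈ gr m, ∀ y ∈ gr m', pmul k x y ∈ gr (m + m'))
    (gr_H : ∀ h, H h ∈ gr 0) (gr_E : ∀ i, E i ∈ gr 1) (gr_F : ∀ i, F i ∈ gr (-1))
    (m : ℤ) : zPart R τ m ≤ (gr m).comap (hC.hom hL) := by
  rw [zPart_eq, Submodule.span_le]
  rintro _ ⟨x, rfl, rfl⟩
  rw [SetLike.mem_coe, Submodule.mem_comap]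
  induction x using FreeMagma.recOnMul with
  | ih1 x =>
    rw [hC.hom_tWord]
    cases x with
    | H h => exact gr_H h
    | E i => exact gr_E i
    | F i => exact gr_F i
  | ih2 x y hx hy =>
    rw [tWord_mul, (hC.isSuperHom_hom hL).map_mul]
    exact gr_mul _ _ _ hx _ hy

/-- The elements of the kernel of `g̃(A, τ) → L` whose degree is different from `-1`, `0`, `1`. -/
def IsChevalley.kerFar (hC : IsChevalley R τ H E F) (hL : IsLieSuperalgebra k L) :
    Submodule k (GTilde R τ) :=
  ⨆ (m : ℤ) (_ : 2 ≤ |m|), LinearMap.ker (hC.hom hL) ⊓ zPart R τ m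

theorem IsChevalley.mem_kerFar (hC : IsChevalley R τ H E F) (hL : IsLieSuperalgebra k L)
    {m : ℤ} (hm : 2 ≤ |m|) {x : GTilde R τ} (hx : hC.hom hL x = 0) (hxm : x ∈ zPart R τ m) :
    x ∈ hC.kerFar hL :=
  Submodule.mem_iSup_of_mem m (Submodule.mem_iSup_of_mem hm ⟨hx, hxm⟩)

/-- A homogeneous element of degree `1` or `-1` of the kernel is zero, since the images of the
`e_i`, and those of the `f_i`, are linearly independent. -/
theorem IsChevalley.eq_zero_of_abs_eq_one (hC : IsChevalley R τ H E F)
    (hL : IsLieSuperalgebra k L) (hE : LinearIndependent k E) (hF : LinearIndependent k F)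
    {m : ℤ} (hm : |m| = 1) {x : GTilde R τ} (hx : hC.hom hL x = 0) (hxm : x ∈ zPart R τ m) :
    x = 0 := by
  have key : ∀ (a : Fin n → GTilde R τ) (b : Fin n → L), (∀ i, hC.hom hL (a i) = b i) →
      LinearIndependent k b → x ∈ Submodule.span k (Set.range a) → x = 0 := by
    intro a b hab hb hxa
    obtain ⟨c, rfl⟩ := (Submodule.mem_span_range_iff_exists_fun k).1 hxa
    rw [map_sum] at hx
    simp only [map_smul, hab] at hx
    have := Fintype.linearIndependent_iff.1 hb c hx
    simp [this]
  rcases (abs_eq (by norm_num)).1 hm with rfl | rfl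
  · exact key _ _ (hC.hom_tE hL) hE (zPart_one_le R τ hxm)
  · exact key _ _ (hC.hom_tF hL) hF (zPart_neg_one_le R τ hxm)

theorem IsChevalley.isGradedIdeal_kerFar (hC : IsChevalley R τ H E F)
    (hL : IsLieSuperalgebra k L) (hE : LinearIndependent k E) (hF : LinearIndependent k F) :
    IsGradedIdeal (hC.kerFar hL) := by
  have hf := hC.isSuperHom_hom hL
  have hG := isLieSuperalgebra_gTilde R τ
  have hind : ∀ N : Submodule k (GTilde R τ),
      (∀ m : ℤ, 2 ≤ |m| → ∀ x, hC.hom hL x = 0 → x ∈ zPart R τ m → x ∈ N) →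
      hC.kerFar hL ≤ N := fun N h =>
    iSup_le fun m => iSup_le fun hm x hx => h m hm x hx.1 hx.2
  refine hG.isGradedIdeal (fun i x hx => ?_) fun x => ?_
  · refine hind ((hC.kerFar hL).comap (pr k i)) (fun m hm x hx hxm => ?_) hx
    refine hC.mem_kerFar hL hm ?_ (pr_mem_zPart R τ i hxm)
    rw [hf.map_pr, hx, map_zero]
  -- a generator changes the degree by at most one, and the kernel vanishes in degrees `1`, `-1`
  have hgen : ∀ (d : ℤ), |d| ≤ 1 → ∀ z ∈ zPart R τ d, ∀ y ∈ hC.kerFar hL,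
      pmul k z y ∈ hC.kerFar hL := by
    intro d hd z hz y hy
    refine hind ((hC.kerFar hL).comap (pmul k z)) (fun m hm y hy hym => ?_) hy
    have h1 : hC.hom hL (pmul k z y) = 0 := by rw [hf.map_mul, hy, map_zero]
    have h2 := pmul_mem_zPart R τ hz hym
    by_cases h : 2 ≤ |d + m|
    · exact hC.mem_kerFar hL h h1 h2
    · have h3 : |d + m| = 1 := by
        have := abs_sub_abs_le_abs_sub m (-d)
        rw [abs_neg, sub_neg_eq_add, add_comm m d] at this
        omega
      rw [Submodule.mem_comap, hC.eq_zero_of_abs_eq_one hL hE hF h3 h1 h2]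
      exact zero_mem _
  induction x using tWord_induction with
  | h0 => intro y _; rw [map_zero, LinearMap.zero_apply]; exact zero_mem _
  | hadd x x' hx hx' =>
    intro y hy
    rw [map_add, LinearMap.add_apply]
    exact add_mem (hx y hy) (hx' y hy)
  | hsmul c x hx =>
    intro y hy
    rw [map_smul, LinearMap.smul_apply]
    exact Submodule.smul_mem _ _ (hx y hy)
  | hw x =>
    induction x using FreeMagma.recOnMul with
    | ih1 x =>
      rw [tWord_of]
      cases x with
      | H h =>
        refine hgen 0 (by simp) _ (cartan_le_zPart R τ ?_)
        rw [cartan_eq]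
        exact ⟨h, rfl⟩
      | E i => exact hgen 1 (by simp) _ (tE_mem_zPart R τ i)
      | F i => exact hgen (-1) (by simp) _ (tF_mem_zPart R τ i)
    | ih2 x x' hx hx' =>
      intro y hy
      have hj := hG.jacobi _ _ _ (tWord_mem R τ x) _ (tWord_mem R τ x') y
      rw [← sub_eq_iff_eq_add] at hj
      rw [tWord_mul, ← hj]
      exact sub_mem (hx _ (hx' _ hy)) (Submodule.smul_mem _ _ (hx' _ (hx _ hy)))

theorem IsChevalley.kerFar_inf_cartan (hC : IsChevalley R τ H E F)
    (hL : IsLieSuperalgebra k L) : hC.kerFar hL ⊓ cartan R τ = ⊥ := by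
  rw [← disjoint_iff]
  refine ((iSupIndep_zPart R τ) 0).symm.mono ?_ (cartan_le_zPart R τ)
  refine iSup_le fun m => iSup_le fun hm => inf_le_right.trans ?_
  refine le_iSup₂_of_le m ?_ le_rfl
  rintro rfl
  norm_num at hm

theorem IsChevalley.kerFar_subset (hC : IsChevalley R τ H E F)
    (hL : IsLieSuperalgebra k L) (hE : LinearIndependent k E) (hF : LinearIndependent k F) :
    (hC.kerFar hL : Set (GTilde R τ)) ⊆ trivialIdeals R τ := by
  intro x hx
  refine ⟨hC.kerFar hL, hC.isGradedIdeal_kerFar hL hE hF, ?_, hC.kerFar_inf_cartan hL, hx⟩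
  refine iSup_le fun m => iSup_le fun hm => le_iSup_of_le m (le_inf ?_ inf_le_right)
  exact fun y hy => hC.mem_kerFar hL hm hy.1 hy.2

theorem mem_centre_of_left {M : Type*} [AddCommGroup M] [Module k M] [SuperProduct k M]
    (hM : IsLieSuperalgebra k M) {i : ZMod 2} {x : M} (hi : x ∈ part k M i)
    (hx : ∀ y, pmul k x y = 0) : x ∈ centre k M := by
  refine fun y => ⟨hx y, ?_⟩
  rw [← SuperSpace.proj_add (k := k) y, map_add, LinearMap.add_apply,
    hM.skew 0 i _ (pr_mem_part _ _) _ hi, hM.skew 1 i _ (pr_mem_part _ _) _ hi, hx, hx]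
  simp

/-- An element of `𝔥` annihilated by all simple roots is central in `g̃(A, τ)`. -/
theorem tH_mem_centre {h : 𝔥} (hr : ∀ i, R.root i h = 0) : tH R τ h ∈ centre k (GTilde R τ) := by
  have hC := isChevalley_gTilde R τ
  have hG := isLieSuperalgebra_gTilde R τ
  refine mem_centre_of_left hG (hC.H_mem h) fun y => ?_
  induction y using tWord_induction with
  | h0 => rw [map_zero]
  | hadd x y hx hy => rw [map_add, hx, hy, add_zero]
  | hsmul c x hx => rw [map_smul, hx, smul_zero]
  | hw x =>
    induction x using FreeMagma.recOnMul with
    | ih1 x =>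
      rw [tWord_of]
      cases x with
      | H h' => exact hC.HH h h'
      | E i => exact (hC.HE h i).trans (by rw [hr, zero_smul])
      | F i => exact (hC.HF h i).trans (by rw [hr, zero_smul, neg_zero])
    | ih2 x y hx hy =>
      rw [tWord_mul, hG.jacobi _ _ _ (hC.H_mem h) _ (tWord_mem R τ x), hx, hy]
      simp

/-- A Lie superalgebra with trivial centre that satisfies the defining relations of `g̃(A, τ)`, is
generated by the corresponding elements, and has a compatible `ℤ`-grading such that no nonzero
graded ideal is contained in the sum of the components of nonzero degree, is the centreless
contragredient Lie superalgebra. -/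
theorem IsChevalley.nonempty_superIso (hC : IsChevalley R τ H E F)
    (hL : IsLieSuperalgebra k L) (hE : LinearIndependent k E) (hF : LinearIndependent k F)
    (gen : ∀ J : Submodule k L, (∀ x ∈ J, ∀ y ∈ J, pmul k x y ∈ J) → (∀ h, H h ∈ J) →
      (∀ i, E i ∈ J) → (∀ i, F i ∈ J) → J = ⊤)
    (gr : ℤ → Submodule k L) (gr_indep : iSupIndep gr)
    (gr_mul : ∀ m m', ∀ x ∈ gr m, ∀ y ∈ gr m', pmul k x y ∈ gr (m + m'))
    (gr_H : ∀ h, H h ∈ gr 0) (gr_E : ∀ i, E i ∈ gr 1) (gr_F : ∀ i, F i ∈ gr (-1))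
    (hcentre : ∀ x ∈ centre k L, x = 0)
    (ideal : ∀ J : Submodule k L, IsGradedIdeal J → J ≤ ⨆ (m : ℤ) (_ : m ≠ 0), gr m → J = ⊥) :
    Nonempty (SuperIso k L (CenterlessContragredient R τ)) := by
  have hf := hC.isSuperHom_hom hL
  have hs := hC.hom_surjective hL gen
  have hgr := hC.hom_mem_gr hL gr_mul gr_H gr_E gr_F
  have q1 : IsSuperHom (SuperQuot.mk k (trivialIdeals R τ)) := isSuperHom_mk _
  have q2 : IsSuperHom (SuperQuot.mk k (centre k (Contragredient R τ))) := isSuperHom_mk _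
  have s1 := SuperQuot.mk_surjective k (trivialIdeals R τ)
  have s2 := SuperQuot.mk_surjective k (centre k (Contragredient R τ))
  refine nonempty_superIso_of_ker_eq hf (q2.comp q1) hs (s2.comp s1) (le_antisymm ?_ ?_)
  · intro x hx
    rw [LinearMap.mem_ker] at hx
    have hxt : x ∈ ⨆ m, zPart R τ m := by rw [iSup_zPart]; trivial
    obtain ⟨v, hv, rfl⟩ := (Submodule.mem_iSup_iff_exists_finsupp _ _).1 hxt
    rw [Finsupp.sum, map_sum] at hx
    have hv0 : ∀ m ∈ v.support, hC.hom hL (v m) = 0 :=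
      (iSupIndep_iff_finsetSum_eq_zero_imp_eq_zero _).1 gr_indep v.support
        (fun m => hC.hom hL (v m)) (fun m _ => hgr m (hv m)) hx
    refine Submodule.sum_mem _ fun m hm => ?_
    have h0 := hv0 m hm
    have hvm := hv m
    generalize v m = y at h0 hvm
    rw [LinearMap.mem_ker, LinearMap.comp_apply]
    by_cases h2 : 2 ≤ |m|
    · rw [SuperQuot.mk_eq_zero_of_mem (hC.kerFar_subset hL hE hF (hC.mem_kerFar hL h2 h0 hvm)),
        map_zero]
    by_cases h1 : |m| = 1
    · rw [hC.eq_zero_of_abs_eq_one hL hE hF h1 h0 hvm, map_zero, map_zero]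
    have hm0 : m = 0 := by
      rw [← abs_eq_zero]
      have := abs_nonneg m
      omega
    subst hm0
    have hyc := zPart_zero_le R τ hvm
    rw [cartan_eq] at hyc
    obtain ⟨h, rfl⟩ := hyc
    rw [hC.hom_tH] at h0
    refine SuperQuot.mk_eq_zero_of_mem fun z => ?_
    have hr : ∀ i, R.root i h = 0 := fun i => by
      have := hC.HE h i
      rw [h0, map_zero, LinearMap.zero_apply] at this
      exact (smul_eq_zero.1 this.symm).resolve_right (hE.ne_zero i)
    obtain ⟨z, rfl⟩ := s1 z
    rw [SuperQuot.mk_mul, SuperQuot.mk_mul, (tH_mem_centre hr z).1, (tH_mem_centre hr z).2,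
      map_zero]
    exact ⟨rfl, rfl⟩
  · have t1 : ∀ x ∈ trivialIdeals R τ, hC.hom hL x = 0 := by
      rintro x ⟨J, hJ, hJz, hJh, hx⟩
      have : J.map (hC.hom hL) = ⊥ := by
        refine ideal _ (hf.isGradedIdeal_map hs hJ) ?_
        rw [Submodule.map_le_iff_le_comap]
        refine hJz.trans (iSup_le fun m => ?_)
        by_cases hm : m = 0
        · subst hm
          refine (inf_le_inf_left _ (zPart_zero_le R τ)).trans ?_
          rw [hJh]
          exact bot_le
        · rw [← Submodule.map_le_iff_le_comap]
          refine le_trans ?_ (le_iSup₂_of_le m hm le_rfl)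
          rw [Submodule.map_le_iff_le_comap]
          exact inf_le_right.trans (hgr m)
      have h1 : hC.hom hL x ∈ J.map (hC.hom hL) := ⟨x, hx, rfl⟩
      rwa [this, Submodule.mem_bot] at h1
    let f1 := SuperQuot.lift _ hf t1
    have hf1 : IsSuperHom f1 := SuperQuot.isSuperHom_lift _ _ _
    have sf1 : Function.Surjective f1 := fun y => by
      obtain ⟨x, rfl⟩ := hs y
      exact ⟨_, SuperQuot.lift_mk _ hf t1 x⟩
    have t2 : ∀ x ∈ centre k (Contragredient R τ), f1 x = 0 := by
      intro x hx
      refine hcentre _ fun y => ?_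
      obtain ⟨y, rfl⟩ := sf1 y
      rw [← hf1.map_mul, ← hf1.map_mul, (hx y).1, (hx y).2, map_zero]
      exact ⟨rfl, rfl⟩
    intro x hx
    rw [LinearMap.mem_ker, LinearMap.comp_apply] at hx
    have h2 := SuperQuot.lift_mk f1 hf1 t2 (SuperQuot.mk k _ x)
    rw [hx, map_zero] at h2
    exact (SuperQuot.lift_mk _ hf t1 x).symm.trans h2.symm

end Recognition

/-! ### The superalgebra attached to an ideal with an invariant form -/

/-- For an ideal `𝔥` of a Lie algebra `𝔤` and a bilinear form on `𝔥`, the superspace with even part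
`𝔤 ⊕ 𝔰𝔩₂` and odd part `𝔥 ⊗ V`, where `V` is the natural module of `𝔰𝔩₂`. An element has
coordinates `g ∈ 𝔤`, the matrix `(h, e; f, -h)` in `𝔰𝔩₂`, and `p ⊗ v₀ + q ⊗ v₁` in `𝔥 ⊗ V`, for the
standard basis `v₀`, `v₁` of `V`. The form is a parameter since the product depends on it. -/
@[ext] structure Double {k : Type u} [Field k] {𝔤 : Type v} [LieRing 𝔤] [LieAlgebra k 𝔤]
    {𝔥 : LieIdeal k 𝔤} (B : 𝔥 →ₗ[k] 𝔥 →ₗ[k] k) : Type (max u v) where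
  g : 𝔤
  h : k
  e : k
  f : k
  p : 𝔥
  q : 𝔥

namespace Double

variable {k : Type u} [Field k] {𝔤 : Type v} [LieRing 𝔤] [LieAlgebra k 𝔤]
    {𝔥 : LieIdeal k 𝔤} {B : 𝔥 →ₗ[k] 𝔥 →ₗ[k] k}

/-- The coordinates of an element. -/
def equiv : Double B ≃ 𝔤 × k × k × k × 𝔥 × 𝔥 where
  toFun x := (x.g, x.h, x.e, x.f, x.p, x.q)
  invFun x := ⟨x.1, x.2.1, x.2.2.1, x.2.2.2.1, x.2.2.2.2.1, x.2.2.2.2.2⟩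
  left_inv _ := rfl
  right_inv _ := rfl

instance : AddCommGroup (Double B) := equiv.addCommGroup

instance : Module k (Double B) := equiv.module k

@[simp] theorem add_g (x y : Double B) : (x + y).g = x.g + y.g := rfl
@[simp] theorem add_h (x y : Double B) : (x + y).h = x.h + y.h := rfl
@[simp] theorem add_e (x y : Double B) : (x + y).e = x.e + y.e := rfl
@[simp] theorem add_f (x y : Double B) : (x + y).f = x.f + y.f := rfl
@[simp] theorem add_p (x y : Double B) : (x + y).p = x.p + y.p := rfl
@[simp] theorem add_q (x y : Double B) : (x + y).q = x.q + y.q := rfl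
@[simp] theorem sub_g (x y : Double B) : (x - y).g = x.g - y.g := rfl
@[simp] theorem sub_h (x y : Double B) : (x - y).h = x.h - y.h := rfl
@[simp] theorem sub_e (x y : Double B) : (x - y).e = x.e - y.e := rfl
@[simp] theorem sub_f (x y : Double B) : (x - y).f = x.f - y.f := rfl
@[simp] theorem sub_p (x y : Double B) : (x - y).p = x.p - y.p := rfl
@[simp] theorem sub_q (x y : Double B) : (x - y).q = x.q - y.q := rfl
@[simp] theorem neg_g (x : Double B) : (-x).g = -x.g := rfl
@[simp] theorem neg_h (x : Double B) : (-x).h = -x.h := rfl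
@[simp] theorem neg_e (x : Double B) : (-x).e = -x.e := rfl
@[simp] theorem neg_f (x : Double B) : (-x).f = -x.f := rfl
@[simp] theorem neg_p (x : Double B) : (-x).p = -x.p := rfl
@[simp] theorem neg_q (x : Double B) : (-x).q = -x.q := rfl
@[simp] theorem zero_g : (0 : Double B).g = 0 := rfl
@[simp] theorem zero_h : (0 : Double B).h = 0 := rfl
@[simp] theorem zero_e : (0 : Double B).e = 0 := rfl
@[simp] theorem zero_f : (0 : Double B).f = 0 := rfl
@[simp] theorem zero_p : (0 : Double B).p = 0 := rfl
@[simp] theorem zero_q : (0 : Double B).q = 0 := rfl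
@[simp] theorem smul_g (c : k) (x : Double B) : (c • x).g = c • x.g := rfl
@[simp] theorem smul_h (c : k) (x : Double B) : (c • x).h = c * x.h := rfl
@[simp] theorem smul_e (c : k) (x : Double B) : (c • x).e = c * x.e := rfl
@[simp] theorem smul_f (c : k) (x : Double B) : (c • x).f = c * x.f := rfl
@[simp] theorem smul_p (c : k) (x : Double B) : (c • x).p = c • x.p := rfl
@[simp] theorem smul_q (c : k) (x : Double B) : (c • x).q = c • x.q := rfl

variable (B) in
/-- The element of `𝔤 ⊕ 𝔰𝔩₂` with the given coordinates. -/
@[simps] def ev (g : 𝔤) (h e f : k) : Double B := ⟨g, h, e, f, 0, 0⟩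

variable (B) in
/-- The element `p ⊗ v₀ + q ⊗ v₁` of `𝔥 ⊗ V`. -/
@[simps] def od (p q : 𝔥) : Double B := ⟨0, 0, 0, 0, p, q⟩

variable (B) in
/-- The product: `𝔤 ⊕ 𝔰𝔩₂` is a direct sum of Lie algebras acting on `𝔥 ⊗ V`, and
`[a ⊗ u, b ⊗ v] = ⟨u|v⟩[a, b] + B(a, b) u ∘ v`, where `⟨·|·⟩` is the alternating form with
`⟨v₀|v₁⟩ = 1` and `u ∘ v` is the element `w ↦ ⟨u|w⟩v + ⟨v|w⟩u` of `𝔰𝔩₂`. -/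
def mul : Double B →ₗ[k] Double B →ₗ[k] Double B :=
  LinearMap.mk₂ k (fun x y =>
    ⟨⁅x.g, y.g⁆ + ((⁅(x.p : 𝔤), y.q⁆ - ⁅(x.q : 𝔤), y.p⁆ : 𝔥) : 𝔤),
      x.e * y.f - x.f * y.e - (B x.p y.q + B x.q y.p),
      2 * (x.h * y.e - x.e * y.h) + 2 * B x.p y.p,
      2 * (x.f * y.h - x.h * y.f) - 2 * B x.q y.q,
      ⁅x.g, y.p⁆ - ⁅y.g, x.p⁆ + (x.h • y.p + x.e • y.q) - (y.h • x.p + y.e • x.q),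
      ⁅x.g, y.q⁆ - ⁅y.g, x.q⁆ + (x.f • y.p - x.h • y.q) - (y.f • x.p - y.h • x.q)⟩)
    (fun _ _ _ => by
      ext1 <;> simp <;> first | ring1 | module)
    (fun _ _ _ => by
      ext1 <;> simp <;> first | ring1 | module)
    (fun _ _ _ => by
      ext1 <;> simp <;> first | ring1 | module)
    (fun _ _ _ => by
      ext1 <;> simp <;> first | ring1 | module)

/-- The parity projections. -/
def proj (i : ZMod 2) : Double B →ₗ[k] Double B :=
  if i = 0 then
    { toFun := fun x => ev B x.g x.h x.e x.f
      map_add' := fun _ _ => by ext1 <;> simp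
      map_smul' := fun _ _ => by ext1 <;> simp }
  else
    { toFun := fun x => od B x.p x.q
      map_add' := fun _ _ => by ext1 <;> simp
      map_smul' := fun _ _ => by ext1 <;> simp }

instance : SuperProduct k (Double B) where
  proj := proj
  proj_proj i j x := by
    rcases zmod2_cases i with rfl | rfl <;> rcases zmod2_cases j with rfl | rfl <;> rfl
  proj_add x := by
    change ev B x.g x.h x.e x.f + od B x.p x.q = x
    ext1 <;> simp
  mul := mul B

theorem pr_zero (x : Double B) : pr k 0 x = ev B x.g x.h x.e x.f := rfl

theorem pr_one (x : Double B) : pr k 1 x = od B x.p x.q := rfl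

@[simp] theorem mul_g (x y : Double B) : (pmul k x y).g =
    ⁅x.g, y.g⁆ + ((⁅(x.p : 𝔤), y.q⁆ - ⁅(x.q : 𝔤), y.p⁆ : 𝔥) : 𝔤) := rfl
@[simp] theorem mul_h (x y : Double B) : (pmul k x y).h =
    x.e * y.f - x.f * y.e - (B x.p y.q + B x.q y.p) := rfl
@[simp] theorem mul_e (x y : Double B) : (pmul k x y).e =
    2 * (x.h * y.e - x.e * y.h) + 2 * B x.p y.p := rfl
@[simp] theorem mul_f (x y : Double B) : (pmul k x y).f =
    2 * (x.f * y.h - x.h * y.f) - 2 * B x.q y.q := rfl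
@[simp] theorem mul_p (x y : Double B) : (pmul k x y).p =
    ⁅x.g, y.p⁆ - ⁅y.g, x.p⁆ + (x.h • y.p + x.e • y.q) - (y.h • x.p + y.e • x.q) := rfl
@[simp] theorem mul_q (x y : Double B) : (pmul k x y).q =
    ⁅x.g, y.q⁆ - ⁅y.g, x.q⁆ + (x.f • y.p - x.h • y.q) - (y.f • x.p - y.h • x.q) := rfl

theorem ev_mem (g : 𝔤) (h e f : k) : ev B g h e f ∈ part k (Double B) 0 := rfl

theorem od_mem (p q : 𝔥) : od B p q ∈ part k (Double B) 1 := rfl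

theorem exists_of_mem_zero {x : Double B} (hx : x ∈ part k (Double B) 0) :
    ∃ g h e f, x = ev B g h e f := ⟨_, _, _, _, (mem_part.1 hx).symm⟩

theorem exists_of_mem_one {x : Double B} (hx : x ∈ part k (Double B) 1) :
    ∃ p q, x = od B p q := ⟨_, _, (mem_part.1 hx).symm⟩

variable (B) in
/-- A symmetric invariant form for which `[a, [a, c]] = B(a, a)c - B(a, c)a`, as for the cross
product of a composition algebra. -/
structure IsCrossForm : Prop where
  symm : ∀ a b, B a b = B b a
  invariant : ∀ (x : 𝔤) a b, B ⁅x, a⁆ b + B a ⁅x, b⁆ = 0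
  cross : ∀ a c : 𝔥, ⁅(a : 𝔤), ⁅(a : 𝔤), c⁆⁆ = B a a • c - B a c • a

theorem lie_coe_swap (a b : 𝔥) : ⁅(a : 𝔤), b⁆ = -⁅(b : 𝔤), a⁆ := by
  ext
  simp

theorem IsCrossForm.cross₂ (hB : IsCrossForm B) (a b c : 𝔥) :
    ⁅(a : 𝔤), ⁅(b : 𝔤), c⁆⁆ + ⁅(b : 𝔤), ⁅(a : 𝔤), c⁆⁆ =
      (2 * B a b) • c - B a c • b - B b c • a := by
  have h := hB.cross (a + b) c
  have h1 := hB.cross a c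
  have h2 := hB.cross b c
  have h3 := hB.symm b a
  simp only [LieSubmodule.coe_add, add_lie, lie_add, map_add, LinearMap.add_apply, h1, h2, h3] at h
  linear_combination (norm := module) h

theorem lie_coe_lie (x : 𝔤) (a b : 𝔥) :
    ⁅x, ⁅(a : 𝔤), b⁆⁆ = ⁅((⁅x, a⁆ : 𝔥) : 𝔤), b⁆ + ⁅(a : 𝔤), ⁅x, b⁆⁆ := by
  rw [leibniz_lie, LieSubmodule.coe_bracket]

theorem jacobi_ee (g g' : 𝔤) (h e f h' e' f' : k) (z : Double B) :
    pmul k (ev B g h e f) (pmul k (ev B g' h' e' f') z) =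
      pmul k (pmul k (ev B g h e f) (ev B g' h' e' f')) z +
        pmul k (ev B g' h' e' f') (pmul k (ev B g h e f) z) := by
  ext1 <;> simp
  · ring
  · ring
  · ring
  · module
  · module

end Double

namespace Double

variable {k : Type u} [Field k] {𝔤 : Type v} [LieRing 𝔤] [LieAlgebra k 𝔤]
    {𝔥 : LieIdeal k 𝔤} {B : 𝔥 →ₗ[k] 𝔥 →ₗ[k] k}

theorem jacobi_eo (hB : IsCrossForm B) (g : 𝔤) (h e f : k) (p q : 𝔥) (z : Double B) :
    pmul k (ev B g h e f) (pmul k (od B p q) z) =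
      pmul k (pmul k (ev B g h e f) (od B p q)) z +
        pmul k (od B p q) (pmul k (ev B g h e f) z) := by
  have i1 := hB.invariant g p z.p
  have i2 := hB.invariant g p z.q
  have i3 := hB.invariant g q z.p
  have i4 := hB.invariant g q z.q
  ext1
  · have h1 := lie_coe_lie g p z.q
    have h2 := lie_coe_lie g q z.p
    simp
    module
  · simp
    linear_combination i2 + i3
  · simp
    linear_combination -2 * i1
  · simp
    linear_combination 2 * i4
  · simp
    module
  · simp
    module

theorem jacobi_oo (hB : IsCrossForm B) (p q p' q' : 𝔥) (z : Double B) :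
    pmul k (od B p q) (pmul k (od B p' q') z) =
      pmul k (pmul k (od B p q) (od B p' q')) z -
        pmul k (od B p' q') (pmul k (od B p q) z) := by
  have sw : ∀ a b c : 𝔥, ⁅(a : 𝔤), ⁅(b : 𝔤), c⁆⁆ = -⁅(a : 𝔤), ⁅(c : 𝔤), b⁆⁆ := fun a b c => by
    rw [lie_coe_swap b c, lie_neg]
  have s1 := hB.symm p' p
  have s2 := hB.symm q' p
  have s3 := hB.symm p' q
  have s4 := hB.symm q' q
  ext1
  · simp
    have sk : ∀ a b : 𝔤, ⁅a, b⁆ = -⁅b, a⁆ := fun a b => (lie_skew a b).symm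
    have sw : ∀ a b c : 𝔤, ⁅a, ⁅b, c⁆⁆ = -⁅a, ⁅c, b⁆⁆ := fun a b c => by rw [sk b c, lie_neg]
    have hj : ∀ a b c : 𝔤, ⁅a, ⁅b, c⁆⁆ = -⁅c, ⁅a, b⁆⁆ + ⁅b, ⁅a, c⁆⁆ := fun a b c => by
      rw [leibniz_lie a b c, sk ⁅a, b⁆ c]
    linear_combination (norm := module) (-2 : k) • hj z.g p q' + sw z.g q' p - sw p q' z.g +
      sw q' p z.g + (2 : k) • hj z.g q p' - sw z.g p' q + sw q p' z.g - sw p' q z.g -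
      z.f • sk p p' + z.h • sk p q' + z.h • sk q p' + z.e • sk q q'
  · simp
    have i1 := hB.invariant z.g p q'
    have i2 := hB.invariant z.g q p'
    rw [hB.symm _ q'] at i1
    rw [hB.symm _ p'] at i2
    linear_combination i1 + i2 + z.f * s1 - z.h * s3 + z.h * s2 + z.e * s4
  · simp
    have i1 := hB.invariant z.g p p'
    rw [hB.symm _ p'] at i1
    linear_combination -2 * i1 - 2 * z.h * s1 - 2 * z.e * s3
  · simp
    have i1 := hB.invariant z.g q q'
    rw [hB.symm _ q'] at i1
    linear_combination 2 * i1 + 2 * z.f * s2 - 2 * z.h * s4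
  · simp
    have h1 := hB.cross₂ p z.p q'
    have h2 := hB.cross₂ p p' z.q
    have h3 := hB.cross₂ p' z.p q
    rw [hB.symm z.p q'] at h1
    rw [hB.symm z.p q, s3] at h3
    linear_combination (norm := module) h1 + sw q' z.p p - sw z.p q' p - sw p q' z.p +
      h2 - sw p' z.q p + sw z.q p' p - sw p z.q p' +
      h3 + sw q p' z.p - sw p' q z.p - sw z.p q p'
  · simp
    have h1 := hB.cross₂ q q' z.p
    have h2 := hB.cross₂ q z.q p'
    have h3 := hB.cross₂ q' z.q p
    rw [hB.symm z.q p'] at h2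
    rw [hB.symm z.q p, s2] at h3
    linear_combination (norm := module) -h1 + sw q' z.p q + sw q z.p q' - sw z.p q' q -
      h2 - sw p' z.q q + sw z.q p' q + sw q p' z.q -
      h3 - sw p q' z.q + sw q' p z.q + sw z.q p q'

theorem skew_eo (g : 𝔤) (h e f : k) (p q : 𝔥) :
    pmul k (ev B g h e f) (od B p q) = -pmul k (od B p q) (ev B g h e f) := by
  ext1 <;> simp <;> abel

/-- The superalgebra attached to a form of the cross product type is a Lie superalgebra. -/
theorem isLieSuperalgebra (hB : IsCrossForm B) : IsLieSuperalgebra k (Double B) where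
  mul_mem i j x hx y hy := by
    rcases zmod2_cases i with rfl | rfl <;> rcases zmod2_cases j with rfl | rfl
    · obtain ⟨g, h, e, f, rfl⟩ := exists_of_mem_zero hx
      obtain ⟨g', h', e', f', rfl⟩ := exists_of_mem_zero hy
      change ev B _ _ _ _ = _
      ext1 <;> simp
    · obtain ⟨g, h, e, f, rfl⟩ := exists_of_mem_zero hx
      obtain ⟨p, q, rfl⟩ := exists_of_mem_one hy
      change od B _ _ = _
      ext1 <;> simp
    · obtain ⟨p, q, rfl⟩ := exists_of_mem_one hx
      obtain ⟨g, h, e, f, rfl⟩ := exists_of_mem_zero hy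
      change od B _ _ = _
      ext1 <;> simp
    · obtain ⟨p, q, rfl⟩ := exists_of_mem_one hx
      obtain ⟨p', q', rfl⟩ := exists_of_mem_one hy
      change ev B _ _ _ _ = _
      ext1 <;> simp
  skew i j x hx y hy := by
    rcases zmod2_cases i with rfl | rfl <;> rcases zmod2_cases j with rfl | rfl
    · obtain ⟨g, h, e, f, rfl⟩ := exists_of_mem_zero hx
      obtain ⟨g', h', e', f', rfl⟩ := exists_of_mem_zero hy
      rw [zero_mul, sgn_zero, one_smul]
      ext1 <;> simp <;> ring
    · obtain ⟨g, h, e, f, rfl⟩ := exists_of_mem_zero hx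
      obtain ⟨p, q, rfl⟩ := exists_of_mem_one hy
      rw [zero_mul, sgn_zero, one_smul, skew_eo]
    · obtain ⟨p, q, rfl⟩ := exists_of_mem_one hx
      obtain ⟨g, h, e, f, rfl⟩ := exists_of_mem_zero hy
      rw [mul_zero, sgn_zero, one_smul, skew_eo, neg_neg]
    · obtain ⟨p, q, rfl⟩ := exists_of_mem_one hx
      obtain ⟨p', q', rfl⟩ := exists_of_mem_one hy
      rw [mul_one, sgn_one, neg_smul, one_smul, neg_neg]
      ext1
      · simp only [mul_g, od_g, od_p, od_q, lie_coe_swap p' q, lie_coe_swap q' p]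
        congr 2
        abel
      all_goals simp [hB.symm p' p, hB.symm q' p, hB.symm p' q, hB.symm q' q]
      ring
  jacobi i j x hx y hy z := by
    rcases zmod2_cases i with rfl | rfl <;> rcases zmod2_cases j with rfl | rfl
    · obtain ⟨g, h, e, f, rfl⟩ := exists_of_mem_zero hx
      obtain ⟨g', h', e', f', rfl⟩ := exists_of_mem_zero hy
      rw [zero_mul, sgn_zero, one_smul, jacobi_ee]
    · obtain ⟨g, h, e, f, rfl⟩ := exists_of_mem_zero hx
      obtain ⟨p, q, rfl⟩ := exists_of_mem_one hy
      rw [zero_mul, sgn_zero, one_smul, jacobi_eo hB]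
    · obtain ⟨p, q, rfl⟩ := exists_of_mem_one hx
      obtain ⟨g, h, e, f, rfl⟩ := exists_of_mem_zero hy
      rw [mul_zero, sgn_zero, one_smul, jacobi_eo hB, skew_eo, map_neg, LinearMap.neg_apply]
      abel
    · obtain ⟨p, q, rfl⟩ := exists_of_mem_one hx
      obtain ⟨p', q', rfl⟩ := exists_of_mem_one hy
      rw [mul_one, sgn_one, neg_smul, one_smul, jacobi_oo hB, sub_eq_add_neg]
  cube x hx := by
    obtain ⟨p, q, rfl⟩ := exists_of_mem_one hx
    have h1 := hB.cross p q
    have h2 := hB.cross q p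
    have h3 := hB.symm q p
    have h4 : ⁅(p : 𝔤), ⁅(q : 𝔤), p⁆⁆ = -⁅(p : 𝔤), ⁅(p : 𝔤), q⁆⁆ := by
      rw [lie_coe_swap q p, lie_neg]
    have h5 : ⁅(q : 𝔤), ⁅(p : 𝔤), q⁆⁆ = -⁅(q : 𝔤), ⁅(q : 𝔤), p⁆⁆ := by
      rw [lie_coe_swap p q, lie_neg]
    have h6 : ∀ a : 𝔥, ⁅(a : 𝔤), a⁆ = 0 := fun a => by ext; simp
    rw [h3] at h2
    ext1
    · simp
    · simp
    · simp
    · simp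
    · simp [h3, h4, h1, h6]
      module
    · simp [h3, h5, h2, h6]
      module

end Double

section Derived

variable {k : Type u} [Field k] {L : Type v} [AddCommGroup L] [Module k L] [SuperProduct k L]

theorem IsLieSuperalgebra.isGradedIdeal_derived (hL : IsLieSuperalgebra k L) :
    IsGradedIdeal (derived k L) := by
  have hm : ∀ x y : L, pmul k x y ∈ derived k L := fun x y => Submodule.subset_span ⟨x, y, rfl⟩
  refine hL.isGradedIdeal (fun i x hx => ?_) fun x y _ => hm x y
  refine (Submodule.span_le.2 ?_ : _ ≤ (derived k L).comap (pr k i)) hx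
  rintro _ ⟨x, y, rfl⟩
  have key : ∀ a b, pr k i (pmul k (pr k a x) (pr k b y)) ∈ derived k L := fun a b => by
    rw [pr_of_mem (hL.mul_mem a b _ (pr_mem_part _ _) _ (pr_mem_part _ _))]
    split_ifs
    · exact hm _ _
    · exact zero_mem _
  rw [SetLike.mem_coe, Submodule.mem_comap, ← SuperSpace.proj_add (k := k) x,
    ← SuperSpace.proj_add (k := k) y]
  simp only [map_add, LinearMap.add_apply]
  exact add_mem (add_mem (key _ _) (key _ _)) (add_mem (key _ _) (key _ _))

end Derived

namespace Double

variable {k : Type u} [Field k] {𝔤 : Type v} [LieRing 𝔤] [LieAlgebra k 𝔤]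
    {𝔥 : LieIdeal k 𝔤} {B : 𝔥 →ₗ[k] 𝔥 →ₗ[k] k}

variable (B) in
/-- The subspace `𝔥 ⊕ 𝔰𝔩₂ ⊕ (𝔥 ⊗ V)`. -/
def core : Submodule k (Double B) where
  carrier := {x | x.g ∈ 𝔥}
  add_mem' hx hy := 𝔥.add_mem hx hy
  zero_mem' := 𝔥.zero_mem
  smul_mem' c _ hx := 𝔥.smul_mem c hx

theorem mem_core {x : Double B} : x ∈ core B ↔ x.g ∈ 𝔥 := Iff.rfl

variable (B) in
/-- The conditions on the ideal and the form under which the core is simple. -/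
structure IsRegular : Prop where
  two_ne_zero : (2 : k) ≠ 0
  nondegenerate : ∀ a : 𝔥, a ≠ 0 → ∃ b, B b a ≠ 0
  perfect : ∀ N : Submodule k 𝔥, (∀ a b : 𝔥, ⁅(a : 𝔤), b⁆ ∈ N) → N = ⊤
  faithful : ∀ x : 𝔤, (∀ a : 𝔥, ⁅x, a⁆ = 0) → x = 0
  exists_ne_zero : ∃ a : 𝔥, a ≠ 0
  lie_mem : ∀ x y : 𝔤, ⁅x, y⁆ ∈ 𝔥

theorem isGraded_core : IsGraded (core B) := by
  intro i x hx
  rcases zmod2_cases i with rfl | rfl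
  · exact hx
  · exact mem_core.2 𝔥.zero_mem

theorem pmul_mem_core (hR : IsRegular B) (x y : Double B) : pmul k x y ∈ core B := by
  rw [mem_core, mul_g]
  exact add_mem (hR.lie_mem _ _) (SetLike.coe_mem _)

theorem exists_lie_ne_zero (hR : IsRegular B) {g : 𝔤} {h e f : k} (hx : ev B g h e f ≠ 0) :
    ∃ a b, pmul k (od B a b) (ev B g h e f) ≠ 0 := by
  by_contra! hc
  apply hx
  obtain ⟨a₀, ha₀⟩ := hR.exists_ne_zero
  have h1 : ∀ a : 𝔥, ⁅g, a⁆ + h • a = 0 ∧ f • a = 0 := fun a => by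
    have h1 := congrArg p (hc a 0)
    have h2 := congrArg q (hc a 0)
    simp at h1 h2
    refine ⟨?_, by simpa using h2⟩
    linear_combination (norm := module) -h1
  have h2 : ∀ a : 𝔥, ⁅g, a⁆ - h • a = 0 ∧ e • a = 0 := fun a => by
    have h1 := congrArg p (hc 0 a)
    have h2 := congrArg q (hc 0 a)
    simp at h1 h2
    refine ⟨?_, by simpa using h1⟩
    linear_combination (norm := module) -h2
  have hf := (smul_eq_zero.1 (h1 a₀).2).resolve_right ha₀
  have he := (smul_eq_zero.1 (h2 a₀).2).resolve_right ha₀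
  have hh : h = 0 := by
    have : ((2 : k) * h) • a₀ = 0 := by
      linear_combination (norm := module) (h1 a₀).1 - (h2 a₀).1
    exact (mul_eq_zero.1 ((smul_eq_zero.1 this).resolve_right ha₀)).resolve_left hR.two_ne_zero
  have hg : g = 0 := hR.faithful g fun a => by simpa [hh] using (h1 a).1
  subst hf he hh hg
  rfl

/-- A nonzero graded subspace stable under the core contains the core. Indeed it contains a nonzero
vector `a ⊗ v₀`, hence by nondegeneracy of the form a nonzero nilpotent element of `𝔰𝔩₂`, thus
`𝔰𝔩₂`, thus `𝔥 ⊗ V = [𝔰𝔩₂, 𝔥 ⊗ V]`, and finally `[𝔥, 𝔥] = 𝔥`. -/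
theorem core_le (hR : IsRegular B) {J : Submodule k (Double B)} (hJ : J ≠ ⊥) (hg : IsGraded J)
    (hm : ∀ x ∈ core B, ∀ y ∈ J, pmul k x y ∈ J) : core B ≤ J := by
  have two := hR.two_ne_zero
  have hev : ∀ h e f : k, ev B 0 h e f ∈ core B := fun _ _ _ => mem_core.2 𝔥.zero_mem
  have hod : ∀ a b : 𝔥, od B a b ∈ core B := fun _ _ => mem_core.2 𝔥.zero_mem
  have s1 : ∃ a b, od B a b ∈ J ∧ od B a b ≠ 0 := by
    obtain ⟨x, hx, hx0⟩ := (Submodule.ne_bot_iff J).1 hJ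
    by_cases h1 : pr k 1 x = 0
    · have h0 : pr k 0 x ≠ 0 := fun h0 => hx0 (by
        rw [← SuperSpace.proj_add (k := k) x, h0, h1, add_zero])
      rw [pr_zero] at h0
      obtain ⟨a, b, hab⟩ := exists_lie_ne_zero hR h0
      have e1 : pmul k (od B a b) (ev B x.g x.h x.e x.f) =
          od B (pmul k (od B a b) (ev B x.g x.h x.e x.f)).p
            (pmul k (od B a b) (ev B x.g x.h x.e x.f)).q := by
        ext1 <;> simp
      have e2 := hm _ (hod a b) _ (hg 0 x hx)
      rw [pr_zero] at e2
      rw [e1] at hab e2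
      exact ⟨_, _, e2, hab⟩
    · exact ⟨_, _, hg 1 x hx, h1⟩
  have s2 : ∃ a, od B a 0 ∈ J ∧ a ≠ 0 := by
    obtain ⟨a, b, h1, h2⟩ := s1
    by_cases hb : b = 0
    · subst hb
      refine ⟨a, h1, ?_⟩
      rintro rfl
      exact h2 rfl
    · have h3 := hm _ (hev 0 1 0) _ h1
      have h4 : pmul k (ev B 0 0 1 0) (od B a b) = od B b 0 := by ext1 <;> simp
      exact ⟨b, h4 ▸ h3, hb⟩
  obtain ⟨a, ha, ha0⟩ := s2
  obtain ⟨b, hb⟩ := hR.nondegenerate a ha0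
  have hE : ∀ t, ev B 0 0 t 0 ∈ J := by
    intro t
    have h1 := J.smul_mem (t * (2 * B b a)⁻¹) (hm _ (hod b 0) _ ha)
    have h2 : (t * (2 * B b a)⁻¹) • pmul k (od B b 0) (od B a 0) = ev B 0 0 t 0 := by
      ext1 <;> simp
      field_simp
    rwa [h2] at h1
  have hH : ∀ t, ev B 0 t 0 0 ∈ J := by
    intro t
    have h1 := hm _ (hev 0 0 1) _ (hE (-t))
    have h2 : pmul k (ev B 0 0 0 1) (ev B 0 0 (-t) 0) = ev B 0 t 0 0 := by ext1 <;> simp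
    rwa [h2] at h1
  have hF : ∀ t, ev B 0 0 0 t ∈ J := by
    intro t
    have h1 := hm _ (hev 0 0 1) _ (hH (t * 2⁻¹))
    have h2 : pmul k (ev B 0 0 0 1) (ev B 0 (t * 2⁻¹) 0 0) = ev B 0 0 0 t := by
      ext1 <;> simp
      field_simp
    rwa [h2] at h1
  have hO : ∀ p q, od B p q ∈ J := by
    intro p q
    have h1 := hm _ (hod (-p) q) _ (hH 1)
    have h2 : pmul k (od B (-p) q) (ev B 0 1 0 0) = od B p q := by ext1 <;> simp
    rwa [h2] at h1
  let φ : 𝔥 →ₗ[k] Double B :=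
    { toFun := fun a => ev B a 0 0 0
      map_add' := fun _ _ => by ext1 <;> simp
      map_smul' := fun _ _ => by ext1 <;> simp }
  have hG : J.comap φ = ⊤ := by
    refine hR.perfect _ fun c d => ?_
    have h1 := add_mem (hm _ (hod c 0) _ (hO 0 d)) (hH (B c d))
    have h2 : pmul k (od B c 0) (od B 0 d) + ev B 0 (B c d) 0 0 = φ ⁅(c : 𝔤), d⁆ := by
      change _ = ev B _ 0 0 0
      ext1 <;> simp
    rwa [h2] at h1
  intro x hx
  have h1 : φ ⟨x.g, mem_core.1 hx⟩ ∈ J := by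
    rw [← Submodule.mem_comap, hG]; trivial
  have h2 : x = φ ⟨x.g, mem_core.1 hx⟩ + ev B 0 x.h 0 0 + ev B 0 0 x.e 0 + ev B 0 0 0 x.f +
      od B x.p x.q := by
    change _ = ev B _ 0 0 0 + _ + _ + _ + _
    ext1 <;> simp
  rw [h2]
  exact add_mem (add_mem (add_mem (add_mem h1 (hH _)) (hE _)) (hF _)) (hO _ _)

theorem exists_mem_core_pmul_ne_zero :
    ∃ x ∈ core B, ∃ y ∈ core B, pmul k x y ≠ 0 := by
  refine ⟨ev B 0 0 1 0, mem_core.2 𝔥.zero_mem, ev B 0 0 0 1, mem_core.2 𝔥.zero_mem, fun h => ?_⟩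
  have := congrArg Double.h h
  simp at this

theorem isSimpleSub_core (hR : IsRegular B) : IsSimpleSub (core B) where
  graded := isGraded_core
  mul_mem x _ y _ := pmul_mem_core hR x y
  nonabelian := exists_mem_core_pmul_ne_zero
  eq_bot_or_eq J hJ hg hm := by
    by_cases h : J = ⊥
    · exact Or.inl h
    · exact Or.inr (le_antisymm hJ (core_le hR h hg fun x hx y hy => (hm x hx y hy).1))

theorem derived_eq_core (hB : IsCrossForm B) (hR : IsRegular B) :
    derived k (Double B) = core B := by
  refine le_antisymm (Submodule.span_le.2 ?_) ?_
  · rintro _ ⟨x, y, rfl⟩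
    exact pmul_mem_core hR x y
  · have hd := (isLieSuperalgebra hB).isGradedIdeal_derived
    obtain ⟨x, -, y, -, hxy⟩ := exists_mem_core_pmul_ne_zero (B := B)
    refine core_le hR (fun h => hxy ?_) hd.graded fun x _ y hy => hd.mul_left x y hy
    rw [← Submodule.mem_bot k, ← h]
    exact Submodule.subset_span ⟨x, y, rfl⟩

theorem eq_zero_of_mem_centre (hR : IsRegular B) {x : Double B} (hx : x ∈ centre k (Double B)) :
    x = 0 := by
  have hp : x.p = 0 := by simpa using congrArg p (hx (ev B 0 1 0 0)).1
  have hq : x.q = 0 := by simpa using congrArg q (hx (ev B 0 1 0 0)).1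
  have hx' : x = ev B x.g x.h x.e x.f := by ext1 <;> simp [hp, hq]
  by_contra h0
  rw [hx'] at h0
  obtain ⟨a, b, hab⟩ := exists_lie_ne_zero hR h0
  rw [← hx'] at hab
  exact hab (hx _).2

end Double

/-! ### Coordinates on `pgl₃` in characteristic `3` -/

namespace PGL3

variable {k : Type u} [Field k]

/-- The class of a matrix in `pgl₃`. -/
def mk : Matrix (Fin 3) (Fin 3) k →ₗ[k] PGL k 3 :=
  (LieSubmodule.Quotient.mk' (scalars k 3)).toLinearMap

theorem mk_surjective : Function.Surjective (mk (k := k)) :=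
  LieSubmodule.Quotient.surjective_mk' (scalars k 3)

theorem mk_lie (A B : Matrix (Fin 3) (Fin 3) k) : ⁅mk A, mk B⁆ = mk ⁅A, B⁆ := rfl

theorem mk_eq_zero {A : Matrix (Fin 3) (Fin 3) k} : mk A = 0 ↔ ∃ c : k, c • 1 = A := by
  rw [← Submodule.mem_span_singleton]
  exact Submodule.Quotient.mk_eq_zero _

/-- The linear form on `pgl₃` induced by a linear form on `gl₃` vanishing at `1`. -/
def lift (φ : Matrix (Fin 3) (Fin 3) k →ₗ[k] k) (h : φ 1 = 0) : PGL k 3 →ₗ[k] k :=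
  (scalars k 3).toSubmodule.liftQ φ (by
    change Submodule.span k {1} ≤ _
    rw [Submodule.span_singleton_le_iff_mem]
    exact h)

variable (k) in
/-- The entry in position `(i, j)`, as a linear form. -/
def entry (i j : Fin 3) : Matrix (Fin 3) (Fin 3) k →ₗ[k] k := Matrix.entryLinearMap k k i j

theorem entry_apply (i j : Fin 3) (A : Matrix (Fin 3) (Fin 3) k) : entry k i j A = A i j := rfl

/-- The difference of the diagonal entries in positions `j + 1` and `j + 2`. Indices lie in `Fin 3`,
so that they are taken modulo `3`. -/
def dif (j : Fin 3) : PGL k 3 →ₗ[k] k :=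
  lift (entry k (j + 1) (j + 1) - entry k (j + 2) (j + 2)) (by simp [entry_apply])

/-- The entry in position `(j + 1, j + 2)`. -/
def up (j : Fin 3) : PGL k 3 →ₗ[k] k :=
  lift (entry k (j + 1) (j + 2)) (by
    rw [entry_apply, Matrix.one_apply_ne]
    decide +revert)

/-- The entry in position `(j + 2, j + 1)`. -/
def dn (j : Fin 3) : PGL k 3 →ₗ[k] k :=
  lift (entry k (j + 2) (j + 1)) (by
    rw [entry_apply, Matrix.one_apply_ne]
    decide +revert)

theorem dif_mk (j : Fin 3) (A : Matrix (Fin 3) (Fin 3) k) :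
    dif j (mk A) = A (j + 1) (j + 1) - A (j + 2) (j + 2) := rfl

theorem up_mk (j : Fin 3) (A : Matrix (Fin 3) (Fin 3) k) : up j (mk A) = A (j + 1) (j + 2) := rfl

theorem dn_mk (j : Fin 3) (A : Matrix (Fin 3) (Fin 3) k) : dn j (mk A) = A (j + 2) (j + 1) := rfl

theorem dif_two (x : PGL k 3) : dif 2 x = -dif 0 x - dif 1 x := by
  obtain ⟨A, rfl⟩ := mk_surjective x
  simp only [dif_mk]
  simp

theorem ext {x y : PGL k 3} (h0 : dif 0 x = dif 0 y) (h1 : dif 1 x = dif 1 y)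
    (hu : ∀ j, up j x = up j y) (hd : ∀ j, dn j x = dn j y) : x = y := by
  rw [← sub_eq_zero]
  have h0' : dif 0 (x - y) = 0 := by rw [map_sub, h0, sub_self]
  have h1' : dif 1 (x - y) = 0 := by rw [map_sub, h1, sub_self]
  have hu' : ∀ j, up j (x - y) = 0 := fun j => by rw [map_sub, hu, sub_self]
  have hd' : ∀ j, dn j (x - y) = 0 := fun j => by rw [map_sub, hd, sub_self]
  generalize x - y = z at *
  obtain ⟨A, rfl⟩ := mk_surjective z
  simp only [dif_mk, up_mk, dn_mk] at h0' h1' hu' hd'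
  rw [mk_eq_zero]
  have a1 := hu' 0
  have a2 := hu' 1
  have a3 := hu' 2
  have a4 := hd' 0
  have a5 := hd' 1
  have a6 := hd' 2
  simp at h0' h1' a1 a2 a3 a4 a5 a6
  refine ⟨A 0 0, ?_⟩
  ext i j
  fin_cases i <;> fin_cases j <;> simp [*]
  · linear_combination -h0' - h1'
  · linear_combination -h1'

theorem up_lie (j : Fin 3) (x y : PGL k 3) : up j ⁅x, y⁆ =
    dif j x * up j y - dif j y * up j x + dn (j + 2) x * dn (j + 1) y -
      dn (j + 2) y * dn (j + 1) x := by
  obtain ⟨A, rfl⟩ := mk_surjective x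
  obtain ⟨B, rfl⟩ := mk_surjective y
  rw [mk_lie]
  simp only [dif_mk, up_mk, dn_mk, LieRing.of_associative_ring_bracket, Matrix.sub_apply,
    Matrix.mul_apply, Fin.sum_univ_three]
  fin_cases j <;> simp <;> ring

theorem dn_lie (j : Fin 3) (x y : PGL k 3) : dn j ⁅x, y⁆ =
    dif j y * dn j x - dif j x * dn j y + up (j + 1) x * up (j + 2) y -
      up (j + 1) y * up (j + 2) x := by
  obtain ⟨A, rfl⟩ := mk_surjective x
  obtain ⟨B, rfl⟩ := mk_surjective y
  rw [mk_lie]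
  simp only [dif_mk, up_mk, dn_mk, LieRing.of_associative_ring_bracket, Matrix.sub_apply,
    Matrix.mul_apply, Fin.sum_univ_three]
  fin_cases j <;> simp <;> ring

/-- In characteristic `3` the three differences of diagonal entries of a commutator agree. -/
theorem dif_lie [CharP k 3] (j : Fin 3) (x y : PGL k 3) : dif j ⁅x, y⁆ =
    -∑ i, (up i x * dn i y - up i y * dn i x) := by
  have h3 := three_eq_zero k
  obtain ⟨A, rfl⟩ := mk_surjective x
  obtain ⟨B, rfl⟩ := mk_surjective y
  rw [mk_lie]
  simp only [dif_mk, up_mk, dn_mk, LieRing.of_associative_ring_bracket, Matrix.sub_apply,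
    Matrix.mul_apply, Fin.sum_univ_three]
  fin_cases j <;> simp <;> grind

theorem mem_PSL [CharP k 3] {x : PGL k 3} : x ∈ PSL k 3 ↔ dif 0 x = dif 1 x := by
  have h3 := three_eq_zero k
  have key : ∀ A : Matrix (Fin 3) (Fin 3) k, A.trace = dif 0 (mk A) - dif 1 (mk A) := by
    intro A
    simp only [dif_mk, Matrix.trace, Fin.sum_univ_three, Matrix.diag_apply]
    simp
    linear_combination A 2 2 * h3
  constructor
  · rintro ⟨A, hA, rfl⟩
    have := key A
    rw [show A.trace = 0 from hA] at this
    exact (sub_eq_zero.1 this.symm)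
  · intro h
    obtain ⟨A, rfl⟩ := mk_surjective x
    refine ⟨A, ?_, rfl⟩
    change A.trace = 0
    rw [key, h, sub_self]

theorem dif_eq [CharP k 3] {x : PGL k 3} (hx : x ∈ PSL k 3) (j : Fin 3) : dif j x = dif 0 x := by
  have h3 := three_eq_zero k
  have h := mem_PSL.1 hx
  fin_cases j
  · rfl
  · exact h.symm
  · change dif 2 x = _
    rw [dif_two]
    linear_combination h - dif 0 x * h3

variable (k) in
/-- The form `-tr(ab)` on `psl₃`, in coordinates. -/
def form : PSL k 3 →ₗ[k] PSL k 3 →ₗ[k] k :=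
  LinearMap.mk₂ k (fun a b => dif 0 (a : PGL k 3) * dif 0 (b : PGL k 3) -
      ∑ i, (up i (a : PGL k 3) * dn i (b : PGL k 3) + dn i (a : PGL k 3) * up i (b : PGL k 3)))
    (fun _ _ _ => by simp [Fin.sum_univ_three]; ring)
    (fun _ _ _ => by simp [Fin.sum_univ_three]; ring)
    (fun _ _ _ => by simp [Fin.sum_univ_three]; ring)
    (fun _ _ _ => by simp [Fin.sum_univ_three]; ring)

theorem form_apply (a b : PSL k 3) : form k a b = dif 0 (a : PGL k 3) * dif 0 (b : PGL k 3) -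
      ∑ i, (up i (a : PGL k 3) * dn i (b : PGL k 3) + dn i (a : PGL k 3) * up i (b : PGL k 3)) :=
  rfl

/-- The class in `pgl₃` with the given coordinates. -/
def vec (d0 d1 : k) (u d : Fin 3 → k) : PGL k 3 :=
  mk !![-d1, u 2, d 1; d 2, d0, u 0; u 1, d 0, 0]

@[simp] theorem dif_zero_vec (d0 d1 : k) (u d : Fin 3 → k) : dif 0 (vec d0 d1 u d) = d0 := by
  simp [vec, dif_mk]

@[simp] theorem dif_one_vec (d0 d1 : k) (u d : Fin 3 → k) : dif 1 (vec d0 d1 u d) = d1 := by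
  simp [vec, dif_mk]

@[simp] theorem up_vec (d0 d1 : k) (u d : Fin 3 → k) (j : Fin 3) : up j (vec d0 d1 u d) = u j := by
  fin_cases j <;> simp [vec, up_mk]

@[simp] theorem dn_vec (d0 d1 : k) (u d : Fin 3 → k) (j : Fin 3) : dn j (vec d0 d1 u d) = d j := by
  fin_cases j <;> simp [vec, dn_mk]

theorem exists_coord (d0 d1 : k) (u d : Fin 3 → k) : ∃ x : PGL k 3,
    dif 0 x = d0 ∧ dif 1 x = d1 ∧ (∀ j, up j x = u j) ∧ ∀ j, dn j x = d j :=
  ⟨vec d0 d1 u d, by simp, by simp, by simp, by simp⟩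

/-- The element of `psl₃` with the given coordinates. -/
def pvec [CharP k 3] (r : k) (u d : Fin 3 → k) : PSL k 3 :=
  ⟨vec r r u d, mem_PSL.2 (by simp)⟩

@[simp] theorem dif_pvec [CharP k 3] (r : k) (u d : Fin 3 → k) (j : Fin 3) :
    dif j (pvec r u d : PGL k 3) = r := by
  rw [dif_eq (pvec r u d).2 j]
  exact dif_zero_vec _ _ _ _

@[simp] theorem up_pvec [CharP k 3] (r : k) (u d : Fin 3 → k) (j : Fin 3) :
    up j (pvec r u d : PGL k 3) = u j := up_vec _ _ _ _ _

@[simp] theorem dn_pvec [CharP k 3] (r : k) (u d : Fin 3 → k) (j : Fin 3) :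
    dn j (pvec r u d : PGL k 3) = d j := dn_vec _ _ _ _ _

theorem exists_coord_PSL [CharP k 3] (r : k) (u d : Fin 3 → k) : ∃ x : PSL k 3,
    (∀ j, dif j (x : PGL k 3) = r) ∧ (∀ j, up j (x : PGL k 3) = u j) ∧
      ∀ j, dn j (x : PGL k 3) = d j :=
  ⟨pvec r u d, by simp, by simp, by simp⟩

theorem isCrossForm [CharP k 3] : Double.IsCrossForm (form k) where
  symm a b := by
    simp only [form_apply, Fin.sum_univ_three]
    ring
  invariant x a b := by
    have h3 := three_eq_zero k
    have ha := dif_eq a.2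
    have hb := dif_eq b.2
    have h2 := dif_two x
    simp only [form_apply, LieSubmodule.coe_bracket, dif_lie, up_lie, dn_lie, Fin.sum_univ_three,
      ha, hb, Fin.isValue, Fin.reduceAdd, h2]
    grind
  cross a c := by
    have h3 := three_eq_zero k
    have ha := dif_eq a.2
    have hc := dif_eq c.2
    refine Subtype.ext (ext ?_ ?_ (fun j => ?_) fun j => ?_)
    · simp only [form_apply, LieSubmodule.coe_bracket, dif_lie, up_lie, dn_lie, Fin.sum_univ_three,
        ha, hc, LieSubmodule.coe_sub, LieSubmodule.coe_smul, map_sub, map_smul, smul_eq_mul]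
      grind
    · simp only [form_apply, LieSubmodule.coe_bracket, dif_lie, up_lie, dn_lie, Fin.sum_univ_three,
        ha, hc, LieSubmodule.coe_sub, LieSubmodule.coe_smul, map_sub, map_smul, smul_eq_mul]
      grind
    · simp only [form_apply, LieSubmodule.coe_bracket, dif_lie, up_lie, dn_lie, Fin.sum_univ_three,
        ha, hc, LieSubmodule.coe_sub, LieSubmodule.coe_smul, map_sub, map_smul, smul_eq_mul]
      fin_cases j <;> simp <;> grind
    · simp only [form_apply, LieSubmodule.coe_bracket, dif_lie, up_lie, dn_lie, Fin.sum_univ_three,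
        ha, hc, LieSubmodule.coe_sub, LieSubmodule.coe_smul, map_sub, map_smul, smul_eq_mul]
      fin_cases j <;> simp <;> grind

end PGL3

namespace PGL3

variable {k : Type u} [Field k]

theorem isRegular [CharP k 3] : Double.IsRegular (form k) where
  two_ne_zero := NeZero.ne (2 : k)
  nondegenerate a ha := by
    by_contra! h
    have hr : dif 0 (a : PGL k 3) = 0 := by
      obtain ⟨c, c0, cu, cd⟩ := exists_coord_PSL (k := k) 1 0 0
      simpa [form_apply, c0, cu, cd] using h c
    have hd : ∀ j, dn j (a : PGL k 3) = 0 := fun j => by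
      obtain ⟨c, c0, cu, cd⟩ := exists_coord_PSL (k := k) 0 (Pi.single j 1) 0
      simpa [form_apply, c0, cu, cd, Pi.single_apply] using h c
    have hu : ∀ j, up j (a : PGL k 3) = 0 := fun j => by
      obtain ⟨c, c0, cu, cd⟩ := exists_coord_PSL (k := k) 0 0 (Pi.single j 1)
      simpa [form_apply, c0, cu, cd, Pi.single_apply] using h c
    refine ha (Subtype.ext (ext ?_ ?_ (fun j => ?_) fun j => ?_))
    · simpa using hr
    · simpa [dif_eq a.2 1] using hr
    · simpa using hu j
    · simpa using hd j
  perfect N hN := by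
    refine (Submodule.eq_top_iff'.2 fun x => ?_)
    obtain ⟨c, c0, cu, cd⟩ := exists_coord_PSL (k := k) 1 0 0
    obtain ⟨y, y0, yu, yd⟩ := exists_coord_PSL (k := k) 0 (fun j => up j (x : PGL k 3))
      fun j => -dn j (x : PGL k 3)
    obtain ⟨a, a0, au, ad⟩ := exists_coord_PSL (k := k) 0 (Pi.single 0 1) 0
    obtain ⟨b, b0, bu, bd⟩ := exists_coord_PSL (k := k) 0 0
      (Pi.single 0 (-dif 0 (x : PGL k 3)))
    have hx : x = ⁅(c : PGL k 3), y⁆ + ⁅(a : PGL k 3), b⁆ := by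
      have h := dif_eq x.2
      refine Subtype.ext (ext ?_ ?_ (fun j => ?_) fun j => ?_)
      · simp [dif_lie, cu, cd, au, ad, bu, bd, Fin.sum_univ_three]
      · simp [dif_lie, cu, cd, au, ad, bu, bd, Fin.sum_univ_three, h]
      · simp [up_lie, c0, cu, cd, y0, yu, a0, b0, ad, bu]
      · simp [dn_lie, c0, cu, cd, y0, yd, a0, b0, ad, bu]
    rw [hx]
    exact add_mem (hN c y) (hN a b)
  faithful x hx := by
    have hx' : ∀ a : PSL k 3, ⁅x, (a : PGL k 3)⁆ = 0 := fun a => congrArg Subtype.val (hx a)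
    obtain ⟨c, c0, cu, cd⟩ := exists_coord_PSL (k := k) 1 0 0
    have hu : ∀ j, up j x = 0 := fun j => by
      simpa [up_lie, c0, cu, cd] using congrArg (up j) (hx' c)
    have hd : ∀ j, dn j x = 0 := fun j => by
      simpa [dn_lie, c0, cu, cd] using congrArg (dn j) (hx' c)
    have hr : ∀ j, dif j x = 0 := fun j => by
      obtain ⟨a, a0, au, ad⟩ := exists_coord_PSL (k := k) 0 (Pi.single j 1) 0
      simpa [up_lie, a0, au, ad] using congrArg (up j) (hx' a)
    exact ext (by simp [hr]) (by simp [hr]) (by simp [hu]) (by simp [hd])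
  exists_ne_zero := by
    obtain ⟨c, c0, -, -⟩ := exists_coord_PSL (k := k) 1 0 0
    refine ⟨c, ?_⟩
    rintro rfl
    simpa using c0 0
  lie_mem x y := mem_PSL.2 (by rw [dif_lie, dif_lie])

theorem finrank_quotient_core [CharP k 3] :
    Module.finrank k (Double (form k) ⧸ Double.core (form k)) = 1 := by
  let φ : Double (form k) →ₗ[k] k :=
    { toFun := fun x => dif 0 x.g - dif 1 x.g
      map_add' := fun _ _ => by simp; ring
      map_smul' := fun _ _ => by simp; ring }
  have hker : Double.core (form k) = LinearMap.ker φ := by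
    ext x
    rw [Double.mem_core, mem_PSL, LinearMap.mem_ker, ← sub_eq_zero]
    rfl
  have hs : Function.Surjective φ := fun c => by
    obtain ⟨x, h0, h1, -, -⟩ := exists_coord c 0 0 0
    refine ⟨Double.ev _ x 0 0 0, ?_⟩
    change dif 0 x - dif 1 x = c
    rw [h0, h1, sub_zero]
  rw [hker, (φ.quotKerEquivOfSurjective hs).finrank_eq, Module.finrank_self]

end PGL3

/-! ### Coordinates on `g(S₂, S₁,₂)` in characteristic `3` -/

theorem sum_zmod_two {M : Type*} [AddCommMonoid M] (F : ZMod 2 → M) : ∑ a, F a = F 0 + F 1 :=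
  Fin.sum_univ_two F

section Triality

variable {k : Type u} [Field k]

theorem pr_end_apply {V : Type v} [AddCommGroup V] [Module k V] [SuperSpace k V] (i : ZMod 2)
    (d : Module.End k V) (x : V) :
    pr k i d x = pr k i (d (pr k 0 x)) + pr k (i + 1) (d (pr k 1 x)) := rfl

theorem pr_tmul {V : Type v} {W : Type w} [AddCommGroup V] [Module k V] [SuperSpace k V]
    [AddCommGroup W] [Module k W] [SuperSpace k W] (i : ZMod 2) (x : V) (y : W) :
    pr k i (x ⊗ₜ[k] y) = pr k 0 x ⊗ₜ pr k i y + pr k 1 x ⊗ₜ pr k (i + 1) y := rfl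

theorem coe_pr_tri {S : Type v} [AddCommGroup S] [Module k S] [FormProduct k S] (i : ZMod 2)
    (d : tri k S) (j : Fin 3) : (pr k i d).1 j = pr k i (d.1 j) := rfl

theorem theta_pow_coe {S : Type v} [AddCommGroup S] [Module k S] [FormProduct k S]
    [IsSymmetricComposition k S] (d : tri k S) (h : ∀ i j, d.1 i = d.1 j) (n : ℕ) :
    (theta ^ n) d = d := by
  induction n with
  | zero => rfl
  | succ n ih =>
    rw [pow_succ, Module.End.mul_apply]
    have : theta d = d := by
      refine Subtype.ext (funext fun j => ?_)
      change (![d.1 2, d.1 0, d.1 1] : Fin 3 → _) j = _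
      fin_cases j <;> exact h _ _
    rw [this, ih]

namespace S2

theorem pr_zero (x : S2 k) : pr k 0 x = x := proj_eq 0 x

theorem pr_one (x : S2 k) : pr k 1 x = 0 := proj_eq 1 x

/-- The endomorphism of `S₂` with eigenvalues `c` and `-c` on the standard basis. -/
def diag (c : k) : Module.End k (S2 k) where
  toFun x := ⟨c * x.p, -(c * x.m)⟩
  map_add' _ _ := by ext <;> simp <;> ring
  map_smul' _ _ := by ext <;> simp <;> ring

theorem diag_apply (c : k) (x : S2 k) : diag c x = ⟨c * x.p, -(c * x.m)⟩ := rfl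

theorem part_zero : part k (S2 k) 0 = ⊤ := by
  ext x
  simp [mem_part, pr_zero]

theorem diag_mem_osp (c : k) : diag c ∈ osp k (S2 k) 0 := by
  refine ⟨mem_part_end fun a x hx => ?_, fun a x _ y => ?_⟩
  · rcases of_mem_part hx with rfl | rfl
    · simp [part_zero]
    · simp
  · simp only [form_eq, diag_apply, zero_mul, sgn_zero]
    ring

/-- The triple of diagonal endomorphisms of `S₂` with parameters `r`, `s` and `-r - s`. -/
def torus (r s : k) : tri k (S2 k) :=
  ⟨fun j => diag (![r, s, -r - s] j), triPart_le_tri 0 ⟨fun _ => diag_mem_osp _, fun a x _ y => by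
    simp only [mul_eq, diag_apply, zero_mul, sgn_zero, one_smul]
    ext <;> simp <;> ring⟩⟩

theorem torus_coe (r s : k) (j : Fin 3) : (torus r s).1 j = diag (![r, s, -r - s] j) := rfl

theorem torus_add (r s r' s' : k) : torus r s + torus r' s' = torus (r + r') (s + s') := by
  refine Subtype.ext (funext fun j => LinearMap.ext fun x => ?_)
  change (torus r s).1 j x + (torus r' s').1 j x = _
  fin_cases j <;> ext <;> simp [torus_coe, diag_apply] <;> ring

theorem torus_smul (c r s : k) : c • torus r s = torus (c * r) (c * s) := by
  refine Subtype.ext (funext fun j => LinearMap.ext fun x => ?_)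
  change c • (torus r s).1 j x = _
  fin_cases j <;> ext <;> simp [torus_coe, diag_apply] <;> ring

theorem pr_torus (i : ZMod 2) (r s : k) : pr k i (torus r s) = if i = 0 then torus r s else 0 := by
  refine Subtype.ext (funext fun j => LinearMap.ext fun x => ?_)
  rw [coe_pr_tri, pr_end_apply, pr_zero, pr_one, map_zero, map_zero, add_zero, proj_eq]
  split_ifs <;> rfl

theorem triBracket_torus (r s r' s' : k) : triBracket (torus r s) (torus r' s') = 0 := by
  refine Subtype.ext (funext fun j => LinearMap.ext fun x => ?_)
  change superComm (diag _) (diag _) x = 0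
  rw [superComm_of_mem (diag_mem_osp _).1 (diag_mem_osp _).1]
  ext <;> simp [diag_apply, sgn_zero] <;> ring

theorem tMap_eq [CharP k 3] (x y : S2 k) : tMap (k := k) x y =
    torus (x.m * y.p - x.p * y.m) (x.m * y.p - x.p * y.m) := by
  have h3 := three_eq_zero k
  have h2 : (2 : k)⁻¹ = -1 := by
    rw [inv_eq_iff_eq_inv, inv_neg, inv_one]
    linear_combination h3
  have hm : ∀ z : S2 k, z ∈ part k (S2 k) 0 := fun z => by simp [part_zero]
  refine Subtype.ext (funext fun j => LinearMap.ext fun z => ?_)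
  change tTriple (k := k) x y j z = _
  fin_cases j
  · change sigma (k := k) x y z = _
    rw [sigma_of_mem (hm x) (hm y) (hm z)]
    ext <;> simp [form_eq, torus_coe, diag_apply, sgn_zero] <;> ring
  · change (((2 : k)⁻¹ * bform k x y) • (1 : Module.End k (S2 k)) -
      rmul (k := k) x * lmul (k := k) y) z = _
    rw [rl_apply (hm x) (hm y) (hm z), h2]
    ext <;> simp [form_eq, mul_eq, torus_coe, diag_apply, sgn_zero] <;> grind
  · change (((2 : k)⁻¹ * bform k x y) • (1 : Module.End k (S2 k)) -
      lmul (k := k) x * rmul (k := k) y) z = _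
    rw [lr_apply (hm y) (hm z), h2]
    ext <;> simp [form_eq, mul_eq, torus_coe, diag_apply, sgn_zero] <;> grind

theorem theta_pow_torus [CharP k 3] (n : ℕ) (r : k) : (theta ^ n) (torus r r) = torus r r := by
  have h3 := three_eq_zero k
  have h : ∀ i : Fin 3, (![r, r, -r - r] : Fin 3 → k) i = r := fun i => by
    fin_cases i
    · rfl
    · rfl
    · change -r - r = r
      linear_combination -r * h3
  exact theta_pow_coe _ (fun i j => by rw [torus_coe, torus_coe, h, h]) n

/-- Every element of the triality algebra of `S₂` is diagonal. -/
theorem exists_eq_torus [CharP k 3] (d : tri k (S2 k)) : ∃ r s, d = torus r s := by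
  have two := NeZero.ne (2 : k)
  have hd : d.1 ∈ triPart k (S2 k) 0 := by
    have h := mem_tri.1 d.2 0
    have : pr k 0 d.1 = d.1 := by
      refine funext fun j => LinearMap.ext fun x => ?_
      change pr k 0 (d.1 j) x = _
      rw [pr_end_apply, pr_zero, pr_zero, pr_one, map_zero, map_zero, add_zero]
    rwa [this] at h
  have key : ∀ j, d.1 j = diag (d.1 j ⟨1, 0⟩).p := fun j => by
    have hm : ∀ z : S2 k, z ∈ part k (S2 k) 0 := fun z => by simp [part_zero]
    have h1 := (hd.1 j).2 0 _ (hm ⟨1, 0⟩) ⟨1, 0⟩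
    have h2 := (hd.1 j).2 0 _ (hm ⟨1, 0⟩) ⟨0, 1⟩
    have h3 := (hd.1 j).2 0 _ (hm ⟨0, 1⟩) ⟨0, 1⟩
    simp [form_eq, sgn_zero] at h1 h2 h3
    have h1' : (d.1 j ⟨1, 0⟩).m = 0 := by
      exact (mul_eq_zero.1 (show 2 * (d.1 j ⟨1, 0⟩).m = 0 by
        linear_combination h1)).resolve_left two
    have h3' : (d.1 j ⟨0, 1⟩).p = 0 := by
      exact (mul_eq_zero.1 (show 2 * (d.1 j ⟨0, 1⟩).p = 0 by
        linear_combination h3)).resolve_left two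
    refine LinearMap.ext fun x => ?_
    have hx : x = x.p • (⟨1, 0⟩ : S2 k) + x.m • ⟨0, 1⟩ := by ext <;> simp
    conv_lhs => rw [hx, map_add, map_smul, map_smul]
    ext
    · simp [diag_apply, h3', mul_comm]
    · simp [diag_apply, h1']
      linear_combination x.m * h2
  refine ⟨(d.1 0 ⟨1, 0⟩).p, (d.1 1 ⟨1, 0⟩).p, Subtype.ext (funext fun j => ?_)⟩
  fin_cases j
  · exact key 0
  · exact key 1
  · change d.1 2 = diag (-(d.1 0 ⟨1, 0⟩).p - (d.1 1 ⟨1, 0⟩).p)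
    rw [key 2]
    congr 1
    have h := congrArg S2.m (hd.2 0 ⟨1, 0⟩ (by simp [part_zero]) ⟨1, 0⟩)
    rw [key 0, key 1, key 2] at h
    simp [mul_eq, diag_apply, sgn_zero] at h
    linear_combination -h

theorem torus_injective {r s r' s' : k} (h : torus r s = torus r' s') : r = r' ∧ s = s' := by
  have h' : ∀ j, (torus r s).1 j ⟨1, 0⟩ = (torus r' s').1 j ⟨1, 0⟩ := fun j => by rw [h]
  exact ⟨by simpa [torus_coe, diag_apply] using h' 0, by simpa [torus_coe, diag_apply] using h' 1⟩

end S2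

namespace S12

/-- The endomorphism of `S₁,₂ = k1 ⊕ V` which is the sum of the element `(h, e; f, -h)` of
`𝔰𝔩(V)`, extended by `0` on `1`, and of the odd endomorphism `1 ↦ w`, `v ↦ ⟨w|v⟩1`, where
`w = (a, b)`. -/
def rot (h e f a b : k) : Module.End k (S12 k) where
  toFun x := ⟨a * x.v - b * x.u, h * x.u + e * x.v + x.c * a, f * x.u - h * x.v + x.c * b⟩
  map_add' _ _ := by ext <;> simp <;> ring
  map_smul' _ _ := by ext <;> simp <;> ring

theorem rot_apply (h e f a b : k) (x : S12 k) : rot h e f a b x =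
    ⟨a * x.v - b * x.u, h * x.u + e * x.v + x.c * a, f * x.u - h * x.v + x.c * b⟩ := rfl

theorem rot_mem_triPart_zero (h e f : k) : (fun _ => rot h e f 0 0) ∈ triPart k (S12 k) 0 := by
  refine ⟨fun j => ⟨mem_part_end fun a x hx => ?_, fun a x hx y => ?_⟩, fun a x hx y => ?_⟩
  · rcases of_mem_part hx with ⟨rfl, c, rfl⟩ | ⟨rfl, c, d, rfl⟩ <;>
      rw [mem_part, proj_eq] <;> ext <;> simp [rot_apply]
  · rcases of_mem_part hx with ⟨rfl, c, rfl⟩ | ⟨rfl, c, d, rfl⟩ <;>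
      simp [rot_apply, form_eq, alt, sgn]
    ring
  · rcases of_mem_part hx with ⟨rfl, c, rfl⟩ | ⟨rfl, c, d, rfl⟩ <;> ext <;>
      simp [rot_apply, mul_eq, alt, sgn] <;> ring

theorem rot_mem_triPart_one [CharP k 3] (a b : k) :
    (fun _ => rot 0 0 0 a b) ∈ triPart k (S12 k) 1 := by
  have h3 := three_eq_zero k
  have h11 : (1 : ZMod 2) + 1 = 0 := rfl
  refine ⟨fun j => ⟨mem_part_end fun a x hx => ?_, fun a x hx y => ?_⟩, fun a x hx y => ?_⟩
  · rcases of_mem_part hx with ⟨rfl, c, rfl⟩ | ⟨rfl, c, d, rfl⟩ <;>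
      rw [mem_part, proj_eq] <;> ext <;> simp [rot_apply, h11]
  · rcases of_mem_part hx with ⟨rfl, c, rfl⟩ | ⟨rfl, c, d, rfl⟩ <;>
      simp [rot_apply, form_eq, alt, sgn] <;> grind
  · rcases of_mem_part hx with ⟨rfl, c, rfl⟩ | ⟨rfl, c, d, rfl⟩ <;> ext <;>
      simp [rot_apply, mul_eq, alt, sgn] <;> grind

theorem rot_add (h e f a b h' e' f' a' b' : k) : rot h e f a b + rot h' e' f' a' b' =
    rot (h + h') (e + e') (f + f') (a + a') (b + b') := by
  refine LinearMap.ext fun x => ?_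
  ext <;> simp [rot_apply] <;> ring

/-- The triple all whose components are `rot h e f a b`. -/
def spin [CharP k 3] (h e f a b : k) : tri k (S12 k) :=
  ⟨fun _ => rot h e f a b, by
    have h1 := add_mem (triPart_le_tri 0 (rot_mem_triPart_zero h e f))
      (triPart_le_tri 1 (rot_mem_triPart_one a b))
    have h2 : (fun _ : Fin 3 => rot h e f 0 0) + (fun _ => rot 0 0 0 a b) =
        fun _ => rot h e f a b := by
      funext j
      change rot _ _ _ _ _ + rot _ _ _ _ _ = _
      rw [rot_add]
      simp
    rwa [h2] at h1⟩

variable [CharP k 3]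

theorem spin_coe (h e f a b : k) (j : Fin 3) : (spin h e f a b).1 j = rot h e f a b := rfl

theorem spin_add (h e f a b h' e' f' a' b' : k) : spin h e f a b + spin h' e' f' a' b' =
    spin (h + h') (e + e') (f + f') (a + a') (b + b') :=
  Subtype.ext (funext fun _ => rot_add _ _ _ _ _ _ _ _ _ _)

theorem spin_smul (c h e f a b : k) : c • spin h e f a b =
    spin (c * h) (c * e) (c * f) (c * a) (c * b) := by
  refine Subtype.ext (funext fun j => LinearMap.ext fun x => ?_)
  change c • (spin h e f a b).1 j x = _
  ext <;> simp [spin_coe, rot_apply] <;> ring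

theorem pr_spin (i : ZMod 2) (h e f a b : k) : pr k i (spin h e f a b) =
    if i = 0 then spin h e f 0 0 else spin 0 0 0 a b := by
  have h11 : (1 : ZMod 2) + 1 = 0 := rfl
  refine Subtype.ext (funext fun j => LinearMap.ext fun x => ?_)
  rw [coe_pr_tri, pr_end_apply]
  rcases zmod2_cases i with rfl | rfl <;> ext <;>
    simp [spin_coe, rot_apply, proj_eq, h11]

theorem triBracket_spin (h e f a b h' e' f' a' b' : k) :
    triBracket (spin h e f a b) (spin h' e' f' a' b') =
      spin (e * f' - f * e' - (a * b' + b * a')) (2 * (h * e' - e * h') + 2 * (a * a'))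
        (2 * (f * h' - h * f') - 2 * (b * b')) (h * a' + e * b' - (h' * a + e' * b))
        (f * a' - h * b' - (f' * a - h' * b)) := by
  have h0 := fun h e f => (rot_mem_triPart_zero (k := k) h e f).1 0
  have h1 := fun a b => (rot_mem_triPart_one (k := k) a b).1 0
  have hs : ∀ h e f a b : k, rot h e f a b = rot h e f 0 0 + rot 0 0 0 a b := fun _ _ _ _ _ => by
    rw [rot_add]
    simp
  refine Subtype.ext (funext fun j => LinearMap.ext fun x => ?_)
  change superComm (rot h e f a b) (rot h' e' f' a' b') x = rot _ _ _ _ _ x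
  rw [hs h e f a b, hs h' e' f' a' b']
  simp only [map_add, LinearMap.add_apply]
  rw [superComm_of_mem (h0 _ _ _).1 (h0 _ _ _).1, superComm_of_mem (h0 _ _ _).1 (h1 _ _).1,
    superComm_of_mem (h1 _ _).1 (h0 _ _ _).1, superComm_of_mem (h1 _ _).1 (h1 _ _).1]
  ext <;> simp [rot_apply, sgn] <;> ring

theorem tMap_eq (x y : S12 k) : tMap (k := k) x y =
    spin (x.u * y.v + x.v * y.u) (-2 * (x.u * y.u)) (2 * (x.v * y.v))
      (x.u * y.c - x.c * y.u) (x.v * y.c - x.c * y.v) := by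
  have h3 := three_eq_zero k
  have h11 : (1 : ZMod 2) + 1 = 0 := rfl
  have h2 : (2 : k)⁻¹ = -1 := by
    rw [inv_eq_iff_eq_inv, inv_neg, inv_one]
    linear_combination h3
  refine Subtype.ext (funext fun j => LinearMap.ext fun z => ?_)
  change tTriple (k := k) x y j z = _
  fin_cases j
  · change sigma (k := k) x y z = _
    ext <;> simp [sigma, sum_zmod_two, form_eq, proj_eq, alt, spin_coe, rot_apply, sgn, h11] <;>
      grind
  · change ((2 : k)⁻¹ * bform k x y) • z - superFlip (pmul k) x (pmul k y z) = _
    ext <;> simp [superFlip, sum_zmod_two, form_eq, mul_eq, proj_eq, alt, spin_coe, rot_apply, sgn,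
      h2] <;> grind
  · change ((2 : k)⁻¹ * bform k x y) • z - pmul k x (superFlip (pmul k) y z) = _
    ext <;> simp [superFlip, sum_zmod_two, form_eq, mul_eq, proj_eq, alt, spin_coe, rot_apply, sgn,
      h2] <;> grind

theorem theta_pow_spin (n : ℕ) (h e f a b : k) :
    (theta ^ n) (spin h e f a b) = spin h e f a b :=
  theta_pow_coe _ (fun _ _ => rfl) n

theorem spin_injective {h e f a b h' e' f' a' b' : k}
    (H : spin h e f a b = spin h' e' f' a' b') : h = h' ∧ e = e' ∧ f = f' ∧ a = a' ∧ b = b' := by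
  have H' : ∀ x, rot h e f a b x = rot h' e' f' a' b' x := fun x => by
    rw [← spin_coe _ _ _ _ _ 0, H, spin_coe]
  have h1 := H' ⟨1, 0, 0⟩
  have h2 := H' ⟨0, 1, 0⟩
  have h3 := H' ⟨0, 0, 1⟩
  simp [rot_apply] at h1 h2 h3
  exact ⟨h2.2.1, h3.2.1, h2.2.2, h1.1, h1.2⟩

/-- In characteristic `3` the three components of an element of the triality superalgebra of
`S₁,₂` agree. -/
theorem exists_eq_spin (d : tri k (S12 k)) : ∃ h e f a b, d = spin h e f a b := by
  have three := three_eq_zero k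
  have two := NeZero.ne (2 : k)
  have hx : ∀ x : S12 k, x = x.c • (⟨1, 0, 0⟩ : S12 k) + x.u • ⟨0, 1, 0⟩ + x.v • ⟨0, 0, 1⟩ :=
    fun x => by ext <;> simp
  have m0 : (⟨1, 0, 0⟩ : S12 k) ∈ part k (S12 k) 0 := rfl
  have m1 : (⟨0, 1, 0⟩ : S12 k) ∈ part k (S12 k) 1 := rfl
  have m2 : (⟨0, 0, 1⟩ : S12 k) ∈ part k (S12 k) 1 := rfl
  have key0 : ∀ d ∈ triPart k (S12 k) 0, ∃ h e f, d = fun _ => rot h e f 0 0 := by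
    intro d hd
    have key : ∀ j, ∃ h e f, d j = rot h e f 0 0 := fun j => by
      obtain ⟨c, hc⟩ := ((of_mem_part (end_apply_mem (hd.1 j).1 m0)).resolve_right (by simp)).2
      obtain ⟨h, f, hh⟩ := ((of_mem_part (end_apply_mem (hd.1 j).1 m1)).resolve_left (by simp)).2
      obtain ⟨e, g, he⟩ := ((of_mem_part (end_apply_mem (hd.1 j).1 m2)).resolve_left (by simp)).2
      have e1 := (hd.1 j).2 0 _ m0 ⟨1, 0, 0⟩
      have e2 := (hd.1 j).2 1 _ m1 ⟨0, 0, 1⟩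
      simp [hc, hh, he, form_eq, alt, sgn] at e1 e2
      refine ⟨h, e, f, LinearMap.ext fun x => ?_⟩
      conv_lhs => rw [hx x, map_add, map_add, map_smul, map_smul, map_smul, hc, hh, he]
      ext <;> simp [rot_apply] <;> grind
    choose h e f H using key
    refine ⟨h 0, e 0, f 0, funext fun j => ?_⟩
    have e1 := hd.2 0 _ m0 ⟨0, 1, 0⟩
    have e2 := hd.2 0 _ m0 ⟨0, 0, 1⟩
    have e3 := hd.2 1 _ m1 ⟨1, 0, 0⟩
    have e4 := hd.2 1 _ m2 ⟨1, 0, 0⟩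
    rw [H 0, H 1, H 2] at e1 e2 e3 e4
    simp [S12.ext_iff, mul_eq, rot_apply, alt, sgn] at e1 e2 e3 e4
    rw [H]
    fin_cases j
    · rfl
    · simp [e3, e4]
    · simp [e1, e2]
  have key1 : ∀ d ∈ triPart k (S12 k) 1, ∃ a b, d = fun _ => rot 0 0 0 a b := by
    intro d hd
    have key : ∀ j, ∃ a b, d j = rot 0 0 0 a b := fun j => by
      obtain ⟨a, b, hc⟩ :=
        ((of_mem_part (end_apply_mem (hd.1 j).1 m0)).resolve_left (by simp)).2
      obtain ⟨c, hh⟩ := ((of_mem_part (end_apply_mem (hd.1 j).1 m1)).resolve_right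
        fun h => absurd h.1 (by decide)).2
      obtain ⟨d', he⟩ := ((of_mem_part (end_apply_mem (hd.1 j).1 m2)).resolve_right
        fun h => absurd h.1 (by decide)).2
      have e1 := (hd.1 j).2 0 _ m0 ⟨0, 1, 0⟩
      have e2 := (hd.1 j).2 0 _ m0 ⟨0, 0, 1⟩
      simp [hc, hh, he, form_eq, alt, sgn] at e1 e2
      refine ⟨a, b, LinearMap.ext fun x => ?_⟩
      conv_lhs => rw [hx x, map_add, map_add, map_smul, map_smul, map_smul, hc, hh, he]
      ext <;> simp [rot_apply]
      grind
    choose a b H using key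
    refine ⟨a 0, b 0, funext fun j => ?_⟩
    have e1 := hd.2 0 _ m0 ⟨1, 0, 0⟩
    have e2 := hd.2 1 _ m1 ⟨0, 1, 0⟩
    have e3 := hd.2 1 _ m2 ⟨0, 0, 1⟩
    rw [H 0, H 1, H 2] at e1 e2 e3
    simp [S12.ext_iff, mul_eq, rot_apply, alt, sgn] at e1 e2 e3
    rw [H]
    fin_cases j
    · rfl
    · change rot _ _ _ (a 1) (b 1) = rot _ _ _ _ _
      congr 1 <;> grind
    · change rot _ _ _ (a 2) (b 2) = rot _ _ _ _ _
      congr 1 <;> grind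
  obtain ⟨h, e, f, H0⟩ := key0 _ (mem_tri.1 d.2 0)
  obtain ⟨a, b, H1⟩ := key1 _ (mem_tri.1 d.2 1)
  refine ⟨h, e, f, a, b, Subtype.ext ?_⟩
  rw [← SuperSpace.proj_add (k := k) d.1]
  change pr k 0 d.1 + pr k 1 d.1 = _
  rw [H0, H1]
  funext j
  change rot _ _ _ _ _ + rot _ _ _ _ _ = rot _ _ _ _ _
  rw [rot_add]
  simp

end S12

end Triality

section MagicCoordinates

variable {k : Type u} [Field k]

/-- The element `e⁺ ⊗ z + e⁻ ⊗ w` of `S₂ ⊗ W`, for the standard basis `e⁺`, `e⁻` of `S₂`. -/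
def ten {W : Type w} [AddCommGroup W] [Module k W] (z w : W) : S2 k ⊗[k] W :=
  (⟨1, 0⟩ : S2 k) ⊗ₜ z + (⟨0, 1⟩ : S2 k) ⊗ₜ w

section Ten

variable {W : Type w} [AddCommGroup W] [Module k W]

theorem ten_add (z w z' w' : W) : ten (k := k) z w + ten z' w' = ten (z + z') (w + w') := by
  simp only [ten, TensorProduct.tmul_add]
  abel

theorem ten_smul (c : k) (z w : W) : c • ten (k := k) z w = ten (c • z) (c • w) := by
  simp only [ten, TensorProduct.tmul_smul, smul_add]

theorem tmul_eq_ten (x : S2 k) (z : W) : x ⊗ₜ[k] z = ten (x.p • z) (x.m • z) := by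
  rw [ten, ← TensorProduct.smul_tmul, ← TensorProduct.smul_tmul, ← TensorProduct.add_tmul]
  congr 1
  ext <;> simp

theorem exists_eq_ten (t : S2 k ⊗[k] W) : ∃ z w, t = ten z w := by
  induction t using TensorProduct.induction_on with
  | zero => exact ⟨0, 0, by simp [ten]⟩
  | tmul x z => exact ⟨_, _, tmul_eq_ten x z⟩
  | add s t hs ht =>
    obtain ⟨z, w, rfl⟩ := hs
    obtain ⟨z', w', rfl⟩ := ht
    exact ⟨_, _, ten_add _ _ _ _⟩

theorem ten_injective {z w z' w' : W} (h : ten (k := k) z w = ten z' w') : z = z' ∧ w = w' := by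
  let P : S2 k →ₗ[k] W →ₗ[k] W := LinearMap.mk₂ k (fun x z => x.p • z)
    (fun _ _ _ => by simp [add_smul]) (fun _ _ _ => by simp [mul_smul])
    (fun _ _ _ => by simp) (fun _ _ _ => smul_comm _ _ _)
  let M : S2 k →ₗ[k] W →ₗ[k] W := LinearMap.mk₂ k (fun x z => x.m • z)
    (fun _ _ _ => by simp [add_smul]) (fun _ _ _ => by simp [mul_smul])
    (fun _ _ _ => by simp) (fun _ _ _ => smul_comm _ _ _)
  have h1 := congrArg (TensorProduct.lift P) h
  have h2 := congrArg (TensorProduct.lift M) h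
  simp [ten, P, M] at h1 h2
  exact ⟨h1, h2⟩

theorem pr_ten [SuperSpace k W] (i : ZMod 2) (z w : W) :
    pr k i (ten (k := k) z w) = ten (pr k i z) (pr k i w) := by
  rw [ten, map_add, pr_tmul, pr_tmul, S2.pr_zero, S2.pr_zero, S2.pr_one, S2.pr_one,
    TensorProduct.zero_tmul, TensorProduct.zero_tmul, add_zero, add_zero, ten]

end Ten

theorem signedMap_tmul {M N : Type*} [AddCommGroup M] [Module k M] [AddCommGroup N] [Module k N]
    {W : Type w} [AddCommGroup W] [Module k W] [FormProduct k W]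
    (ε : ZMod 2 → ZMod 2 → ZMod 2 → ZMod 2 → ZMod 2) (hε : ∀ a b, ε 0 a 0 b = 0)
    (f : S2 k →ₗ[k] S2 k →ₗ[k] M) (g : W →ₗ[k] W →ₗ[k] N) (x y : S2 k) (z w : W) :
    signedMap ε f g (x ⊗ₜ z) (y ⊗ₜ w) = f x y ⊗ₜ g z w := by
  conv_rhs => rw [← SuperSpace.proj_add (k := k) z, ← SuperSpace.proj_add (k := k) w]
  simp only [signedMap, sum_zmod_two, LinearMap.add_apply, LinearMap.smul_apply,
    TensorProduct.map₂_apply_tmul, TensorProduct.map_tmul, LinearMap.compl₁₂_apply, S2.pr_zero,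
    S2.pr_one, hε, map_zero,
    LinearMap.zero_apply, TensorProduct.zero_tmul, smul_zero, sgn_zero, one_smul, map_add,
    TensorProduct.tmul_add, add_zero]
  abel

theorem iotaMul_ten {W : Type w} [AddCommGroup W] [Module k W] [FormProduct k W] (z w z' w' : W) :
    iotaMul (ten (k := k) z w) (ten z' w') = ten (pmul k w w') (pmul k z z') := by
  have h : ∀ (x y : S2 k) (z w : W), iotaMul (x ⊗ₜ[k] z) (y ⊗ₜ w) = pmul k x y ⊗ₜ pmul k z w :=
    signedMap_tmul _ (fun _ _ => mul_zero _) _ _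
  simp only [ten, map_add, LinearMap.add_apply, h, S2.mul_eq, mul_one, mul_zero]
  have h0 : (⟨0, 0⟩ : S2 k) = 0 := rfl
  simp only [h0, TensorProduct.zero_tmul]
  abel

theorem actLeft_ten {W : Type w} [AddCommGroup W] [Module k W] (c : k) (z w : W) :
    actLeft (S2.diag c) (ten (k := k) z w) = ten (c • z) (-(c • w)) := by
  have h : ∀ (x : S2 k) (z : W), actLeft (S2.diag c) (x ⊗ₜ[k] z) = S2.diag c x ⊗ₜ z :=
    fun _ _ => rfl
  rw [ten, map_add, h, h, S2.diag_apply, S2.diag_apply, tmul_eq_ten, tmul_eq_ten, ten_add]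
  congr 1 <;> simp

theorem actRight_ten {W : Type w} [AddCommGroup W] [Module k W] [FormProduct k W]
    (d : Module.End k W) (z w : W) : actRight d (ten (k := k) z w) = ten (d z) (d w) := by
  have h : ∀ (x : S2 k) (z : W), actRight d (x ⊗ₜ[k] z) = x ⊗ₜ d z := fun x z => by
    conv_rhs => rw [← SuperSpace.proj_add (k := k) d]
    simp [actRight, sum_zmod_two, S2.pr_zero, S2.pr_one, sgn_zero, TensorProduct.tmul_add]
  rw [ten, map_add, h, h, ten]

theorem magicHalf_apply {S : Type v} [AddCommGroup S] [Module k S] [FormProduct k S]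
    {S' : Type w} [AddCommGroup S'] [Module k S'] [FormProduct k S'] (X Y : Magic k S S') :
    magicHalf X Y = (0, 0, fun j => actLeft (X.1.1 j) (Y.2.2 j) + actRight (X.2.1.1 j) (Y.2.2 j) +
      iotaMul (X.2.2 (j + 1)) (Y.2.2 (j + 2))) := rfl

variable [CharP k 3]

theorem iotaTri_apply {S : Type v} [AddCommGroup S] [Module k S] [FormProduct k S]
    {S' : Type w} [AddCommGroup S'] [Module k S'] [FormProduct k S']
    [IsSymmetricComposition k S] (X Y : S ⊗[k] S') :
    iotaTri X Y = TensorProduct.rid k (tri k S) (signedMap (S := S) (S' := S')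
      (fun a a' b b' => a * a' + a * b' + b * b') tMap (bform k) X Y) := rfl

theorem iotaTri'_apply {S : Type v} [AddCommGroup S] [Module k S] [FormProduct k S]
    {S' : Type w} [AddCommGroup S'] [Module k S'] [FormProduct k S']
    [IsSymmetricComposition k S'] (X Y : S ⊗[k] S') :
    iotaTri' X Y = TensorProduct.lid k (tri k S') (signedMap (S := S) (S' := S')
      (fun _ a' b _ => b * a') (bform k) tMap X Y) := rfl

theorem iotaTri_ten (z w z' w' : S12 k) : iotaTri (ten (k := k) z w) (ten z' w') =
    S2.torus (bform k w z' - bform k z w') (bform k w z' - bform k z w') := by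
  have h : ∀ (x y : S2 k) (z w : S12 k), iotaTri (x ⊗ₜ[k] z) (y ⊗ₜ w) =
      bform k z w • tMap (k := k) x y := fun x y z w => by
    rw [iotaTri_apply, signedMap_tmul _ (fun _ _ => by simp), TensorProduct.rid_tmul]
  simp only [ten, map_add, LinearMap.add_apply, h, S2.tMap_eq, S2.torus_smul, S2.torus_add]
  congr 1 <;> ring

theorem iotaTri'_ten (z w z' w' : S12 k) : iotaTri' (ten (k := k) z w) (ten z' w') =
    tMap (k := k) z w' + tMap (k := k) w z' := by
  have h : ∀ (x y : S2 k) (z w : S12 k), iotaTri' (x ⊗ₜ[k] z) (y ⊗ₜ w) =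
      bform k x y • tMap (k := k) z w := fun x y z w => by
    rw [iotaTri'_apply, signedMap_tmul _ (fun _ _ => by simp), TensorProduct.lid_tmul]
  simp [ten, h, S2.form_eq]

/-- The element of `g(S₂, S₁,₂)` with the given coordinates. -/
def magicMk (r s h e f a b : k) (z w : Fin 3 → S12 k) : Magic k (S2 k) (S12 k) :=
  (S2.torus r s, S12.spin h e f a b, fun j => ten (z j) (w j))

theorem exists_eq_magicMk (X : Magic k (S2 k) (S12 k)) :
    ∃ r s h e f a b z w, X = magicMk r s h e f a b z w := by
  obtain ⟨X₁, X₂, X₃⟩ := X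
  obtain ⟨r, s, rfl⟩ := S2.exists_eq_torus X₁
  obtain ⟨h, e, f, a, b, rfl⟩ := S12.exists_eq_spin X₂
  choose z w H using fun j => exists_eq_ten (X₃ j)
  exact ⟨r, s, h, e, f, a, b, z, w, by rw [magicMk, ← funext H]⟩

theorem magicMk_add (r s h e f a b r' s' h' e' f' a' b' : k) (z w z' w' : Fin 3 → S12 k) :
    magicMk r s h e f a b z w + magicMk r' s' h' e' f' a' b' z' w' =
      magicMk (r + r') (s + s') (h + h') (e + e') (f + f') (a + a') (b + b') (z + z') (w + w') := by
  refine Prod.ext ?_ (Prod.ext ?_ (funext fun j => ?_))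
  · exact S2.torus_add _ _ _ _
  · exact S12.spin_add _ _ _ _ _ _ _ _ _ _
  · exact ten_add _ _ _ _

theorem magicMk_smul (c r s h e f a b : k) (z w : Fin 3 → S12 k) :
    c • magicMk r s h e f a b z w =
      magicMk (c * r) (c * s) (c * h) (c * e) (c * f) (c * a) (c * b) (c • z) (c • w) := by
  refine Prod.ext ?_ (Prod.ext ?_ (funext fun j => ?_))
  · exact S2.torus_smul _ _ _
  · exact S12.spin_smul _ _ _ _ _ _
  · exact ten_smul _ _ _

theorem pr_magicMk (i : ZMod 2) (r s h e f a b : k) (z w : Fin 3 → S12 k) :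
    pr k i (magicMk r s h e f a b z w) =
      if i = 0 then magicMk r s h e f 0 0 (fun j => pr k 0 (z j)) (fun j => pr k 0 (w j))
      else magicMk 0 0 0 0 0 a b (fun j => pr k 1 (z j)) (fun j => pr k 1 (w j)) := by
  have h0 : S2.torus (0 : k) 0 = 0 := by
    simpa using (S2.torus_smul (0 : k) 0 0).symm
  have h1 : pr k i (magicMk r s h e f a b z w) = (pr k i (S2.torus r s),
      pr k i (S12.spin h e f a b), fun j => pr k i (ten (z j) (w j))) := rfl
  rw [h1, S2.pr_torus, S12.pr_spin]
  simp only [pr_ten]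
  rcases zmod2_cases i with rfl | rfl
  · rfl
  · simp [magicMk, h0]

/-- The part of the product of `g(S₂, S₁,₂)` given by the action on `S₂ ⊗ S₁,₂` and by the products
between different copies of it. -/
theorem magicHalf_magicMk (r s h e f a b r' s' h' e' f' a' b' : k) (z w z' w' : Fin 3 → S12 k) :
    magicHalf (magicMk r s h e f a b z w) (magicMk r' s' h' e' f' a' b' z' w') =
      magicMk 0 0 0 0 0 0 0
        (fun j => (![r, s, -r - s] : Fin 3 → k) j • z' j + S12.rot h e f a b (z' j) +
          pmul k (w (j + 1)) (w' (j + 2)))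
        (fun j => -((![r, s, -r - s] : Fin 3 → k) j • w' j) + S12.rot h e f a b (w' j) +
          pmul k (z (j + 1)) (z' (j + 2))) := by
  have h0 : S2.torus (0 : k) 0 = 0 := by
    simpa using (S2.torus_smul (0 : k) 0 0).symm
  have h1 : S12.spin (0 : k) 0 0 0 0 = 0 := by
    simpa using (S12.spin_smul (0 : k) 0 0 0 0 0).symm
  rw [magicHalf_apply]
  refine Prod.ext h0.symm (Prod.ext h1.symm (funext fun j => ?_))
  dsimp only [magicMk]
  rw [S2.torus_coe, S12.spin_coe, actLeft_ten, actRight_ten, iotaMul_ten, ten_add, ten_add]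

theorem magicDiag_apply {S : Type v} [AddCommGroup S] [Module k S] [FormProduct k S]
    {S' : Type w} [AddCommGroup S'] [Module k S'] [FormProduct k S']
    [IsSymmetricComposition k S] [IsSymmetricComposition k S'] (X Y : Magic k S S') :
    magicDiag X Y =
      (triBracket X.1 Y.1 + ∑ i : Fin 3, (theta ^ (i : ℕ)) (iotaTri (X.2.2 i) (Y.2.2 i)),
      triBracket X.2.1 Y.2.1 + ∑ i : Fin 3, (theta ^ (i : ℕ)) (iotaTri' (X.2.2 i) (Y.2.2 i)),
      0) := rfl

theorem magicDiag_magicMk (r s h e f a b r' s' h' e' f' a' b' : k) (z w z' w' : Fin 3 → S12 k) :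
    magicDiag (magicMk r s h e f a b z w) (magicMk r' s' h' e' f' a' b' z' w') =
      magicMk (∑ j, (bform k (w j) (z' j) - bform k (z j) (w' j)))
        (∑ j, (bform k (w j) (z' j) - bform k (z j) (w' j)))
        (e * f' - f * e' - (a * b' + b * a') + ∑ j, ((z j).u * (w' j).v + (z j).v * (w' j).u +
          ((w j).u * (z' j).v + (w j).v * (z' j).u)))
        (2 * (h * e' - e * h') + 2 * (a * a') +
          ∑ j, (-2 * ((z j).u * (w' j).u) + -2 * ((w j).u * (z' j).u)))
        (2 * (f * h' - h * f') - 2 * (b * b') +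
          ∑ j, (2 * ((z j).v * (w' j).v) + 2 * ((w j).v * (z' j).v)))
        (h * a' + e * b' - (h' * a + e' * b) + ∑ j, ((z j).u * (w' j).c - (z j).c * (w' j).u +
          ((w j).u * (z' j).c - (w j).c * (z' j).u)))
        (f * a' - h * b' - (f' * a - h' * b) + ∑ j, ((z j).v * (w' j).c - (z j).c * (w' j).v +
          ((w j).v * (z' j).c - (w j).c * (z' j).v))) 0 0 := by
  have h0 : ten (k := k) (0 : S12 k) 0 = 0 := by simp [ten]
  rw [magicDiag_apply]
  simp only [magicMk, iotaTri_ten, iotaTri'_ten, S2.theta_pow_torus, S2.triBracket_torus, zero_add,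
    map_add, S12.tMap_eq, S12.theta_pow_spin, S12.triBracket_spin, Pi.zero_apply, h0]
  simp only [Fin.sum_univ_three, S2.torus_add, S12.spin_add]
  rfl

/-- The product `[x, y]`, as a function of two elements. For a concrete superalgebra it is applied
through the same instances as in the general lemmas. -/
abbrev prod (k : Type u) [Field k] {L : Type v} [AddCommGroup L] [Module k L] [SuperProduct k L]
    (x y : L) : L := pmul k x y

/-- The product of homogeneous elements of `g(S, S')`. -/
theorem pmul_magic {S : Type v} [AddCommGroup S] [Module k S] [FormProduct k S]
    {S' : Type w} [AddCommGroup S'] [Module k S'] [FormProduct k S']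
    [IsSymmetricComposition k S] [IsSymmetricComposition k S'] (X Y : Magic k S S') {i j : ZMod 2}
    (hX : X ∈ part k _ i) (hY : Y ∈ part k _ j) : prod k X Y =
      magicDiag X Y + magicHalf X Y + (-sgn k (i * j)) • magicHalf Y X := by
  change magicDiag X Y + magicHalf X Y + (-1 : k) • superFlip magicHalf X Y = _
  rw [superFlip_of_mem _ hX hY]
  module

end MagicCoordinates

/-- Linear maps between additive groups. For concrete spaces this fixes the underlying additive
monoids to be those of the groups, in the form in which general lemmas on superalgebras use them. -/
abbrev GroupLin (k : Type u) [Field k] (L : Type v) (M : Type w) [AddCommGroup L] [Module k L]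
    [AddCommGroup M] [Module k M] : Type (max v w) := L →ₗ[k] M

namespace PGL3

variable {k : Type u} [Field k] [CharP k 3]

variable (k) in
/-- The isomorphism from the double of `psl₃ ⊂ pgl₃` to `g(S₂, S₁,₂)`. The diagonal of `pgl₃` is
mapped to `tri(S₂)`, the subalgebra `𝔰𝔩₂` and the diagonal of `psl₃ ⊗ V` to `tri(S₁,₂)`, and the
entries off the diagonal to the three copies of `S₂ ⊗ S₁,₂`. -/
def toMagic : GroupLin k (Double (form k)) (Magic k (S2 k) (S12 k)) where
  toFun x := magicMk (dif 0 x.g) (dif 1 x.g) x.h x.e x.f (-dif 0 (x.p : PGL k 3))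
    (-dif 0 (x.q : PGL k 3)) (fun j => ⟨-up j x.g, up j (x.p : PGL k 3), up j (x.q : PGL k 3)⟩)
    (fun j => ⟨dn j x.g, dn j (x.p : PGL k 3), dn j (x.q : PGL k 3)⟩)
  map_add' x y := by
    rw [magicMk_add]
    congr 1
    any_goals (simp; done)
    any_goals (simp; ring1)
    · funext j
      ext <;> simp
      ring
    · funext j
      ext <;> simp
  map_smul' c x := by
    rw [RingHom.id_apply, magicMk_smul]
    congr 1
    any_goals (simp; done)
    · funext j
      ext <;> simp
    · funext j
      ext <;> simp

theorem toMagic_apply (x : Double (form k)) : toMagic k x =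
    magicMk (dif 0 x.g) (dif 1 x.g) x.h x.e x.f (-dif 0 (x.p : PGL k 3))
      (-dif 0 (x.q : PGL k 3)) (fun j => ⟨-up j x.g, up j (x.p : PGL k 3), up j (x.q : PGL k 3)⟩)
      (fun j => ⟨dn j x.g, dn j (x.p : PGL k 3), dn j (x.q : PGL k 3)⟩) := rfl

theorem toMagic_pr (i : ZMod 2) (x : Double (form k)) :
    toMagic k (pr k i x) = pr k i (toMagic k x) := by
  rw [toMagic_apply x, pr_magicMk]
  rcases zmod2_cases i with rfl | rfl
  · rw [Double.pr_zero, toMagic_apply, if_pos rfl]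
    congr 1 <;> simp
  · rw [Double.pr_one, toMagic_apply, if_neg (by decide)]
    congr 1 <;> simp [S12.proj_eq]

theorem toMagic_mem {i : ZMod 2} {x : Double (form k)} (hx : x ∈ part k _ i) :
    toMagic k x ∈ part k _ i := by
  rw [mem_part] at hx ⊢
  rw [← toMagic_pr, hx]

theorem toMagic_injective : Function.Injective (toMagic k) := by
  intro x y h
  rw [toMagic_apply, toMagic_apply, magicMk, magicMk] at h
  obtain ⟨h1, h2⟩ := S2.torus_injective (congrArg Prod.fst h)
  obtain ⟨h3, h4, h5, h6, h7⟩ := S12.spin_injective (congrArg (fun X => X.2.1) h)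
  have h8 := fun j => ten_injective (congrFun (congrArg (fun X => X.2.2) h) j)
  simp only [S12.mk.injEq, neg_inj] at h6 h7 h8
  ext1
  · exact ext h1 h2 (fun j => (h8 j).1.1) fun j => (h8 j).2.1
  · exact h3
  · exact h4
  · exact h5
  · exact Subtype.ext (ext h6 (by rw [dif_eq x.p.2, dif_eq y.p.2, h6])
      (fun j => (h8 j).1.2.1) fun j => (h8 j).2.2.1)
  · exact Subtype.ext (ext h7 (by rw [dif_eq x.q.2, dif_eq y.q.2, h7])
      (fun j => (h8 j).1.2.2) fun j => (h8 j).2.2.2)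

theorem toMagic_surjective : Function.Surjective (toMagic k) := by
  intro X
  obtain ⟨r, s, h, e, f, a, b, z, w, rfl⟩ := exists_eq_magicMk X
  obtain ⟨g, g0, g1, gu, gd⟩ := exists_coord r s (fun j => -(z j).c) fun j => (w j).c
  obtain ⟨p, p0, pu, pd⟩ := exists_coord_PSL (-a) (fun j => (z j).u) fun j => (w j).u
  obtain ⟨q, q0, qu, qd⟩ := exists_coord_PSL (-b) (fun j => (z j).v) fun j => (w j).v
  refine ⟨⟨g, h, e, f, p, q⟩, ?_⟩
  rw [toMagic_apply]
  simp only [g0, g1, gu, gd, p0, pu, pd, q0, qu, qd, neg_neg]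

end PGL3

theorem IsSuperHom.of_homogeneous {k : Type u} [Field k] {L : Type v} [AddCommGroup L] [Module k L]
    [SuperProduct k L] {M : Type w} [AddCommGroup M] [Module k M] [SuperProduct k M]
    {f : L →ₗ[k] M} (hf : ∀ i x, f (pr k i x) = pr k i (f x))
    (h : ∀ i j, ∀ x ∈ part k L i, ∀ y ∈ part k L j, f (pmul k x y) = pmul k (f x) (f y)) :
    IsSuperHom f where
  map_pr := hf
  map_mul x y := by
    refine hom_induction (k := k) (P := fun x => f (pmul k x y) = pmul k (f x) (f y))
      (fun i x hx => ?_) (fun x x' h h' => ?_) x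
    · refine hom_induction (k := k) (P := fun y => f (pmul k x y) = pmul k (f x) (f y))
        (fun j y hy => h i j x hx y hy) (fun y y' h h' => ?_) y
      simp only [map_add, h, h']
    · simp only [map_add, LinearMap.add_apply, h, h']

namespace PGL3

variable {k : Type u} [Field k] [CharP k 3]

set_option maxHeartbeats 1000000 in
theorem toMagic_mul_of_mem {i j : ZMod 2} {x y : Double (form k)} (hx : x ∈ part k _ i)
    (hy : y ∈ part k _ j) : toMagic k (pmul k x y) = prod k (toMagic k x) (toMagic k y) := by
  have h3 := three_eq_zero k
  rw [pmul_magic _ _ (toMagic_mem hx) (toMagic_mem hy), toMagic_apply x, toMagic_apply y,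
    magicDiag_magicMk, magicHalf_magicMk, magicHalf_magicMk,
    magicMk_smul, magicMk_add, magicMk_add, toMagic_apply]
  have hxp := dif_eq x.p.2
  have hxq := dif_eq x.q.2
  have hyp := dif_eq y.p.2
  have hyq := dif_eq y.q.2
  have hx2 := dif_two x.g
  have hy2 := dif_two y.g
  have e : ∀ j : Fin 3, (![dif 0 x.g, dif 1 x.g, -dif 0 x.g - dif 1 x.g] : Fin 3 → k) j =
      dif j x.g := fun j => by
    fin_cases j
    · rfl
    · rfl
    · exact hx2.symm
  have e' : ∀ j : Fin 3, (![dif 0 y.g, dif 1 y.g, -dif 0 y.g - dif 1 y.g] : Fin 3 → k) j =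
      dif j y.g := fun j => by
    fin_cases j
    · rfl
    · rfl
    · exact hy2.symm
  simp only [e, e']
  congr 1
  · simp only [Double.mul_g, map_add, LieSubmodule.coe_sub, LieSubmodule.coe_bracket, map_sub,
      dif_lie, S12.form_eq, S12.alt, Fin.sum_univ_three]
    grind
  · simp only [Double.mul_g, map_add, LieSubmodule.coe_sub, LieSubmodule.coe_bracket, map_sub,
      dif_lie, S12.form_eq, S12.alt, Fin.sum_univ_three]
    grind
  · simp only [Double.mul_h, form_apply, Fin.sum_univ_three]
    grind
  · simp only [Double.mul_e, form_apply, Fin.sum_univ_three]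
    grind
  · simp only [Double.mul_f, form_apply, Fin.sum_univ_three]
    grind
  · simp only [Double.mul_p, LieSubmodule.coe_sub, LieSubmodule.coe_add, LieSubmodule.coe_smul,
      LieSubmodule.coe_bracket, map_sub, map_add, map_smul, smul_eq_mul, dif_lie,
      Fin.sum_univ_three]
    grind
  · simp only [Double.mul_q, LieSubmodule.coe_sub, LieSubmodule.coe_add, LieSubmodule.coe_smul,
      LieSubmodule.coe_bracket, map_sub, map_add, map_smul, smul_eq_mul, dif_lie,
      Fin.sum_univ_three]
    grind
  all_goals
    funext l
    clear e e' hxp hxq hyp hyq hx2 hy2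
    have hl := fun a : PSL k 3 => dif_eq a.2 l
    rcases zmod2_cases i with rfl | rfl <;> rcases zmod2_cases j with rfl | rfl
    · obtain ⟨g, h, e, f, rfl⟩ := Double.exists_of_mem_zero hx
      obtain ⟨g', h', e', f', rfl⟩ := Double.exists_of_mem_zero hy
      ext <;> simp [up_lie, dn_lie, S12.rot_apply, S12.mul_eq, S12.alt, sgn]
      grind
    · obtain ⟨g, h, e, f, rfl⟩ := Double.exists_of_mem_zero hx
      obtain ⟨p', q', rfl⟩ := Double.exists_of_mem_one hy
      ext <;> simp [hl, up_lie, dn_lie, S12.rot_apply, S12.mul_eq, S12.alt, sgn] <;> grind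
    · obtain ⟨p, q, rfl⟩ := Double.exists_of_mem_one hx
      obtain ⟨g', h', e', f', rfl⟩ := Double.exists_of_mem_zero hy
      ext <;> simp [hl, up_lie, dn_lie, S12.rot_apply, S12.mul_eq, S12.alt, sgn] <;> grind
    · obtain ⟨p, q, rfl⟩ := Double.exists_of_mem_one hx
      obtain ⟨p', q', rfl⟩ := Double.exists_of_mem_one hy
      ext <;> simp [hl, up_lie, dn_lie, S12.rot_apply, S12.mul_eq, S12.alt, sgn]
      grind

theorem isSuperHom_toMagic : IsSuperHom (toMagic k) :=
  IsSuperHom.of_homogeneous toMagic_pr fun i j x hx y hy => by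
    have h := toMagic_mul_of_mem hx hy
    -- The values of `toMagic` are replaced by variables since otherwise the comparison of the two
    -- sides unfolds the product of `g(S₂, S₁,₂)`.
    generalize toMagic k x = a at h ⊢
    generalize toMagic k y = b at h ⊢
    generalize toMagic k (pmul k x y) = c at h ⊢
    exact h

variable (k) in
/-- The superalgebra `g(S₂, S₁,₂)` is isomorphic to the double of `psl₃ ⊂ pgl₃`. -/
def magicIso : SuperIso k (Double (form k)) (Magic k (S2 k) (S12 k)) :=
  SuperIso.ofBijective (toMagic k) isSuperHom_toMagic ⟨toMagic_injective, toMagic_surjective⟩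

end PGL3

/-! ### A `ℤ`-grading of the double of `psl₃ ⊂ pgl₃` -/

/-- A family of subspaces is independent if the linear forms that vanish on all of its members but
one have no common zero. -/
theorem iSupIndep_of_separating {k : Type u} [Field k] {L : Type v} [AddCommGroup L] [Module k L]
    {ι : Type*} (gr : ι → Submodule k L)
    (h : ∀ x, (∀ (φ : L →ₗ[k] k) (d : ι), (∀ m, m ≠ d → ∀ y ∈ gr m, φ y = 0) → φ x = 0) → x = 0) :
    iSupIndep gr := by
  rw [iSupIndep_def]
  intro m
  rw [Submodule.disjoint_def]
  refine fun x hx hx' => h x fun φ d hφ => ?_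
  by_cases hd : m = d
  · subst hd
    have : (⨆ j, ⨆ (_ : j ≠ m), gr j) ≤ LinearMap.ker φ := iSup₂_le hφ
    exact this hx'
  · exact hφ m hd x hx

namespace PGL3

variable {k : Type u} [Field k]

/-- The `ℤ`-degree of the entry `(j + 1, j + 2)` of a matrix, for the grading that gives degree
`j - i` to the entry `(i, j)`. -/
def du : Fin 3 → ℤ := ![1, -2, 1]

theorem du_add (j : Fin 3) : du (j + 1) + du (j + 2) = -du j := by
  fin_cases j <;> rfl

variable (k) in
/-- The homogeneous component of degree `m` of `pgl₃`. -/
def deg (m : ℤ) : Submodule k (PGL k 3) where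
  carrier := {x | (m ≠ 0 → ∀ j, dif j x = 0) ∧ (∀ j, m ≠ du j → up j x = 0) ∧
    ∀ j, m ≠ -du j → dn j x = 0}
  add_mem' := by
    rintro x y ⟨h1, h2, h3⟩ ⟨h1', h2', h3'⟩
    refine ⟨fun h j => ?_, fun j h => ?_, fun j h => ?_⟩
    · rw [map_add, h1 h, h1' h, add_zero]
    · rw [map_add, h2 j h, h2' j h, add_zero]
    · rw [map_add, h3 j h, h3' j h, add_zero]
  zero_mem' := by simp
  smul_mem' := by
    rintro c x ⟨h1, h2, h3⟩
    refine ⟨fun h j => ?_, fun j h => ?_, fun j h => ?_⟩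
    · rw [map_smul, h1 h, smul_zero]
    · rw [map_smul, h2 j h, smul_zero]
    · rw [map_smul, h3 j h, smul_zero]

theorem lie_mem_deg [CharP k 3] {m m' : ℤ} {x y : PGL k 3} (hx : x ∈ deg k m)
    (hy : y ∈ deg k m') : ⁅x, y⁆ ∈ deg k (m + m') := by
  obtain ⟨x1, x2, x3⟩ := hx
  obtain ⟨y1, y2, y3⟩ := hy
  have key : ∀ {P Q : Prop} {a b : k}, (P ∨ Q) → (P → a = 0) → (Q → b = 0) → a * b = 0 := by
    rintro P Q a b (h | h) ha hb
    · rw [ha h, zero_mul]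
    · rw [hb h, mul_zero]
  refine ⟨fun h j => ?_, fun j h => ?_, fun j h => ?_⟩
  · rw [dif_lie, Finset.sum_eq_zero, neg_zero]
    intro i _
    have h1 : up i x * dn i y = 0 := key (by omega) (x2 i) (y3 i)
    have h2 : up i y * dn i x = 0 := key (by omega) (y2 i) (x3 i)
    rw [h1, h2, sub_zero]
  · have hj := du_add j
    have h1 : dif j x * up j y = 0 := key (by omega) (fun h => x1 h j) (y2 j)
    have h2 : dif j y * up j x = 0 := key (by omega) (fun h => y1 h j) (x2 j)
    have h3 : dn (j + 2) x * dn (j + 1) y = 0 := key (by omega) (x3 (j + 2)) (y3 (j + 1))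
    have h4 : dn (j + 2) y * dn (j + 1) x = 0 := key (by omega) (y3 (j + 2)) (x3 (j + 1))
    rw [up_lie, h1, h2, h3, h4]
    ring
  · have hj := du_add j
    have h1 : dif j y * dn j x = 0 := key (by omega) (fun h => y1 h j) (x3 j)
    have h2 : dif j x * dn j y = 0 := key (by omega) (fun h => x1 h j) (y3 j)
    have h3 : up (j + 1) x * up (j + 2) y = 0 := key (by omega) (x2 (j + 1)) (y2 (j + 2))
    have h4 : up (j + 1) y * up (j + 2) x = 0 := key (by omega) (y2 (j + 1)) (x2 (j + 2))
    rw [dn_lie, h1, h2, h3, h4]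
    ring

theorem form_eq_zero_of_mem_deg [CharP k 3] {m m' : ℤ} {a b : PSL k 3}
    (ha : (a : PGL k 3) ∈ deg k m) (hb : (b : PGL k 3) ∈ deg k m') (h : m + m' ≠ 0) :
    form k a b = 0 := by
  obtain ⟨x1, x2, x3⟩ := ha
  obtain ⟨y1, y2, y3⟩ := hb
  have key : ∀ {P Q : Prop} {a b : k}, (P ∨ Q) → (P → a = 0) → (Q → b = 0) → a * b = 0 := by
    rintro P Q a b (h | h) ha hb
    · rw [ha h, zero_mul]
    · rw [hb h, mul_zero]
  have h0 : dif 0 (a : PGL k 3) * dif 0 (b : PGL k 3) = 0 :=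
    key (by omega) (fun h => x1 h 0) (fun h => y1 h 0)
  rw [form_apply, Finset.sum_eq_zero, h0, sub_zero]
  intro i _
  rw [key (by omega) (x2 i) (y3 i), key (by omega) (x3 i) (y2 i), add_zero]

variable (k) in
/-- The homogeneous component of degree `m` of the double of `psl₃ ⊂ pgl₃`, for the grading that
gives degree `3` to `v₀` and `-3` to `v₁`. -/
def grade (m : ℤ) : Submodule k (Double (form k)) where
  carrier := {x | x.g ∈ deg k m ∧ (m ≠ 0 → x.h = 0) ∧ (m ≠ 6 → x.e = 0) ∧ (m ≠ -6 → x.f = 0) ∧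
    (x.p : PGL k 3) ∈ deg k (m - 3) ∧ (x.q : PGL k 3) ∈ deg k (m + 3)}
  add_mem' := by
    rintro x y ⟨h1, h2, h3, h4, h5, h6⟩ ⟨h1', h2', h3', h4', h5', h6'⟩
    refine ⟨add_mem h1 h1', fun h => ?_, fun h => ?_, fun h => ?_, add_mem h5 h5', add_mem h6 h6'⟩
    · rw [Double.add_h, h2 h, h2' h, add_zero]
    · rw [Double.add_e, h3 h, h3' h, add_zero]
    · rw [Double.add_f, h4 h, h4' h, add_zero]
  zero_mem' := ⟨zero_mem _, fun _ => rfl, fun _ => rfl, fun _ => rfl, zero_mem _, zero_mem _⟩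
  smul_mem' := by
    rintro c x ⟨h1, h2, h3, h4, h5, h6⟩
    refine ⟨Submodule.smul_mem _ _ h1, fun h => ?_, fun h => ?_, fun h => ?_,
      Submodule.smul_mem _ _ h5, Submodule.smul_mem _ _ h6⟩
    · rw [Double.smul_h, h2 h, mul_zero]
    · rw [Double.smul_e, h3 h, mul_zero]
    · rw [Double.smul_f, h4 h, mul_zero]

theorem mem_grade {m : ℤ} {x : Double (form k)} : x ∈ grade k m ↔
    x.g ∈ deg k m ∧ (m ≠ 0 → x.h = 0) ∧ (m ≠ 6 → x.e = 0) ∧ (m ≠ -6 → x.f = 0) ∧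
      (x.p : PGL k 3) ∈ deg k (m - 3) ∧ (x.q : PGL k 3) ∈ deg k (m + 3) := Iff.rfl

theorem pmul_mem_grade [CharP k 3] {m m' : ℤ} {x y : Double (form k)} (hx : x ∈ grade k m)
    (hy : y ∈ grade k m') : pmul k x y ∈ grade k (m + m') := by
  obtain ⟨xg, xh, xe, xf, xp, xq⟩ := hx
  obtain ⟨yg, yh, ye, yf, yp, yq⟩ := hy
  have key : ∀ {P Q : Prop} {a b : k}, (P ∨ Q) → (P → a = 0) → (Q → b = 0) → a * b = 0 := by
    rintro P Q a b (h | h) ha hb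
    · rw [ha h, zero_mul]
    · rw [hb h, mul_zero]
  have mem : ∀ {m₁ m₂ m₃ : ℤ} {x : PGL k 3} (_ : x ∈ deg k m₁) (_ : m₁ = m₂), x ∈ deg k m₂ :=
    fun h h' => h' ▸ h
  have smul : ∀ {d n n' : ℤ} {c : k} {x : PGL k 3} (_ : n ≠ d → c = 0) (_ : x ∈ deg k n')
      (m₁ : ℤ) (_ : m₁ = n' + n - d), c • x ∈ deg k m₁ := by
    intro d n n' c x hc hx m₁ hm
    by_cases h : n = d
    · subst h
      exact Submodule.smul_mem _ _ (mem (m₃ := 0) hx (by omega))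
    · rw [hc h, zero_smul]
      exact zero_mem _
  have lie : ∀ {m₁ m₂ m₃ : ℤ} {x y : PGL k 3} (_ : x ∈ deg k m₁) (_ : y ∈ deg k m₂)
      (_ : m₁ + m₂ = m₃), ⁅x, y⁆ ∈ deg k m₃ := fun hx hy h => h ▸ lie_mem_deg hx hy
  refine ⟨?_, fun h => ?_, fun h => ?_, fun h => ?_, ?_, ?_⟩
  · rw [Double.mul_g]
    exact add_mem (lie_mem_deg xg yg) (sub_mem (lie xp yq (by omega)) (lie xq yp (by omega)))
  · rw [Double.mul_h, key (by omega) xe yf, key (by omega) xf ye,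
      form_eq_zero_of_mem_deg xp yq (by omega), form_eq_zero_of_mem_deg xq yp (by omega)]
    ring
  · rw [Double.mul_e, key (by omega) xh ye, key (by omega) xe yh,
      form_eq_zero_of_mem_deg xp yp (by omega)]
    ring
  · rw [Double.mul_f, key (by omega) xh yf, key (by omega) xf yh,
      form_eq_zero_of_mem_deg xq yq (by omega)]
    ring
  · rw [Double.mul_p]
    exact sub_mem (add_mem (sub_mem (lie xg yp (by omega)) (lie yg xp (by omega)))
      (add_mem (smul xh yp _ (by omega)) (smul xe yq _ (by omega))))
      (add_mem (smul yh xp _ (by omega)) (smul ye xq _ (by omega)))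
  · rw [Double.mul_q]
    exact sub_mem (add_mem (sub_mem (lie xg yq (by omega)) (lie yg xq (by omega)))
      (sub_mem (smul xf yp _ (by omega)) (smul xh yq _ (by omega))))
      (sub_mem (smul yf xp _ (by omega)) (smul yh xq _ (by omega)))

theorem iSupIndep_grade [CharP k 3] : iSupIndep (grade k) := by
  refine iSupIndep_of_separating _ fun x h => ?_
  let G : Double (form k) →ₗ[k] PGL k 3 := ⟨⟨Double.g, fun _ _ => rfl⟩, fun _ _ => rfl⟩
  let P : Double (form k) →ₗ[k] PGL k 3 := ⟨⟨fun x => x.p, fun _ _ => rfl⟩, fun _ _ => rfl⟩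
  let Q : Double (form k) →ₗ[k] PGL k 3 := ⟨⟨fun x => x.q, fun _ _ => rfl⟩, fun _ _ => rfl⟩
  have hG : x.g = 0 := by
    refine ext ?_ ?_ (fun j => ?_) fun j => ?_ <;> rw [map_zero]
    · exact h (dif 0 ∘ₗ G) 0 fun m hm y hy => (mem_grade.1 hy).1.1 hm 0
    · exact h (dif 1 ∘ₗ G) 0 fun m hm y hy => (mem_grade.1 hy).1.1 hm 1
    · exact h (up j ∘ₗ G) (du j) fun m hm y hy => (mem_grade.1 hy).1.2.1 j hm
    · exact h (dn j ∘ₗ G) (-du j) fun m hm y hy => (mem_grade.1 hy).1.2.2 j hm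
  have hP : x.p = 0 := by
    refine Subtype.ext (ext ?_ ?_ (fun j => ?_) fun j => ?_) <;>
      rw [LieSubmodule.coe_zero, map_zero]
    · exact h (dif 0 ∘ₗ P) 3 fun m hm y hy => (mem_grade.1 hy).2.2.2.2.1.1 (by omega) 0
    · exact h (dif 1 ∘ₗ P) 3 fun m hm y hy => (mem_grade.1 hy).2.2.2.2.1.1 (by omega) 1
    · exact h (up j ∘ₗ P) (du j + 3) fun m hm y hy => (mem_grade.1 hy).2.2.2.2.1.2.1 j (by omega)
    · exact h (dn j ∘ₗ P) (-du j + 3) fun m hm y hy => (mem_grade.1 hy).2.2.2.2.1.2.2 j (by omega)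
  have hQ : x.q = 0 := by
    refine Subtype.ext (ext ?_ ?_ (fun j => ?_) fun j => ?_) <;>
      rw [LieSubmodule.coe_zero, map_zero]
    · exact h (dif 0 ∘ₗ Q) (-3) fun m hm y hy => (mem_grade.1 hy).2.2.2.2.2.1 (by omega) 0
    · exact h (dif 1 ∘ₗ Q) (-3) fun m hm y hy => (mem_grade.1 hy).2.2.2.2.2.1 (by omega) 1
    · exact h (up j ∘ₗ Q) (du j - 3) fun m hm y hy => (mem_grade.1 hy).2.2.2.2.2.2.1 j (by omega)
    · exact h (dn j ∘ₗ Q) (-du j - 3) fun m hm y hy => (mem_grade.1 hy).2.2.2.2.2.2.2 j (by omega)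
  refine Double.ext hG ?_ ?_ ?_ hP hQ
  · exact h ⟨⟨Double.h, fun _ _ => rfl⟩, fun _ _ => rfl⟩ 0 fun m hm y hy => (mem_grade.1 hy).2.1 hm
  · exact h ⟨⟨Double.e, fun _ _ => rfl⟩, fun _ _ => rfl⟩ 6 fun m hm y hy =>
      (mem_grade.1 hy).2.2.1 hm
  · exact h ⟨⟨Double.f, fun _ _ => rfl⟩, fun _ _ => rfl⟩ (-6) fun m hm y hy =>
      (mem_grade.1 hy).2.2.2.1 hm

/-- A nonzero graded ideal contains the core, hence an element with a nonzero component along the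
diagonal of `𝔰𝔩₂`, which has degree `0`. -/
theorem eq_bot_of_le_grade [CharP k 3] {J : Submodule k (Double (form k))} (hJ : IsGradedIdeal J)
    (h : J ≤ ⨆ (m : ℤ) (_ : m ≠ 0), grade k m) : J = ⊥ := by
  by_contra h0
  have h1 := Double.core_le isRegular h0 hJ.graded fun x _ y hy => hJ.mul_left x y hy
  let φ : Double (form k) →ₗ[k] k := ⟨⟨Double.h, fun _ _ => rfl⟩, fun _ _ => rfl⟩
  have h2 : (⨆ (m : ℤ) (_ : m ≠ 0), grade k m) ≤ LinearMap.ker φ :=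
    iSup₂_le fun m hm y hy => (mem_grade.1 hy).2.1 hm
  have h3 : Double.ev (form k) 0 1 0 0 ∈ LinearMap.ker φ :=
    h2 (h (h1 (Double.mem_core.2 (PSL k 3).zero_mem)))
  exact one_ne_zero (α := k) h3

end PGL3

/-! ### Chevalley generators of the double of `psl₃ ⊂ pgl₃` -/

namespace Double

variable {k : Type u} [Field k] {𝔤 : Type v} [LieRing 𝔤] [LieAlgebra k 𝔤]
    {𝔥 : LieIdeal k 𝔤} {B : 𝔥 →ₗ[k] 𝔥 →ₗ[k] k}

theorem mul_ev_ev (x y : 𝔤) (h e f h' e' f' : k) : pmul k (ev B x h e f) (ev B y h' e' f') =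
    ev B ⁅x, y⁆ (e * f' - f * e') (2 * (h * e' - e * h')) (2 * (f * h' - h * f')) := by
  ext1 <;> simp

theorem mul_ev_od (x : 𝔤) (h e f : k) (p q : 𝔥) : pmul k (ev B x h e f) (od B p q) =
    od B (⁅x, p⁆ + (h • p + e • q)) (⁅x, q⁆ + (f • p - h • q)) := by
  ext1 <;> simp

theorem mul_od_ev (x : 𝔤) (h e f : k) (p q : 𝔥) : pmul k (od B p q) (ev B x h e f) =
    -od B (⁅x, p⁆ + (h • p + e • q)) (⁅x, q⁆ + (f • p - h • q)) := by
  ext1 <;> simp <;> abel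

theorem mul_od_od (p q p' q' : 𝔥) : pmul k (od B p q) (od B p' q') =
    ev B ((⁅(p : 𝔤), q'⁆ - ⁅(q : 𝔤), p'⁆ : 𝔥) : 𝔤) (-(B p q' + B q p')) (2 * B p p')
      (-(2 * B q q')) := by
  ext1 <;> simp

theorem smul_ev (c : k) (x : 𝔤) (h e f : k) :
    c • ev B x h e f = ev B (c • x) (c * h) (c * e) (c * f) := by
  ext1 <;> simp

theorem smul_od (c : k) (p q : 𝔥) : c • od B p q = od B (c • p) (c • q) := by
  ext1 <;> simp

end Double

namespace PGL3

variable {k : Type u} [Field k] {𝔥 : Type v} [AddCommGroup 𝔥] [Module k 𝔥]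
  (R : Realization (cartanMatrix k) 𝔥)

/-- The image of the Cartan subalgebra of a realization: `h` acts on the matrix units `E₁₂`, `E₂₃`
and on `E₃₁ ⊗ v₀` with eigenvalues `α₁(h)`, `α₂(h)` and `α₃(h)`. -/
def chevH : 𝔥 →ₗ[k] Double (form k) where
  toFun h := Double.ev (form k) (vec (R.root 1 h) (-R.root 0 h - R.root 1 h) 0 0)
    (R.root 0 h + R.root 1 h + R.root 2 h) 0 0
  map_add' x y := by
    refine Double.ext (ext ?_ ?_ (fun j => ?_) fun j => ?_) ?_ ?_ ?_ ?_ ?_ <;> simp <;> ring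
  map_smul' c x := by
    refine Double.ext (ext ?_ ?_ (fun j => ?_) fun j => ?_) ?_ ?_ ?_ ?_ ?_ <;> simp <;> ring

theorem chevH_apply (h : 𝔥) : chevH R h =
    Double.ev (form k) (vec (R.root 1 h) (-R.root 0 h - R.root 1 h) 0 0)
      (R.root 0 h + R.root 1 h + R.root 2 h) 0 0 := rfl

theorem chevH_mem_grade (h : 𝔥) : chevH R h ∈ grade k 0 := by
  refine ⟨⟨by simp, fun j _ => ?_, fun j _ => ?_⟩, by simp, ?_, ?_, zero_mem _, zero_mem _⟩ <;>
    simp [chevH_apply]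

theorem smul_vec (c a b : k) (u d : Fin 3 → k) :
    c • vec a b u d = vec (c * a) (c * b) (c • u) (c • d) := by
  refine ext ?_ ?_ (fun i => ?_) fun i => ?_ <;> simp

theorem dif_vec_zero (u d : Fin 3 → k) (j : Fin 3) : dif j (vec 0 0 u d) = 0 := by
  fin_cases j <;> simp [dif_two]

variable [CharP k 3]

variable (k) in
/-- The elements `E₁₂`, `E₂₃` and `E₃₁ ⊗ v₀`, where rows and columns are numbered from `1`. -/
def chevE : Fin 3 → Double (form k) :=
  ![Double.ev _ (vec 0 0 (Pi.single 2 1) 0) 0 0 0, Double.ev _ (vec 0 0 (Pi.single 0 1) 0) 0 0 0,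
    Double.od _ (pvec 0 (Pi.single 1 1) 0) 0]

variable (k) in
/-- The elements `E₂₁`, `E₃₂` and `-E₁₃ ⊗ v₁`. -/
def chevF : Fin 3 → Double (form k) :=
  ![Double.ev _ (vec 0 0 0 (Pi.single 2 1)) 0 0 0, Double.ev _ (vec 0 0 0 (Pi.single 0 1)) 0 0 0,
    Double.od _ 0 (pvec 0 0 (Pi.single 1 (-1)))]

theorem lie_single (i j : Fin 3) (c : k) :
    ⁅(vec 0 0 (Pi.single i 1) 0 : PGL k 3), (vec 0 0 0 (Pi.single j c) : PGL k 3)⁆ =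
      if i = j then vec (-c) (-c) 0 0 else 0 := by
  by_cases h : i = j
  · subst h
    rw [if_pos rfl]
    refine ext ?_ ?_ (fun j => ?_) fun j => ?_ <;>
      simp [dif_lie, up_lie, dn_lie, Pi.single_apply, dif_vec_zero]
  · rw [if_neg h]
    refine ext ?_ ?_ (fun j => ?_) fun j => ?_ <;>
      simp [dif_lie, up_lie, dn_lie, Pi.single_apply, dif_vec_zero, Ne.symm h]

theorem lie_single_pvec (i j : Fin 3) (c : k) :
    ⁅(vec 0 0 (Pi.single i 1) 0 : PGL k 3), pvec 0 0 (Pi.single j c)⁆ =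
      if i = j then pvec (-c) 0 0 else 0 :=
  Subtype.ext ((lie_single i j c).trans (by split_ifs <;> rfl))

theorem lie_pvec_single (i j : Fin 3) (c : k) :
    ⁅(vec 0 0 0 (Pi.single j c) : PGL k 3), pvec 0 (Pi.single i 1) 0⁆ =
      if i = j then pvec c 0 0 else 0 :=
  Subtype.ext ((lie_skew _ _).symm.trans
    ((congrArg Neg.neg (lie_single i j c)).trans (by
      split_ifs
      · change -vec (-c) (-c) 0 0 = vec c c 0 0
        rw [← neg_one_smul k, smul_vec]
        simp
      · simp)))

theorem lie_diag_up (a b c : k) (j : Fin 3) :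
    ⁅vec a b 0 0, vec 0 0 (Pi.single j c) 0⁆ =
      vec 0 0 (Pi.single j (dif j (vec a b 0 0) * c)) 0 := by
  refine ext ?_ ?_ (fun i => ?_) fun i => ?_ <;>
    simp [dif_lie, up_lie, dn_lie, Pi.single_apply]
  split_ifs with h
  · rw [h]
  · rfl

theorem lie_diag_dn (a b c : k) (j : Fin 3) :
    ⁅vec a b 0 0, vec 0 0 0 (Pi.single j c)⁆ =
      vec 0 0 0 (Pi.single j (-dif j (vec a b 0 0) * c)) := by
  refine ext ?_ ?_ (fun i => ?_) fun i => ?_ <;>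
    simp [dif_lie, up_lie, dn_lie, Pi.single_apply]
  split_ifs with h
  · rw [h]
  · rw [neg_zero]

theorem lie_diag_pvec_up (a b c : k) (j : Fin 3) :
    ⁅vec a b 0 0, pvec 0 (Pi.single j c) 0⁆ =
      pvec 0 (Pi.single j (dif j (vec a b 0 0) * c)) 0 :=
  Subtype.ext (lie_diag_up a b c j)

theorem lie_diag_pvec_dn (a b c : k) (j : Fin 3) :
    ⁅vec a b 0 0, pvec 0 0 (Pi.single j c)⁆ =
      pvec 0 0 (Pi.single j (-dif j (vec a b 0 0) * c)) :=
  Subtype.ext (lie_diag_dn a b c j)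

theorem smul_pvec (c r : k) (u d : Fin 3 → k) :
    c • pvec r u d = pvec (c * r) (c • u) (c • d) :=
  Subtype.ext (smul_vec c r r u d)

theorem pvec_add_pvec (r r' : k) (u d u' d' : Fin 3 → k) :
    pvec r u d + pvec r' u' d' = pvec (r + r') (u + u') (d + d') := by
  refine Subtype.ext (ext ?_ ?_ (fun i => ?_) fun i => ?_) <;> simp

theorem pmul_chevH_chevE (h : 𝔥) (i : Fin 3) :
    pmul k (chevH R h) (chevE k i) = R.root i h • chevE k i := by
  rw [chevH_apply]
  fin_cases i
  · simp [chevE, Double.mul_ev_ev, Double.smul_ev, lie_diag_up, smul_vec, ← Pi.single_smul, dif_two]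
    congr 3
    ring
  · simp [chevE, Double.mul_ev_ev, Double.smul_ev, lie_diag_up, smul_vec, ← Pi.single_smul]
  · change pmul k _ (Double.od _ (pvec 0 (Pi.single 1 1) 0) 0) =
      R.root 2 h • Double.od _ (pvec 0 (Pi.single 1 1) 0) 0
    simp [Double.mul_ev_od, Double.smul_od, lie_diag_pvec_up, smul_pvec, ← Pi.single_smul]
    rw [pvec_add_pvec, add_zero, ← Pi.single_add]
    congr 4
    · ring
    · exact add_zero 0

theorem pmul_chevH_chevF (h : 𝔥) (i : Fin 3) :
    pmul k (chevH R h) (chevF k i) = -(R.root i h • chevF k i) := by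
  rw [chevH_apply, ← neg_smul]
  have hs : ∀ i (c : k), -Pi.single (M := fun _ : Fin 3 => k) i c = Pi.single i (-c) :=
    fun i c => (Pi.single_neg (f := fun _ : Fin 3 => k) i c).symm
  fin_cases i
  · simp [chevF, Double.mul_ev_ev, -neg_smul, Double.smul_ev, lie_diag_dn, smul_vec,
      ← Pi.single_smul, dif_two]
  · simp [chevF, Double.mul_ev_ev, -neg_smul, Double.smul_ev, lie_diag_dn, smul_vec,
      ← Pi.single_smul]
  · change pmul k _ (Double.od _ 0 (pvec 0 0 (Pi.single 1 (-1)))) =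
      -R.root 2 h • Double.od _ 0 (pvec 0 0 (Pi.single 1 (-1)))
    rw [Double.mul_ev_od, Double.smul_od, lie_diag_pvec_dn]
    refine congrArg₂ (Double.od _) (by simp) ?_
    rw [smul_zero, zero_sub, ← neg_smul, smul_pvec, smul_pvec, pvec_add_pvec, ← Pi.single_smul,
      ← Pi.single_smul, ← Pi.single_add]
    simp
    congr 2
    ring

theorem pmul_chevE_chevF (i j : Fin 3) : pmul k (chevE k i) (chevF k j) =
    if i = j then chevH R (R.coroot i) else 0 := by
  have h3 := three_eq_zero k
  have hH : chevH R (R.coroot i) = Double.ev (form k) (vec (cartanMatrix k i 1)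
      (-cartanMatrix k i 0 - cartanMatrix k i 1) 0 0)
      (cartanMatrix k i 0 + cartanMatrix k i 1 + cartanMatrix k i 2) 0 0 := by
    rw [chevH_apply, R.root_coroot, R.root_coroot, R.root_coroot]
  rw [hH]
  fin_cases i <;> fin_cases j
  · simp [chevE, chevF, cartanMatrix, Double.mul_ev_ev, lie_single]
    congr 1
    · congr 1
      ring
    · ring
  · simp [chevE, chevF, Double.mul_ev_ev, lie_single]
    rfl
  · change pmul k _ (Double.od _ 0 (pvec 0 0 (Pi.single 1 (-1)))) = _
    simp [chevE, Double.mul_ev_od, lie_single_pvec]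
    rfl
  · simp [chevE, chevF, Double.mul_ev_ev, lie_single]
    rfl
  · simp [chevE, chevF, cartanMatrix, Double.mul_ev_ev, lie_single]
    congr 1
    · congr 1
      · linear_combination -h3
      · ring
    · ring
  · change pmul k _ (Double.od _ 0 (pvec 0 0 (Pi.single 1 (-1)))) = _
    simp [chevE, Double.mul_ev_od, lie_single_pvec]
    rfl
  · change pmul k (Double.od _ (pvec 0 (Pi.single 1 1) 0) 0) _ = _
    simp [chevF, Double.mul_od_ev, lie_pvec_single]
    rfl
  · change pmul k (Double.od _ (pvec 0 (Pi.single 1 1) 0) 0) _ = _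
    simp [chevF, Double.mul_od_ev, lie_pvec_single]
    rfl
  · change pmul k (Double.od _ (pvec 0 (Pi.single 1 1) 0) 0)
      (Double.od _ 0 (pvec 0 0 (Pi.single 1 (-1)))) = _
    simp [cartanMatrix, Double.mul_od_od, form_apply, Pi.single_apply]
    congr 1
    · exact (lie_single 1 1 (-1)).trans (by
        rw [if_pos rfl]
        congr 1
        · ring
        · linear_combination h3)
    · linear_combination -h3

theorem isChevalley : IsChevalley R {2} (chevH R) (chevE k) (chevF k) where
  H_mem h := Double.ev_mem _ _ _ _
  E_mem i := by
    fin_cases i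
    · exact Double.ev_mem _ _ _ _
    · exact Double.ev_mem _ _ _ _
    · exact Double.od_mem _ _
  F_mem i := by
    fin_cases i
    · exact Double.ev_mem _ _ _ _
    · exact Double.ev_mem _ _ _ _
    · exact Double.od_mem _ _
  HH h h' := by
    refine Double.ext (ext ?_ ?_ (fun j => ?_) fun j => ?_) ?_ ?_ ?_ ?_ ?_ <;>
      simp [chevH_apply, dif_lie, up_lie, dn_lie]
  HE := pmul_chevH_chevE R
  HF := pmul_chevH_chevF R
  EF := pmul_chevE_chevF R

theorem chevE_linearIndependent : LinearIndependent k (chevE k) := by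
  rw [Fintype.linearIndependent_iff]
  intro c hc
  rw [Fin.sum_univ_three] at hc
  have h0 := congrArg (fun x : Double (form k) => up 2 x.g) hc
  have h1 := congrArg (fun x : Double (form k) => up 0 x.g) hc
  have h2 := congrArg (fun x : Double (form k) => up 1 (x.p : PGL k 3)) hc
  simp [chevE] at h0 h1 h2
  intro i
  fin_cases i
  · exact h0
  · exact h1
  · exact h2

theorem chevF_linearIndependent : LinearIndependent k (chevF k) := by
  rw [Fintype.linearIndependent_iff]
  intro c hc
  rw [Fin.sum_univ_three] at hc
  have h0 := congrArg (fun x : Double (form k) => dn 2 x.g) hc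
  have h1 := congrArg (fun x : Double (form k) => dn 0 x.g) hc
  have h2 := congrArg (fun x : Double (form k) => dn 1 (x.q : PGL k 3)) hc
  simp [chevF] at h0 h1 h2
  intro i
  fin_cases i
  · exact h0
  · exact h1
  · exact h2

theorem chevE_mem_grade (i : Fin 3) : chevE k i ∈ grade k 1 := by
  fin_cases i <;> refine ⟨⟨fun _ j => ?_, fun j hj => ?_, fun j hj => ?_⟩, fun _ => ?_, fun _ => ?_,
    fun _ => ?_, ⟨fun _ j => ?_, fun j hj => ?_, fun j hj => ?_⟩,
    ⟨fun _ j => ?_, fun j hj => ?_, fun j hj => ?_⟩⟩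
  all_goals first | fin_cases j | skip
  all_goals simp [chevE, dif_two]
  all_goals simp [du] at hj

theorem chevF_mem_grade (i : Fin 3) : chevF k i ∈ grade k (-1) := by
  fin_cases i <;> refine ⟨⟨fun _ j => ?_, fun j hj => ?_, fun j hj => ?_⟩, fun _ => ?_, fun _ => ?_,
    fun _ => ?_, ⟨fun _ j => ?_, fun j hj => ?_, fun j hj => ?_⟩,
    ⟨fun _ j => ?_, fun j hj => ?_, fun j hj => ?_⟩⟩
  all_goals first | fin_cases j | skip
  all_goals simp [chevF, dif_two]
  all_goals simp [du] at hj

end PGL3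

namespace PGL3

variable {k : Type u} [Field k] [CharP k 3]

theorem ev_off_diagonal_mem {J : Submodule k (Double (form k))}
    (hJ : ∀ x ∈ J, ∀ y ∈ J, pmul k x y ∈ J) (hE : ∀ i, chevE k i ∈ J) (hF : ∀ i, chevF k i ∈ J)
    (u d : Fin 3 → k) : Double.ev (form k) (vec 0 0 u d) 0 0 0 ∈ J := by
  have hU : ∀ j, Double.ev (form k) (vec 0 0 (Pi.single j 1) 0) 0 0 0 ∈ J := by
    intro j
    fin_cases j
    · exact hE 1
    · have h := hJ _ (hF 1) _ (hF 0)
      convert h using 1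
      refine Double.ext (ext ?_ ?_ (fun j => ?_) fun j => ?_) ?_ ?_ ?_ ?_ ?_
      all_goals try fin_cases j
      all_goals simp [chevF, up_lie, dn_lie, dif_lie, dif_vec_zero]
    · exact hE 0
  have hD : ∀ j, Double.ev (form k) (vec 0 0 0 (Pi.single j 1)) 0 0 0 ∈ J := by
    intro j
    fin_cases j
    · exact hF 1
    · have h := hJ _ (hE 0) _ (hE 1)
      convert h using 1
      refine Double.ext (ext ?_ ?_ (fun j => ?_) fun j => ?_) ?_ ?_ ?_ ?_ ?_
      all_goals try fin_cases j
      all_goals simp [chevE, up_lie, dn_lie, dif_lie, dif_vec_zero]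
    · exact hF 0
  have h : Double.ev (form k) (vec 0 0 u d) 0 0 0 =
      ∑ j, (u j • Double.ev (form k) (vec 0 0 (Pi.single j 1) 0) 0 0 0 +
        d j • Double.ev (form k) (vec 0 0 0 (Pi.single j 1)) 0 0 0) := by
    rw [Fin.sum_univ_three]
    refine Double.ext (ext ?_ ?_ (fun j => ?_) fun j => ?_) ?_ ?_ ?_ ?_ ?_
    all_goals try fin_cases j
    all_goals simp
  rw [h]
  exact Submodule.sum_mem _ fun j _ =>
    add_mem (Submodule.smul_mem _ _ (hU j)) (Submodule.smul_mem _ _ (hD j))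

theorem lie_vec_pvec (u d : Fin 3 → k) :
    ⁅vec 0 0 (-u) d, pvec 1 0 0⁆ = pvec 0 u d := by
  refine Subtype.ext (ext ?_ ?_ (fun j => ?_) fun j => ?_) <;>
    simp [up_lie, dn_lie, dif_lie, dif_vec_zero]

theorem eq_pvec (p : PSL k 3) :
    p = pvec (dif 0 (p : PGL k 3)) (fun j => up j (p : PGL k 3)) fun j => dn j (p : PGL k 3) := by
  refine Subtype.ext (ext ?_ ?_ (fun j => ?_) fun j => ?_)
  · simp
  · rw [dif_pvec, dif_eq p.2]
  · simp
  · simp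

theorem od_mem {J : Submodule k (Double (form k))}
    (hJ : ∀ x ∈ J, ∀ y ∈ J, pmul k x y ∈ J) (hE : ∀ i, chevE k i ∈ J) (hF : ∀ i, chevF k i ∈ J)
    (p q : PSL k 3) : Double.od (form k) p q ∈ J := by
  have hg := ev_off_diagonal_mem hJ hE hF
  have hp : Double.od (form k) (pvec 1 0 0) 0 ∈ J := by
    have h := hJ _ (hg 0 (Pi.single 1 1)) _ (hE 2)
    change pmul k _ (Double.od _ (pvec 0 (Pi.single 1 1) 0) 0) ∈ J at h
    rw [Double.mul_ev_od, lie_pvec_single] at h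
    simpa using h
  have hq : Double.od (form k) 0 (pvec 1 0 0) ∈ J := by
    have h := hJ _ (hg (Pi.single 1 1) 0) _ (hF 2)
    change pmul k _ (Double.od _ 0 (pvec 0 0 (Pi.single 1 (-1)))) ∈ J at h
    rw [Double.mul_ev_od, lie_single_pvec] at h
    simpa using h
  -- The commutators of a diagonal element with all matrices are the matrices with zero diagonal.
  have h1 : ∀ p : PSL k 3, Double.od (form k) p 0 ∈ J := fun p => by
    have h := hJ _ (hg (-fun j => up j (p : PGL k 3)) fun j => dn j (p : PGL k 3)) _ hp
    rw [Double.mul_ev_od, lie_vec_pvec] at h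
    have h' := add_mem (Submodule.smul_mem _ (dif 0 (p : PGL k 3)) hp) h
    convert h' using 1
    rw [Double.smul_od, smul_pvec]
    refine Double.ext (by simp) (by simp) (by simp) (by simp) ?_ (by simp)
    simp [pvec_add_pvec]
    exact eq_pvec p
  have h2 : ∀ p : PSL k 3, Double.od (form k) 0 p ∈ J := fun p => by
    have h := hJ _ (hg (-fun j => up j (p : PGL k 3)) fun j => dn j (p : PGL k 3)) _ hq
    rw [Double.mul_ev_od, lie_vec_pvec] at h
    have h' := add_mem (Submodule.smul_mem _ (dif 0 (p : PGL k 3)) hq) h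
    convert h' using 1
    rw [Double.smul_od, smul_pvec]
    refine Double.ext (by simp) (by simp) (by simp) (by simp) (by simp) ?_
    simp [pvec_add_pvec]
    exact eq_pvec p
  have h := add_mem (h1 p) (h2 q)
  convert h using 1
  ext1 <;> simp

variable {𝔥 : Type v} [AddCommGroup 𝔥] [Module k 𝔥] (R : Realization (cartanMatrix k) 𝔥)

/-- The Chevalley generators generate. The trace of the component in `pgl₃` of the image of `h` is
`α₁(h) - α₂(h)`, so that it is nonzero for some `h`. -/
theorem eq_top_of_chev_mem {J : Submodule k (Double (form k))}
    (hJ : ∀ x ∈ J, ∀ y ∈ J, pmul k x y ∈ J) (hH : ∀ h, chevH R h ∈ J)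
    (hE : ∀ i, chevE k i ∈ J) (hF : ∀ i, chevF k i ∈ J) : J = ⊤ := by
  have h3 := three_eq_zero k
  have h2 : (2 : k) ≠ 0 := NeZero.ne (2 : k)
  have hg := ev_off_diagonal_mem hJ hE hF
  have ho := od_mem hJ hE hF
  -- The square of `p ⊗ v₀` is `2B(p, p)` times the first nilpotent element of `𝔰𝔩₂`.
  have he : ∀ c : k, Double.ev (form k) 0 0 c 0 ∈ J := fun c => by
    have h := Submodule.smul_mem _ (c / 2) (hJ _ (ho (pvec 1 0 0) 0) _ (ho (pvec 1 0 0) 0))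
    rw [Double.mul_od_od, Double.smul_ev] at h
    simpa [form_apply, h2] using h
  have hf : ∀ c : k, Double.ev (form k) 0 0 0 c ∈ J := fun c => by
    have h := Submodule.smul_mem _ (-(c / 2)) (hJ _ (ho 0 (pvec 1 0 0)) _ (ho 0 (pvec 1 0 0)))
    rw [Double.mul_od_od, Double.smul_ev] at h
    simpa [form_apply, h2] using h
  have hh : ∀ c : k, Double.ev (form k) 0 c 0 0 ∈ J := fun c => by
    have h := hJ _ (he c) _ (hf 1)
    rw [Double.mul_ev_ev] at h
    simpa using h
  obtain ⟨h, hh0⟩ : ∃ h, R.root 0 h - R.root 1 h ≠ 0 := by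
    by_contra! hc
    exact absurd (R.root_indep.injective (LinearMap.ext fun h => sub_eq_zero.1 (hc h))) (by decide)
  have hd : ∀ a b : k, Double.ev (form k) (vec a b 0 0) 0 0 0 ∈ J := fun a b => by
    have h5 := hJ _ (hg (Pi.single 0 1) 0) _ (hg 0 (Pi.single 0 1))
    rw [Double.mul_ev_ev, lie_single, if_pos rfl] at h5
    have h6 := sub_mem (hH h) (hh (R.root 0 h + R.root 1 h + R.root 2 h))
    have h7 := sub_mem (Submodule.smul_mem _ ((a - b) / (R.root 0 h - R.root 1 h)) h6)
      (Submodule.smul_mem _ (a - (a - b) / (R.root 0 h - R.root 1 h) * R.root 1 h) h5)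
    convert h7 using 1
    refine Double.ext (ext ?_ ?_ (fun j => ?_) fun j => ?_) ?_ ?_ ?_ ?_ ?_ <;>
      simp [chevH_apply]
    field_simp
    linear_combination (a - b) * R.root 1 h * h3
  refine Submodule.eq_top_iff'.2 fun x => ?_
  have h := add_mem (add_mem (add_mem (hd (dif 0 x.g) (dif 1 x.g))
    (hg (fun j => up j x.g) fun j => dn j x.g)) (add_mem (hh x.h) (add_mem (he x.e) (hf x.f))))
    (ho x.p x.q)
  convert h using 1
  refine Double.ext (ext ?_ ?_ (fun j => ?_) fun j => ?_) ?_ ?_ ?_ ?_ ?_ <;> simp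

/-- The double of `psl₃ ⊂ pgl₃` is the contragredient Lie superalgebra modulo its centre. -/
theorem nonempty_superIso :
    Nonempty (SuperIso k (Double (form k)) (CenterlessContragredient R {2})) :=
  (isChevalley R).nonempty_superIso (Double.isLieSuperalgebra isCrossForm) chevE_linearIndependent
    chevF_linearIndependent (fun _ hJ hH hE hF => eq_top_of_chev_mem R hJ hH hE hF) (grade k)
    iSupIndep_grade (fun _ _ _ hx _ hy => pmul_mem_grade hx hy) (chevH_mem_grade R)
    chevE_mem_grade chevF_mem_grade
    (fun _ hx => Double.eq_zero_of_mem_centre isRegular hx) fun _ hJ h => eq_bot_of_le_grade hJ h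

end PGL3

/-! ### The even and the odd part -/

namespace Double

variable {k : Type u} [Field k] {𝔤 : Type v} [LieRing 𝔤] [LieAlgebra k 𝔤]
    {𝔥 : LieIdeal k 𝔤} {B : 𝔥 →ₗ[k] 𝔥 →ₗ[k] k}

/-- The matrix `(h, e; f, -h)` in `𝔰𝔩₂`. -/
def slMatrix (h e f : k) : LieAlgebra.SpecialLinear.sl (Fin 2) k :=
  ⟨!![h, e; f, -h], (Matrix.trace_fin_two _).trans (add_neg_cancel h)⟩

theorem coe_slMatrix (h e f : k) :
    (slMatrix h e f : Matrix (Fin 2) (Fin 2) k) = !![h, e; f, -h] := rfl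

theorem slMatrix_eq (X : LieAlgebra.SpecialLinear.sl (Fin 2) k) :
    slMatrix ((X : Matrix (Fin 2) (Fin 2) k) 0 0) ((X : Matrix (Fin 2) (Fin 2) k) 0 1)
      ((X : Matrix (Fin 2) (Fin 2) k) 1 0) = X := by
  have h : Matrix.trace (X : Matrix (Fin 2) (Fin 2) k) = 0 := X.2
  rw [Matrix.trace_fin_two, add_comm] at h
  refine Subtype.ext ?_
  rw [coe_slMatrix, ← eq_neg_of_add_eq_zero_left h, ← Matrix.eta_fin_two]

theorem slMatrix_add (h e f h' e' f' : k) :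
    slMatrix (h + h') (e + e') (f + f') = slMatrix h e f + slMatrix h' e' f' := by
  refine Subtype.ext ?_
  change !![_, _; _, _] = !![_, _; _, _] + !![_, _; _, _]
  ext i j
  fin_cases i <;> fin_cases j <;> simp [add_comm]

theorem slMatrix_smul (c h e f : k) :
    slMatrix (c * h) (c * e) (c * f) = c • slMatrix h e f := by
  refine Subtype.ext ?_
  change !![_, _; _, _] = c • !![_, _; _, _]
  ext i j
  fin_cases i <;> fin_cases j <;> simp

theorem slMatrix_lie (h e f h' e' f' : k) : ⁅slMatrix h e f, slMatrix h' e' f'⁆ =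
    slMatrix (e * f' - f * e') (2 * (h * e' - e * h')) (2 * (f * h' - h * f')) := by
  refine Subtype.ext ?_
  rw [LieAlgebra.SpecialLinear.sl_bracket, coe_slMatrix, coe_slMatrix, coe_slMatrix]
  ext i j
  fin_cases i <;> fin_cases j <;> simp <;> ring

variable (B) in
/-- The even part is `𝔤 ⊕ 𝔰𝔩₂`. -/
def evEquiv : part k (Double B) 0 ≃ₗ[k] 𝔤 × LieAlgebra.SpecialLinear.sl (Fin 2) k where
  toFun x := (x.1.g, slMatrix x.1.h x.1.e x.1.f)
  map_add' _ _ := Prod.ext rfl (slMatrix_add _ _ _ _ _ _)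
  map_smul' _ _ := Prod.ext rfl (slMatrix_smul _ _ _ _)
  invFun y := ⟨ev B y.1 ((y.2 : Matrix (Fin 2) (Fin 2) k) 0 0)
    ((y.2 : Matrix (Fin 2) (Fin 2) k) 0 1) ((y.2 : Matrix (Fin 2) (Fin 2) k) 1 0), ev_mem _ _ _ _⟩
  left_inv x := Subtype.ext x.2
  right_inv y := Prod.ext rfl (slMatrix_eq y.2)

theorem evEquiv_apply (x : part k (Double B) 0) : evEquiv B x =
    ((x : Double B).g, slMatrix (x : Double B).h (x : Double B).e (x : Double B).f) := rfl

theorem evEquiv_mul {x y z : part k (Double B) 0} (h : (z : Double B) = pmul k (x : Double B) y) :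
    evEquiv B z = ⁅evEquiv B x, evEquiv B y⁆ := by
  have hx : (x : Double B) = ev B _ _ _ _ := x.2.symm
  have hy : (y : Double B) = ev B _ _ _ _ := y.2.symm
  rw [hx, hy, mul_ev_ev] at h
  rw [evEquiv_apply, evEquiv_apply, evEquiv_apply, h]
  exact Prod.ext rfl (slMatrix_lie _ _ _ _ _ _).symm

variable (B) in
/-- The odd part is `𝔥 ⊗ V`. -/
def odEquiv : part k (Double B) 1 ≃ₗ[k] 𝔥 ⊗[k] (Fin 2 → k) :=
  LinearEquiv.trans
    { toFun := fun x => ![x.1.p, x.1.q]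
      map_add' := fun x y => by
        ext i
        fin_cases i <;> rfl
      map_smul' := fun c x => by
        ext i
        fin_cases i <;> rfl
      invFun := fun y => ⟨od B (y 0) (y 1), od_mem _ _⟩
      left_inv := fun x => Subtype.ext x.2
      right_inv := fun y => by
        ext i
        fin_cases i <;> rfl }
    (TensorProduct.piScalarRight k k 𝔥 (Fin 2)).symm

theorem odEquiv_apply (x : part k (Double B) 1) : odEquiv B x =
    (x : Double B).p ⊗ₜ Pi.single 0 1 + (x : Double B).q ⊗ₜ Pi.single 1 1 := by
  rw [odEquiv, LinearEquiv.trans_apply, LinearEquiv.symm_apply_eq, map_add,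
    TensorProduct.piScalarRight_apply, TensorProduct.piScalarRight_apply,
    TensorProduct.piScalarRightHom_tmul, TensorProduct.piScalarRightHom_tmul]
  ext i
  fin_cases i <;> simp

theorem odEquiv_mul {x : part k (Double B) 0} {y z : part k (Double B) 1}
    (h : (z : Double B) = pmul k (x : Double B) y) :
    odEquiv B z = (LieModule.toEnd k 𝔤 𝔥 (evEquiv B x).1).rTensor (Fin 2 → k) (odEquiv B y) +
      (LieModule.toEnd k (Matrix (Fin 2) (Fin 2) k) (Fin 2 → k) (evEquiv B x).2).lTensor 𝔥
        (odEquiv B y) := by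
  have hx : (x : Double B) = ev B _ _ _ _ := x.2.symm
  have hy : (y : Double B) = od B _ _ := y.2.symm
  rw [hx, hy, mul_ev_od] at h
  have hX : ((evEquiv B x).2 : Matrix (Fin 2) (Fin 2) k) =
    !![(x : Double B).h, (x : Double B).e; (x : Double B).f, -(x : Double B).h] := rfl
  have h0 : ⁅((evEquiv B x).2 : Matrix (Fin 2) (Fin 2) k), (Pi.single 0 1 : Fin 2 → k)⁆ =
      (x : Double B).h • Pi.single 0 1 + (x : Double B).f • Pi.single 1 1 := by
    rw [hX]
    change Matrix.mulVec _ _ = _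
    ext i
    fin_cases i <;> simp
  have h1 : ⁅((evEquiv B x).2 : Matrix (Fin 2) (Fin 2) k), (Pi.single 1 1 : Fin 2 → k)⁆ =
      (x : Double B).e • Pi.single 0 1 - (x : Double B).h • Pi.single 1 1 := by
    rw [hX]
    change Matrix.mulVec _ _ = _
    ext i
    fin_cases i <;> simp
  rw [odEquiv_apply, odEquiv_apply, h]
  simp only [map_add, LinearMap.rTensor_tmul, LinearMap.lTensor_tmul, LieModule.toEnd_apply_apply,
    h0, h1, od_p, od_q, TensorProduct.tmul_add, TensorProduct.tmul_sub, TensorProduct.add_tmul,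
    TensorProduct.sub_tmul, TensorProduct.smul_tmul]
  rw [show (evEquiv B x).1 = (x : Double B).g from rfl]
  abel

end Double

section Transfer

variable {k : Type u} [Field k] {L : Type v} [AddCommGroup L] [Module k L] [SuperProduct k L]
  {M : Type w} [AddCommGroup M] [Module k M] [SuperProduct k M]

/-- The isomorphism between homogeneous components induced by an isomorphism. -/
def SuperIso.partEquiv (e : SuperIso k L M) (i : ZMod 2) : part k L i ≃ₗ[k] part k M i :=
  e.toLinearEquiv.submoduleMap (part k L i) ≪≫ₗ LinearEquiv.ofEq _ _ (by
    ext x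
    constructor
    · rintro ⟨y, hy, rfl⟩
      exact e.isSuperHom.map_mem hy
    · intro hx
      exact ⟨e.toLinearEquiv.symm x, e.isSuperHom_symm.map_mem hx,
        e.toLinearEquiv.apply_symm_apply x⟩)

theorem SuperIso.coe_partEquiv (e : SuperIso k L M) (i : ZMod 2) (x : part k L i) :
    (e.partEquiv i x : M) = e.toLinearEquiv x := rfl

/-- A proper nonzero derived superalgebra is a graded ideal that prevents simplicity. -/
theorem not_isSimpleSuper (hL : IsLieSuperalgebra k L)
    (hf : Module.finrank k (L ⧸ derived k L) = 1) (hs : IsSimpleSub (derived k L)) :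
    ¬ IsSimpleSuper k L := by
  intro h
  have hd := hL.isGradedIdeal_derived
  rcases h.eq_bot_or_eq _ le_top hd.graded
    fun x _ y hy => ⟨hd.mul_left x y hy, hd.mul_right y hy x⟩ with h0 | h0
  · obtain ⟨x, hx, y, -, hxy⟩ := hs.nonabelian
    rw [h0, Submodule.mem_bot] at hx
    exact hxy (by rw [hx, map_zero, LinearMap.zero_apply])
  · rw [h0, Module.finrank_zero_of_subsingleton] at hf
    exact zero_ne_one hf

end Transfer

namespace PGL3

variable {k : Type u} [Field k] {M : Type w} [AddCommGroup M] [Module k M] [SuperProduct k M]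

set_option linter.overlappingInstances false in
/-- The structure of the even and the odd part. The grading is a separate argument `s`: that of a
product space is found by unification both as a direct sum and as part of a superalgebra. -/
theorem exists_part_equiv_of_superIso [s : SuperSpace k M] (hs : s = SuperProduct.toSuperSpace)
    (e : SuperIso k M (Double (form k))) :
    ∃ (φ : part k M 0 ≃ₗ[k] PGL k 3 × LieAlgebra.SpecialLinear.sl (Fin 2) k)
      (ψ : part k M 1 ≃ₗ[k] PSL k 3 ⊗[k] (Fin 2 → k)),
      (∀ x y z : part k M 0, (z : M) = pmul k (x : M) y → φ z = ⁅φ x, φ y⁆) ∧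
      (∀ (x : part k M 0) (y z : part k M 1), (z : M) = pmul k (x : M) y →
        ψ z = (LieModule.toEnd k (PGL k 3) (PSL k 3) (φ x).1).rTensor (Fin 2 → k) (ψ y) +
          (LieModule.toEnd k (Matrix (Fin 2) (Fin 2) k) (Fin 2 → k) (φ x).2).lTensor (PSL k 3)
            (ψ y)) := by
  subst hs
  have key : ∀ (i j : ZMod 2) (x : part k M i) (y z : part k M j), (z : M) = pmul k (x : M) y →
      (e.partEquiv j z : Double (form k)) =
        pmul k (e.partEquiv i x : Double (form k)) (e.partEquiv j y) := fun i j x y z h => by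
    simp only [SuperIso.coe_partEquiv]
    rw [h]
    exact e.map_mul x y
  exact ⟨(e.partEquiv 0).trans (Double.evEquiv (form k)),
    (e.partEquiv 1).trans (Double.odEquiv (form k)),
    fun x y z h => Double.evEquiv_mul (key 0 0 x y z h),
    fun x y z h => Double.odEquiv_mul (key 0 1 x y z h)⟩

variable [CharP k 3]

theorem isLieSuperalgebra_of_superIso (e : SuperIso k M (Double (form k))) :
    IsLieSuperalgebra k M :=
  (Double.isLieSuperalgebra isCrossForm).of_injective e.isSuperHom e.toLinearEquiv.injective

theorem derived_eq_of_superIso (e : SuperIso k M (Double (form k))) :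
    derived k M = (Double.core (form k)).map (e.toLinearEquiv.symm : Double (form k) →ₗ[k] M) := by
  rw [← Double.derived_eq_core isCrossForm isRegular,
    derived_map e.isSuperHom_symm e.toLinearEquiv.symm.surjective]

theorem isSimpleSub_derived_of_superIso (e : SuperIso k M (Double (form k))) :
    IsSimpleSub (derived k M) := by
  rw [derived_eq_of_superIso e]
  exact (Double.isSimpleSub_core isRegular).map e.isSuperHom_symm e.toLinearEquiv.symm.bijective

theorem finrank_quotient_derived_of_superIso (e : SuperIso k M (Double (form k))) :
    Module.finrank k (M ⧸ derived k M) = 1 := by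
  rw [← finrank_quotient_core (k := k)]
  exact (Submodule.Quotient.equiv _ _ e.toLinearEquiv.symm
    (derived_eq_of_superIso e).symm).symm.finrank_eq

theorem nonempty_superIso_of_superIso {𝔥 : Type*} [AddCommGroup 𝔥] [Module k 𝔥]
    (R : Realization (cartanMatrix k) 𝔥) (e : SuperIso k M (Double (form k))) :
    Nonempty (SuperIso k M (CenterlessContragredient R {2})) :=
  (nonempty_superIso R).map e.trans

end PGL3

end MagicSquare

end

theorem mainTheorem12 (k : Type*) [Field k] [CharP k 3] :
    IsLieSuperalgebra k (Magic k (S2 k) (S12 k)) ∧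
    (∀ (𝔥 : Type*) [AddCommGroup 𝔥] [Module k 𝔥] (R : Realization (cartanMatrix k) 𝔥),
      Nonempty (SuperIso k (Magic k (S2 k) (S12 k)) (CenterlessContragredient R {2}))) ∧
    ¬ IsSimpleSuper k (Magic k (S2 k) (S12 k)) ∧
    IsGradedIdeal (derived k (Magic k (S2 k) (S12 k))) ∧
    Module.finrank k (Magic k (S2 k) (S12 k) ⧸ derived k (Magic k (S2 k) (S12 k))) = 1 ∧
    IsSimpleSub (derived k (Magic k (S2 k) (S12 k))) ∧
    ∃ (φ : part k (Magic k (S2 k) (S12 k)) 0 ≃ₗ[k]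
          PGL k 3 × LieAlgebra.SpecialLinear.sl (Fin 2) k)
      (ψ : part k (Magic k (S2 k) (S12 k)) 1 ≃ₗ[k] PSL k 3 ⊗[k] (Fin 2 → k)),
      (∀ x y z : part k (Magic k (S2 k) (S12 k)) 0,
        (z : Magic k (S2 k) (S12 k)) = pmul k (x : Magic k (S2 k) (S12 k)) y → φ z = ⁅φ x, φ y⁆) ∧
      (∀ (x : part k (Magic k (S2 k) (S12 k)) 0) (y z : part k (Magic k (S2 k) (S12 k)) 1),
        (z : Magic k (S2 k) (S12 k)) = pmul k (x : Magic k (S2 k) (S12 k)) y →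
        ψ z = (LieModule.toEnd k (PGL k 3) (PSL k 3) (φ x).1).rTensor (Fin 2 → k) (ψ y) +
          (LieModule.toEnd k (Matrix (Fin 2) (Fin 2) k) (Fin 2 → k) (φ x).2).lTensor (PSL k 3)
            (ψ y)) := by
  have e := (PGL3.magicIso k).symm
  have hL := PGL3.isLieSuperalgebra_of_superIso e
  have hf := PGL3.finrank_quotient_derived_of_superIso e
  have hs := PGL3.isSimpleSub_derived_of_superIso e
  exact ⟨hL, fun _ _ _ R => PGL3.nonempty_superIso_of_superIso R e, not_isSimpleSuper hL hf hs,
    hL.isGradedIdeal_derived, hf, hs, PGL3.exists_part_equiv_of_superIso rfl e⟩
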